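/- Let $m\ge 1$, and let $\mathbb{C}_m$ be the complex Clifford algebra generated by $e_1,\dots,e_m$ with $e_ie_j+e_je_i=-2\delta_{ij}$. Write $\underline{x}=\sum_j x_je_j=r\,\underline\omega$ with $r=|\underline x|$ for $\underline x\in\mathbb{R}^m$, and $\underline\partial=\sum_j e_j\partial_{x_j}$ for the Dirac operator. For $\lambda\in\mathbb{C}$ let $T_\lambda=\mathrm{Fp}\,r^\lambda$ and $U_\lambda=\mathrm{Fp}\,r^\lambda\underline\omega$ be the tempered distributions on $\mathbb{R}^m$ given by $$\langle T_\lambda,\varphi\rangle=\Big\langle \mathrm{Fp}\,r_+^{\lambda+m-1},\int_{S^{m-1}}\varphi(r\underline\omega)\,dS(\underline\omega)\Big\rangle,\qquad \langle U_\lambda,\varphi\rangle=\Big\langle \mathrm{Fp}\,r_+^{\lambda+m-1},\int_{S^{m-1}}\underline\omega\,\varphi(r\underline\omega)\,dS(\underline\omega)\Big\rangle,$$ where $\mathrm{Fp}$ is the Hadamard finite part. Their normalizations are $$T^*_\lambda=\frac{\pi^{(\lambda+m)/2}}{\Gamma(\frac{\lambda+m}{2})}T_\lambda\ \ (\lambda\ne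 -m-2l),\qquad T^*_{-m-2l}=\frac{\pi^{m/2-l}}{2^{2l}\Gamma(\frac m2+l)}(-\Delta)^l\delta,$$ $$U^*_\lambda=\frac{\pi^{(\lambda+m+1)/2}}{\Gamma(\frac{\lambda+m+1}{2})}U_\lambda\ \ (\lambda\ne -m-2l-1),\qquad U^*_{-m-2l-1}=-\frac{\pi^{m/2-l}}{2^{2l+1}\Gamma(\frac m2+l+1)}\underline\partial^{2l+1}\delta,$$ with $l=0,1,2,\dots$. For $\mu\in\mathbb{C}$, with $\mu\notin\{-m,-m-1,-m-2,\dots\}$ if $m$ is even, put $$\underline\partial^\mu\delta=\frac{1+e^{i\pi\mu}}{2}\,\frac{2^\mu\,\Gamma(\frac{m+\mu}{2})}{\pi^{(m-\mu)/2}}\,T^*_{-m-\mu}-\frac{1-e^{i\pi\mu}}{2}\,\frac{2^\mu\,\Gamma(\frac{m+\mu+1}{2})}{\pi^{(m-\mu+1)/2}}\,U^*_{-m-\mu}.$$ If $m$ is odd, one of the Gamma factors has a pole at each $\mu\in\{-m,-m-1,-m-2,\dots\}$; the factor $1\pm e^{i\pi\mu}$ in front of it vanishes there, and that term is omitted. Let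 $\mu,\nu\in\mathbb{C}$ and, if $m$ is even, suppose that $\mu$, $\nu$ and $\mu+\nu$ are all different from $-m,-m-1,-m-2,\dots$. Then $$\underline\partial^\mu\delta*\underline\partial^\nu\delta=\underline\partial^{\mu+\nu}\delta .$$ Here the convolution is understood through the exchange formula $\mathcal{F}(u*v)=\mathcal{F}u\cdot\mathcal{F}v$: the Fourier transforms $\mathcal{F}u=\mathrm{Fp}\,f$ and $\mathcal{F}v=\mathrm{Fp}\,g$ are finite parts of functions $f,g:\mathbb{R}^m\to\mathbb{C}_m$ that are continuous outside the origin, and their product is $\mathrm{Fp}(fg)$. Moreover, if $\operatorname{Re}(\mu+\nu)>-m$, or if $\mu$ or $\nu$ is a non-negative integer, the identity also holds for the ordinary convolution of tempered distributions: for all Schwartz functions $\varphi,\psi$ the convolution integral of $\underline\partial^\mu\delta*\varphi$ and $\underline\partial^\nu\delta*\psi$ converges absolutely, and $(\underline\partial^\mu\delta*\varphi)*(\underline\partial^\nu\delta*\psi)=(\underline\partial^{\mu+\nu}\delta*\varphi)*\psi$. -/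

import Mathlib

open MeasureTheory Filter Topology
open scoped SchwartzMap FourierTransform LineDeriv

noncomputable section

namespace DiracPowers

/-! ### The complex Clifford algebra -/

/-- The quadratic form `-∑ zⱼ²` on `ℂᵐ`. -/
def cliffordForm (m : ℕ) : QuadraticForm ℂ (Fin m → ℂ) :=
  QuadraticMap.weightedSumSquares ℂ (fun _ : Fin m => (-1 : ℂ))

/-- The complex Clifford algebra `ℂ ⊗ ℝ_{0,m}`, with generators satisfying
`eᵢ eⱼ + eⱼ eᵢ = -2 δᵢⱼ`. -/
def Cl (m : ℕ) : Type := CliffordAlgebra (cliffordForm m)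

instance (m : ℕ) : Ring (Cl m) := inferInstanceAs (Ring (CliffordAlgebra (cliffordForm m)))

instance (m : ℕ) : Algebra ℂ (Cl m) :=
  inferInstanceAs (Algebra ℂ (CliffordAlgebra (cliffordForm m)))

/-- The linear inclusion of `ℂᵐ` into the Clifford algebra. -/
def Cl.ι (m : ℕ) : (Fin m → ℂ) →ₗ[ℂ] Cl m := CliffordAlgebra.ι (cliffordForm m)

/-- The generators `e₁, …, e_m`. -/
def e {m : ℕ} (j : Fin m) : Cl m := Cl.ι m (Pi.single j 1)

theorem e_mul_e_add {m : ℕ} (i j : Fin m) :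
    (e i * e j + e j * e i : Cl m) = if i = j then -2 else 0 := by
  have h := CliffordAlgebra.ι_mul_ι_add_swap (Q := cliffordForm m)
    (Pi.single i (1 : ℂ)) (Pi.single j 1)
  have h2 : QuadraticMap.polar (cliffordForm m) (Pi.single i (1 : ℂ)) (Pi.single j 1)
      = if i = j then -2 else 0 := by
    simp only [QuadraticMap.polar, cliffordForm, QuadraticMap.weightedSumSquares_apply,
      ← Finset.sum_sub_distrib, Pi.add_apply]
    have key : ∀ x : Fin m, (-1 : ℂ) • (((Pi.single i (1 : ℂ) : Fin m → ℂ) x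
        + (Pi.single j (1 : ℂ) : Fin m → ℂ) x) * ((Pi.single i (1 : ℂ) : Fin m → ℂ) x
        + (Pi.single j (1 : ℂ) : Fin m → ℂ) x))
        - (-1 : ℂ) • ((Pi.single i (1 : ℂ) : Fin m → ℂ) x * (Pi.single i (1 : ℂ) : Fin m → ℂ) x)
        - (-1 : ℂ) • ((Pi.single j (1 : ℂ) : Fin m → ℂ) x * (Pi.single j (1 : ℂ) : Fin m → ℂ) x)
        = (Pi.single i (-2 * (Pi.single j (1 : ℂ) : Fin m → ℂ) i) : Fin m → ℂ) x := by
      intro x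
      by_cases hx : x = i
      · subst hx; simp; ring
      · simp [Pi.single_eq_of_ne hx]
    rw [Finset.sum_congr rfl (fun x _ => key x)]
    simp [Pi.single_apply]
  rw [h2] at h
  refine (show (e i * e j + e j * e i : Cl m) = _ from h).trans ?_
  split_ifs
  · exact (map_neg (algebraMap ℂ (Cl m)) 2).trans (by rw [map_ofNat])
  · exact map_zero (algebraMap ℂ (Cl m))

/-- Coordinates of the Clifford algebra in a basis indexed by the subsets of `{1, …, m}`. They serve
only to put a norm on this finite-dimensional space. -/
def Cl.coords (m : ℕ) : Cl m ≃ₗ[ℂ] (Finset (Fin m) → ℂ) :=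
  letI : Invertible (2 : ℂ) := invertibleOfNonzero two_ne_zero
  (show Cl m ≃ₗ[ℂ] ExteriorAlgebra ℂ (Fin m → ℂ) from
    CliffordAlgebra.equivExterior (cliffordForm m)).trans
    (Pi.basisFun ℂ (Fin m)).ExteriorAlgebra.equivFun

/-- A norm on the Clifford algebra; the space is finite-dimensional, so the choice is immaterial. -/
instance (m : ℕ) : NormedAddCommGroup (Cl m) :=
  NormedAddCommGroup.induced (Cl m) (Finset (Fin m) → ℂ) (Cl.coords m) (Cl.coords m).injective

instance (m : ℕ) : NormedSpace ℂ (Cl m) :=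
  NormedSpace.induced ℂ (Cl m) (Finset (Fin m) → ℂ) (Cl.coords m)

instance (m : ℕ) : FiniteDimensional ℂ (Cl m) := (Cl.coords m).symm.finiteDimensional

/-- The Euclidean space `ℝᵐ`. -/
abbrev Eu (m : ℕ) : Type := EuclideanSpace ℝ (Fin m)

/-- A point `x` of `ℝᵐ`, read as the Clifford vector `x₁ e₁ + ⋯ + x_m e_m`. -/
def vec {m : ℕ} (x : Eu m) : Cl m := ∑ j, ((x j : ℝ) : ℂ) • e j

theorem continuous_vec {m : ℕ} : Continuous (vec : Eu m → Cl m) := by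
  unfold vec
  fun_prop

/-! ### Finite parts on the half-line -/

section FpRay

variable {F : Type*} [NormedAddCommGroup F] [NormedSpace ℂ F]

/-- Number of Taylor terms subtracted in the finite part of `r ^ μ`. -/
def fpOrder (μ : ℂ) : ℕ := ⌈-μ.re⌉₊

/-- The Taylor remainder of `g` at `0`, with the first `n` terms subtracted. -/
def taylorRem (n : ℕ) (g : ℝ → F) (r : ℝ) : F :=
  g r - ∑ j ∈ Finset.range n, ((r ^ j / (j.factorial : ℝ) : ℝ) : ℂ) • iteratedDeriv j g 0

/-- The value `⟨Fp r₊^μ, g⟩` of the classical (Hadamard) finite part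
`Fp ∫₀^∞ r^μ g(r) dr`. The divergent integrals `∫₀¹ r^(μ+j) dr` contribute `1 / (μ + j + 1)`, and
nothing when `μ + j = -1` (this is the value `1 / 0 = 0` below). -/
def fpRayFun (μ : ℂ) (g : ℝ → F) : F :=
  (∫ r in Set.Ioc (0 : ℝ) 1, (r : ℂ) ^ μ • taylorRem (fpOrder μ) g r)
    + (∫ r in Set.Ioi (1 : ℝ), (r : ℂ) ^ μ • g r)
    + ∑ j ∈ Finset.range (fpOrder μ),
        (1 / ((j.factorial : ℂ) * (μ + j + 1))) • iteratedDeriv j g 0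

theorem norm_taylorRem_le (n : ℕ) (g : 𝓢(ℝ, F)) {r : ℝ} (hr : r ∈ Set.Icc (0 : ℝ) 1) :
    ‖taylorRem n g r‖ ≤ SchwartzMap.seminorm ℂ 0 n g * r ^ n := by
  have hder : ∀ k y, ‖iteratedDeriv k g y‖ ≤ SchwartzMap.seminorm ℂ 0 k g := by
    intro k y
    simpa using g.le_seminorm' ℂ 0 k y
  have hsm : ∀ k y, y ∈ Set.Icc (0 : ℝ) 1 →
      iteratedDerivWithin k g (Set.Icc 0 1) y = iteratedDeriv k g y := by
    intro k y hy
    exact iteratedDerivWithin_eq_iteratedDeriv (uniqueDiffOn_Icc zero_lt_one)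
      (g.smooth k).contDiffAt hy
  cases n with
  | zero => simpa [taylorRem] using hder 0 r
  | succ n =>
    have h := taylor_mean_remainder_bound (f := g) (n := n) (x := r) zero_le_one
      ((g.smooth (n + 1)).contDiffOn) hr (C := SchwartzMap.seminorm ℂ 0 (n + 1) g)
      (fun y hy => by rw [hsm _ y hy]; exact hder _ y)
    have h0 : (0 : ℝ) ∈ Set.Icc (0 : ℝ) 1 := by simp
    have heq : g r - taylorWithinEval g n (Set.Icc 0 1) 0 r = taylorRem (n + 1) g r := by
      rw [taylor_within_apply, taylorRem]
      congr 1
      refine Finset.sum_congr rfl fun k _ => ?_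
      rw [hsm k 0 h0, sub_zero, Complex.coe_smul, mul_comm, div_eq_mul_inv]
    rw [heq, sub_zero] at h
    refine h.trans ?_
    refine div_le_self (mul_nonneg (apply_nonneg _ _) (pow_nonneg hr.1 _)) ?_
    exact_mod_cast Nat.one_le_iff_ne_zero.mpr n.factorial_ne_zero

theorem continuous_taylorRem (n : ℕ) (g : 𝓢(ℝ, F)) : Continuous (taylorRem n g) := by
  have := g.continuous
  unfold taylorRem
  fun_prop

theorem continuousOn_cpow (μ : ℂ) : ContinuousOn (fun r : ℝ => (r : ℂ) ^ μ) (Set.Ioi 0) :=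
  fun r hr => (Complex.continuousAt_ofReal_cpow_const r μ (Or.inr (ne_of_gt hr))).continuousWithinAt

theorem norm_cpow_smul_taylorRem_le (μ : ℂ) (g : 𝓢(ℝ, F)) {r : ℝ} (hr : r ∈ Set.Ioc (0 : ℝ) 1) :
    ‖(r : ℂ) ^ μ • taylorRem (fpOrder μ) g r‖ ≤ SchwartzMap.seminorm ℂ 0 (fpOrder μ) g := by
  rw [norm_smul, Complex.norm_cpow_eq_rpow_re_of_pos hr.1]
  have h := norm_taylorRem_le (fpOrder μ) g (Set.Ioc_subset_Icc_self hr)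
  have hS : 0 ≤ SchwartzMap.seminorm ℂ 0 (fpOrder μ) g := apply_nonneg _ _
  calc r ^ μ.re * ‖taylorRem (fpOrder μ) g r‖
      ≤ r ^ μ.re * (SchwartzMap.seminorm ℂ 0 (fpOrder μ) g * r ^ (fpOrder μ)) := by
        gcongr
        exact Real.rpow_nonneg hr.1.le _
    _ = SchwartzMap.seminorm ℂ 0 (fpOrder μ) g * r ^ (μ.re + fpOrder μ) := by
        rw [Real.rpow_add hr.1, Real.rpow_natCast]; ring
    _ ≤ SchwartzMap.seminorm ℂ 0 (fpOrder μ) g * 1 := by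
        gcongr
        refine Real.rpow_le_one hr.1.le hr.2 ?_
        have := Nat.le_ceil (-μ.re)
        unfold fpOrder
        linarith
    _ = _ := mul_one _

theorem integrableOn_cpow_smul_taylorRem (μ : ℂ) (g : 𝓢(ℝ, F)) :
    IntegrableOn (fun r : ℝ => (r : ℂ) ^ μ • taylorRem (fpOrder μ) g r) (Set.Ioc 0 1) := by
  refine Integrable.mono' (g := fun _ => SchwartzMap.seminorm ℂ 0 (fpOrder μ) g)
    (integrableOn_const (by simp)) ?_ ?_
  · refine ContinuousOn.aestronglyMeasurable ?_ measurableSet_Ioc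
    exact ((continuousOn_cpow μ).mono (fun r hr => hr.1)).smul
      (continuous_taylorRem _ g).continuousOn
  · exact (ae_restrict_iff' measurableSet_Ioc).2
      (Eventually.of_forall fun r hr => norm_cpow_smul_taylorRem_le μ g hr)

/-- A decay exponent for Schwartz functions that beats `r ^ μ` at infinity. -/
def fpDecay (μ : ℂ) : ℕ := ⌈μ.re⌉₊ + 2

theorem norm_cpow_smul_le (μ : ℂ) (g : 𝓢(ℝ, F)) {r : ℝ} (hr : r ∈ Set.Ioi (1 : ℝ)) :
    ‖(r : ℂ) ^ μ • g r‖ ≤ SchwartzMap.seminorm ℂ (fpDecay μ) 0 g * r ^ (-2 : ℝ) := by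
  have hr0 : 0 < r := zero_lt_one.trans hr
  rw [norm_smul, Complex.norm_cpow_eq_rpow_re_of_pos hr0]
  have h : r ^ (fpDecay μ) * ‖g r‖ ≤ SchwartzMap.seminorm ℂ (fpDecay μ) 0 g := by
    simpa [abs_of_pos hr0] using g.le_seminorm' ℂ (fpDecay μ) 0 r
  have hle : r ^ μ.re ≤ r ^ (fpDecay μ) * r ^ (-2 : ℝ) := by
    rw [← Real.rpow_natCast, ← Real.rpow_add hr0]
    refine Real.rpow_le_rpow_of_exponent_le (le_of_lt hr) ?_
    have := Nat.le_ceil (μ.re)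
    unfold fpDecay
    push_cast
    linarith
  calc r ^ μ.re * ‖g r‖ ≤ (r ^ (fpDecay μ) * r ^ (-2 : ℝ)) * ‖g r‖ := by gcongr
    _ = (r ^ (fpDecay μ) * ‖g r‖) * r ^ (-2 : ℝ) := by ring
    _ ≤ _ := by gcongr

theorem integrableOn_rpow_neg_two : IntegrableOn (fun r : ℝ => r ^ (-2 : ℝ)) (Set.Ioi 1) :=
  integrableOn_Ioi_rpow_of_lt (by norm_num) zero_lt_one

theorem integrableOn_cpow_smul (μ : ℂ) (g : 𝓢(ℝ, F)) :
    IntegrableOn (fun r : ℝ => (r : ℂ) ^ μ • g r) (Set.Ioi 1) := by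
  refine Integrable.mono' (integrableOn_rpow_neg_two.const_mul
    (SchwartzMap.seminorm ℂ (fpDecay μ) 0 g)) ?_ ?_
  · refine ContinuousOn.aestronglyMeasurable ?_ measurableSet_Ioi
    exact ((continuousOn_cpow μ).mono (Set.Ioi_subset_Ioi zero_le_one)).smul
      g.continuous.continuousOn
  · exact (ae_restrict_iff' measurableSet_Ioi).2
      (Eventually.of_forall fun r hr => norm_cpow_smul_le μ g hr)

theorem iteratedDeriv_add_schwartz (f g : 𝓢(ℝ, F)) (j : ℕ) (x : ℝ) :
    iteratedDeriv j (f + g : 𝓢(ℝ, F)) x = iteratedDeriv j f x + iteratedDeriv j g x :=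
  iteratedDeriv_add (f.smooth j).contDiffAt (g.smooth j).contDiffAt

theorem iteratedDeriv_smul_schwartz (a : ℂ) (f : 𝓢(ℝ, F)) (j : ℕ) (x : ℝ) :
    iteratedDeriv j (a • f : 𝓢(ℝ, F)) x = a • iteratedDeriv j f x :=
  iteratedDeriv_const_smul_field a (f : ℝ → F)

theorem taylorRem_add (n : ℕ) (f g : 𝓢(ℝ, F)) (r : ℝ) :
    taylorRem n (f + g : 𝓢(ℝ, F)) r = taylorRem n f r + taylorRem n g r := by
  simp only [taylorRem, iteratedDeriv_add_schwartz, smul_add, Finset.sum_add_distrib,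
    add_apply]
  abel

theorem taylorRem_smul (n : ℕ) (a : ℂ) (f : 𝓢(ℝ, F)) (r : ℝ) :
    taylorRem n (a • f : 𝓢(ℝ, F)) r = a • taylorRem n f r := by
  simp only [taylorRem, iteratedDeriv_smul_schwartz, smul_sub, Finset.smul_sum,
    smul_apply]
  congr 1
  exact Finset.sum_congr rfl fun k _ => smul_comm _ _ _

theorem fpRayFun_add (μ : ℂ) (f g : 𝓢(ℝ, F)) :
    fpRayFun μ (f + g : 𝓢(ℝ, F)) = fpRayFun μ f + fpRayFun μ g := by
  simp only [fpRayFun, taylorRem_add, iteratedDeriv_add_schwartz, smul_add,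
    Finset.sum_add_distrib, add_apply]
  rw [integral_add (integrableOn_cpow_smul_taylorRem μ f) (integrableOn_cpow_smul_taylorRem μ g),
    integral_add (integrableOn_cpow_smul μ f) (integrableOn_cpow_smul μ g)]
  abel

theorem fpRayFun_smul (μ a : ℂ) (f : 𝓢(ℝ, F)) :
    fpRayFun μ (a • f : 𝓢(ℝ, F)) = a • fpRayFun μ f := by
  simp only [fpRayFun, taylorRem_smul, iteratedDeriv_smul_schwartz, smul_add, Finset.smul_sum,
    smul_apply]
  simp only [smul_comm _ a]
  rw [integral_smul, integral_smul]

/-- The tempered distribution `Fp r₊^μ` on the real line, acting on `F`-valued functions. -/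
def fpRay (μ : ℂ) : 𝓢(ℝ, F) →L[ℂ] F :=
  SchwartzMap.mkCLMtoNormedSpace (σ := RingHom.id ℂ) (fun g => fpRayFun μ g)
    (fpRayFun_add μ) (fun a f => fpRayFun_smul μ a f) <| by
    classical
    set S : Finset (ℕ × ℕ) :=
      {(fpDecay μ, 0)} ∪ (Finset.range (fpOrder μ + 1)).image (fun j => (0, j)) with hS
    set I : ℝ := ∫ r in Set.Ioi (1 : ℝ), r ^ (-2 : ℝ) with hI
    set D : ℝ := ∑ j ∈ Finset.range (fpOrder μ), ‖1 / ((j.factorial : ℂ) * (μ + j + 1))‖ with hD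
    have hI0 : 0 ≤ I := setIntegral_nonneg measurableSet_Ioi fun r hr =>
      Real.rpow_nonneg (zero_le_one.trans (le_of_lt hr)) _
    have hD0 : 0 ≤ D := Finset.sum_nonneg fun _ _ => norm_nonneg _
    refine ⟨S, 1 + I + D, by positivity, fun g => ?_⟩
    have hmem : ∀ p ∈ S, SchwartzMap.seminorm ℂ p.1 p.2 g ≤ S.sup (schwartzSeminormFamily ℂ ℝ F) g :=
      fun p hp => (Finset.le_sup (f := schwartzSeminormFamily ℂ ℝ F) hp) g
    have h0 : ∀ j ≤ fpOrder μ, SchwartzMap.seminorm ℂ 0 j g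
        ≤ S.sup (schwartzSeminormFamily ℂ ℝ F) g := by
      intro j hj
      refine hmem (0, j) ?_
      rw [hS, Finset.mem_union, Finset.mem_image]
      exact Or.inr ⟨j, Finset.mem_range.2 (Nat.lt_succ_of_le hj), rfl⟩
    have h1 : SchwartzMap.seminorm ℂ (fpDecay μ) 0 g ≤ S.sup (schwartzSeminormFamily ℂ ℝ F) g :=
      hmem (fpDecay μ, 0) (by rw [hS]; simp)
    set p := S.sup (schwartzSeminormFamily ℂ ℝ F) g with hp
    have A1 : ‖∫ r in Set.Ioc (0 : ℝ) 1, (r : ℂ) ^ μ • taylorRem (fpOrder μ) g r‖ ≤ p := by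
      have := norm_setIntegral_le_of_norm_le_const (μ := volume) (s := Set.Ioc (0 : ℝ) 1)
        (f := fun r : ℝ => (r : ℂ) ^ μ • taylorRem (fpOrder μ) g r) (C := p) (by simp)
        (fun r hr => (norm_cpow_smul_taylorRem_le μ g hr).trans (h0 _ le_rfl))
      simpa using this
    have A2 : ‖∫ r in Set.Ioi (1 : ℝ), (r : ℂ) ^ μ • g r‖ ≤ p * I := by
      rw [hI, ← integral_const_mul]
      refine norm_integral_le_of_norm_le (integrableOn_rpow_neg_two.const_mul p) ?_
      refine (ae_restrict_iff' measurableSet_Ioi).2 (Eventually.of_forall fun r hr => ?_)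
      refine (norm_cpow_smul_le μ g hr).trans ?_
      have : 0 ≤ r ^ (-2 : ℝ) := Real.rpow_nonneg (zero_le_one.trans (le_of_lt hr)) _
      gcongr
    have A3 : ‖∑ j ∈ Finset.range (fpOrder μ),
        (1 / ((j.factorial : ℂ) * (μ + j + 1))) • iteratedDeriv j g 0‖ ≤ D * p := by
      refine (norm_sum_le _ _).trans ?_
      rw [hD, Finset.sum_mul]
      refine Finset.sum_le_sum fun j hj => ?_
      rw [norm_smul]
      refine mul_le_mul_of_nonneg_left ?_ (norm_nonneg _)
      refine le_trans ?_ (h0 j (Finset.mem_range.1 hj).le)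
      simpa using g.le_seminorm' ℂ 0 j 0
    have h := (norm_add₃_le (a := ∫ r in Set.Ioc (0 : ℝ) 1, (r : ℂ) ^ μ • taylorRem (fpOrder μ) g r)
      (b := ∫ r in Set.Ioi (1 : ℝ), (r : ℂ) ^ μ • g r)
      (c := ∑ j ∈ Finset.range (fpOrder μ),
        (1 / ((j.factorial : ℂ) * (μ + j + 1))) • iteratedDeriv j g 0))
    calc ‖fpRayFun μ g‖ ≤ _ := h
      _ ≤ p + p * I + D * p := by gcongr
      _ = (1 + I + D) * p := by ring

end FpRay

/-! ### Spherical means -/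

section SphericalMean

variable {m : ℕ}

/-- The unit sphere `S^{m-1}`. -/
abbrev Sph (m : ℕ) : Type := Metric.sphere (0 : Eu m) 1

/-- The surface measure `dS(ω)` on the unit sphere. -/
def surface (m : ℕ) : Measure (Sph m) := (volume : Measure (Eu m)).toSphere

instance (m : ℕ) : IsFiniteMeasure (surface m) := by unfold surface; infer_instance

/-- `∫_{S^{m-1}} h(ω) φ(r ω) dS(ω)`. -/
def sphereIntegral (h : Sph m → Cl m) (φ : 𝓢(Eu m, ℂ)) (r : ℝ) : Cl m :=
  ∫ ω, φ (r • (ω : Eu m)) • h ω ∂(surface m)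

theorem iteratedDeriv_radial (φ : 𝓢(Eu m, ℂ)) (ω : Eu m) (j : ℕ) (r : ℝ) :
    iteratedDeriv j (fun s : ℝ => φ (s • ω)) r
      = iteratedFDeriv ℝ j φ (r • ω) (fun _ => ω) := by
  have h := ContinuousLinearMap.iteratedFDeriv_comp_right (i := j)
    (ContinuousLinearMap.toSpanSingleton ℝ ω) (φ.smooth j) r le_rfl
  rw [iteratedDeriv_eq_iteratedFDeriv]
  have h' : (fun s : ℝ => φ (s • ω)) = φ ∘ (ContinuousLinearMap.toSpanSingleton ℝ ω) := by
    ext s; simp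
  rw [h', h]
  simp

theorem norm_iteratedDeriv_radial_le (φ : 𝓢(Eu m, ℂ)) (ω : Sph m) (k j : ℕ) (r : ℝ) :
    |r| ^ k * ‖iteratedDeriv j (fun s : ℝ => φ (s • (ω : Eu m))) r‖
      ≤ SchwartzMap.seminorm ℂ k j φ := by
  have hω : ‖(ω : Eu m)‖ = 1 := by simp
  rw [iteratedDeriv_radial]
  have h1 := (iteratedFDeriv ℝ j φ (r • (ω : Eu m))).le_opNorm (fun _ => (ω : Eu m))
  simp only [hω, Finset.prod_const_one, mul_one] at h1
  have h2 := φ.le_seminorm ℂ k j (r • (ω : Eu m))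
  rw [norm_smul, hω, mul_one, Real.norm_eq_abs] at h2
  exact (mul_le_mul_of_nonneg_left h1 (by positivity)).trans h2

theorem continuous_iteratedDeriv_radial (φ : 𝓢(Eu m, ℂ)) (j : ℕ) (r : ℝ) :
    Continuous (fun ω : Sph m => iteratedDeriv j (fun s : ℝ => φ (s • (ω : Eu m))) r) := by
  simp only [iteratedDeriv_radial]
  have h : Continuous (iteratedFDeriv ℝ j φ) := (φ.smooth j).continuous_iteratedFDeriv le_rfl
  fun_prop

/-- The radial derivatives of a spherical integral. -/
theorem hasDerivAt_sphereIntegral {h : Sph m → Cl m} (hh : Continuous h) (φ : 𝓢(Eu m, ℂ))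
    (j : ℕ) (r : ℝ) :
    HasDerivAt
      (fun r => ∫ ω, iteratedDeriv j (fun s : ℝ => φ (s • (ω : Eu m))) r • h ω ∂(surface m))
      (∫ ω, iteratedDeriv (j + 1) (fun s : ℝ => φ (s • (ω : Eu m))) r • h ω ∂(surface m)) r := by
  have hc : ∀ k x, Continuous
      (fun ω : Sph m => iteratedDeriv k (fun s : ℝ => φ (s • (ω : Eu m))) x • h ω) :=
    fun k x => (continuous_iteratedDeriv_radial φ k x).smul hh
  have hint : ∀ {f : Sph m → Cl m}, Continuous f → Integrable f (surface m) := fun hf =>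
    hf.integrable_of_hasCompactSupport (HasCompactSupport.of_compactSpace _)
  have hb : Integrable (fun ω => SchwartzMap.seminorm ℂ 0 (j + 1) φ * ‖h ω‖) (surface m) :=
    ((hint hh).norm).const_mul _
  refine (hasDerivAt_integral_of_dominated_loc_of_deriv_le (s := Set.univ)
    (F := fun x (ω : Sph m) => iteratedDeriv j (fun s : ℝ => φ (s • (ω : Eu m))) x • h ω)
    (F' := fun x (ω : Sph m) => iteratedDeriv (j + 1) (fun s : ℝ => φ (s • (ω : Eu m))) x • h ω) univ_mem
    (Eventually.of_forall fun x => (hint (hc j x)).aestronglyMeasurable) (hint (hc j r))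
    (hint (hc (j + 1) r)).aestronglyMeasurable
    (Eventually.of_forall fun ω x _ => ?_) hb (Eventually.of_forall fun ω x _ => ?_)).2
  · rw [norm_smul]
    gcongr
    simpa using norm_iteratedDeriv_radial_le φ ω 0 (j + 1) x
  · rw [iteratedDeriv_succ]
    refine HasDerivAt.smul_const ?_ (h ω)
    refine DifferentiableAt.hasDerivAt ?_
    have hsm : ContDiff ℝ (j + 1) (fun s : ℝ => φ (s • (ω : Eu m))) :=
      (φ.smooth (j + 1)).comp (contDiff_id.smul contDiff_const)
    exact (hsm.differentiable_iteratedDeriv j (by exact_mod_cast Nat.lt_succ_self j)) x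

theorem iteratedDeriv_sphereIntegral {h : Sph m → Cl m} (hh : Continuous h) (φ : 𝓢(Eu m, ℂ))
    (j : ℕ) :
    iteratedDeriv j (sphereIntegral h φ)
      = fun r => ∫ ω, iteratedDeriv j (fun s : ℝ => φ (s • (ω : Eu m))) r • h ω ∂(surface m) := by
  induction j with
  | zero => ext r; simp [sphereIntegral]
  | succ j ih =>
    rw [iteratedDeriv_succ, ih]
    ext r
    exact (hasDerivAt_sphereIntegral hh φ j r).deriv

theorem contDiff_sphereIntegral {h : Sph m → Cl m} (hh : Continuous h) (φ : 𝓢(Eu m, ℂ)) :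
    ContDiff ℝ (⊤ : ℕ∞) (sphereIntegral h φ) := by
  refine contDiff_of_differentiable_iteratedDeriv fun j _ => ?_
  rw [iteratedDeriv_sphereIntegral hh φ j]
  exact fun r => (hasDerivAt_sphereIntegral hh φ j r).differentiableAt

theorem integrable_sphere {h : Sph m → Cl m} (hh : Continuous h) (φ : 𝓢(Eu m, ℂ)) (r : ℝ) :
    Integrable (fun ω : Sph m => φ (r • (ω : Eu m)) • h ω) (surface m) := by
  have := φ.continuous
  have hc : Continuous (fun ω : Sph m => φ (r • (ω : Eu m)) • h ω) := by fun_prop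
  exact hc.integrable_of_hasCompactSupport (HasCompactSupport.of_compactSpace _)

/-- The (unnormalised) generalised spherical mean `φ ↦ (r ↦ ∫_{S^{m-1}} h(ω) φ(r ω) dS(ω))` as a
continuous linear map from Schwartz functions on `ℝᵐ` to Schwartz functions of `r ∈ ℝ`. -/
def sphericalMean (h : C(Sph m, Cl m)) : 𝓢(Eu m, ℂ) →L[ℂ] 𝓢(ℝ, Cl m) :=
  SchwartzMap.mkCLM (σ := RingHom.id ℂ) (fun φ => sphereIntegral h φ)
    (fun f g r => by
      simp only [sphereIntegral, add_apply, add_smul]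
      exact integral_add (integrable_sphere h.continuous f r) (integrable_sphere h.continuous g r))
    (fun a f r => by
      simp only [sphereIntegral, smul_apply, smul_assoc, RingHom.id_apply]
      exact integral_smul a _)
    (fun φ => contDiff_sphereIntegral h.continuous φ) <| by
    rintro ⟨k, j⟩
    refine ⟨{(k, j)}, ∫ ω, ‖h ω‖ ∂(surface m), integral_nonneg fun _ => norm_nonneg _,
      fun φ r => ?_⟩
    have hint : Integrable (fun ω => ‖h ω‖) (surface m) :=
      (h.continuous.norm).integrable_of_hasCompactSupport (HasCompactSupport.of_compactSpace _)
    simp only [Finset.sup_singleton, SchwartzMap.schwartzSeminormFamily_apply]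
    rw [norm_iteratedFDeriv_eq_norm_iteratedDeriv, iteratedDeriv_sphereIntegral h.continuous,
      Real.norm_eq_abs, mul_comm (∫ ω, ‖h ω‖ ∂(surface m)), ← integral_const_mul]
    have hk : 0 ≤ |r| ^ k := by positivity
    calc |r| ^ k * ‖∫ ω, iteratedDeriv j (fun s : ℝ => φ (s • (ω : Eu m))) r • h ω ∂(surface m)‖
        = ‖∫ ω, (|r| ^ k) • (iteratedDeriv j (fun s : ℝ => φ (s • (ω : Eu m))) r • h ω)
            ∂(surface m)‖ := by
          rw [integral_smul, norm_smul, Real.norm_of_nonneg hk]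
      _ ≤ ∫ ω, SchwartzMap.seminorm ℂ k j φ * ‖h ω‖ ∂(surface m) := by
          refine norm_integral_le_of_norm_le (hint.const_mul _)
            (Eventually.of_forall fun ω => ?_)
          rw [norm_smul, norm_smul, Real.norm_of_nonneg hk, ← mul_assoc]
          gcongr
          exact norm_iteratedDeriv_radial_le φ ω k j r

end SphericalMean

/-! ### The distributions `T_λ`, `U_λ` and their normalisations -/

/-- Clifford-valued tempered distributions on `ℝᵐ`. -/
abbrev ClDistribution (m : ℕ) : Type := 𝓢'(Eu m, Cl m)

/-- `T_λ = Fp r^λ`: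
`⟨T_λ, φ⟩ = ⟨Fp r₊^(λ+m-1), ∫_{S^{m-1}} φ(r ω) dS(ω)⟩`. -/
def T (m : ℕ) (lam : ℂ) : ClDistribution m :=
  ContinuousLinearMap.toPointwiseConvergenceCLM _ _ _ _
    ((fpRay (lam + m - 1)).comp (sphericalMean (ContinuousMap.const (Sph m) (1 : Cl m))))

/-- `U_λ = Fp r^λ ω`:
`⟨U_λ, φ⟩ = ⟨Fp r₊^(λ+m-1), ∫_{S^{m-1}} ω φ(r ω) dS(ω)⟩`. -/
def U (m : ℕ) (lam : ℂ) : ClDistribution m :=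
  ContinuousLinearMap.toPointwiseConvergenceCLM _ _ _ _
    ((fpRay (lam + m - 1)).comp
      (sphericalMean ⟨fun ω : Sph m => vec (ω : Eu m), continuous_vec.comp continuous_subtype_val⟩))

/-- Left multiplication of a Clifford-valued distribution by a Clifford number. -/
def leftMul {m : ℕ} (a : Cl m) (u : ClDistribution m) : ClDistribution m :=
  PointwiseConvergenceCLM.postcomp (𝓢(Eu m, ℂ))
    (LinearMap.toContinuousLinearMap (LinearMap.mulLeft ℂ a)) u

/-- The Dirac operator `∑ eⱼ ∂_{xⱼ}` on Clifford-valued distributions. -/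
def dirac {m : ℕ} (u : ClDistribution m) : ClDistribution m :=
  ∑ j : Fin m, leftMul (e j) (∂_{EuclideanSpace.single j (1 : ℝ)} u)

/-- The Dirac distribution `δ`, with values in the Clifford algebra. -/
def delta (m : ℕ) : ClDistribution m :=
  PointwiseConvergenceCLM.postcomp (𝓢(Eu m, ℂ))
    (ContinuousLinearMap.toSpanSingleton ℂ (1 : Cl m)) (TemperedDistribution.delta (0 : Eu m))

open Classical in
/-- The normalised scalar distributions `T*_λ`. -/
def TStar (m : ℕ) (lam : ℂ) : ClDistribution m :=
  if h : ∃ l : ℕ, lam = -m - 2 * l then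
    ((Real.pi : ℂ) ^ ((m : ℂ) / 2 - h.choose)
        / (2 ^ (2 * h.choose) * Complex.Gamma ((m : ℂ) / 2 + h.choose))) •
      (fun u : ClDistribution m => -Laplacian.laplacian u)^[h.choose] (delta m)
  else
    ((Real.pi : ℂ) ^ ((lam + m) / 2) / Complex.Gamma ((lam + m) / 2)) • T m lam

open Classical in
/-- The normalised vector-valued distributions `U*_λ`. -/
def UStar (m : ℕ) (lam : ℂ) : ClDistribution m :=
  if h : ∃ l : ℕ, lam = -m - 2 * l - 1 then
    (-((Real.pi : ℂ) ^ ((m : ℂ) / 2 - h.choose)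
        / (2 ^ (2 * h.choose + 1) * Complex.Gamma ((m : ℂ) / 2 + h.choose + 1)))) •
      dirac^[2 * h.choose + 1] (delta m)
  else
    ((Real.pi : ℂ) ^ ((lam + m + 1) / 2) / Complex.Gamma ((lam + m + 1) / 2)) • U m lam

/-- The kernel `∂^μ δ` of the complex power `∂^μ` of the Dirac operator.

For odd `m` and `μ = -m, -m-2, …` the factor `1 + exp(iπμ)` is zero, and for odd `m` and
`μ = -m-1, -m-3, …` the factor `1 - exp(iπμ)` is zero: the corresponding term is then absent, so that
the negative integer powers are given by a single term. For even `m` the formula defines the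
kernel only for `μ ≠ -m, -m-1, -m-2, …`. -/
def diracPow (m : ℕ) (μ : ℂ) : ClDistribution m :=
  ((1 + Complex.exp (Complex.I * Real.pi * μ)) / 2 *
      ((2 : ℂ) ^ μ * Complex.Gamma ((m + μ) / 2) / (Real.pi : ℂ) ^ ((m - μ) / 2))) •
    TStar m (-m - μ)
  - ((1 - Complex.exp (Complex.I * Real.pi * μ)) / 2 *
      ((2 : ℂ) ^ μ * Complex.Gamma ((m + μ + 1) / 2) / (Real.pi : ℂ) ^ ((m - μ + 1) / 2))) •
    UStar m (-m - μ)

/-! ### Convolution -/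

/-- Hadamard finite part of `I ε` as `ε → 0+`: after removing finitely many terms
`aₚ ε^(-z) (log ε)^k`, with `Re z ≥ 0` and `(z, k) ≠ (0, 0)`, the rest tends to `c`. -/
def HasFinitePart {F : Type*} [NormedAddCommGroup F] [NormedSpace ℂ F] (I : ℝ → F) (c : F) : Prop :=
  ∃ (s : Finset (ℂ × ℕ)) (a : ℂ × ℕ → F), (∀ p ∈ s, 0 ≤ p.1.re ∧ p ≠ (0, 0)) ∧
    Tendsto (fun ε : ℝ => I ε - ∑ p ∈ s, ((ε : ℂ) ^ (-p.1) * (Real.log ε : ℂ) ^ p.2) • a p)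
      (𝓝[>] 0) (𝓝 c)

/-- `u` is the finite part distribution `Fp f` on `ℝᵐ` of a function `f` that may be singular at the
origin: `⟨u, φ⟩` is the finite part of `∫_{‖ξ‖ > ε} f(ξ) φ(ξ) dξ`. -/
def IsFinitePart {m : ℕ} (f : Eu m → Cl m) (u : ClDistribution m) : Prop :=
  ∀ φ : 𝓢(Eu m, ℂ),
    (∀ ε : ℝ, 0 < ε → IntegrableOn (fun ξ => φ ξ • f ξ) {ξ | ε < ‖ξ‖}) ∧
    HasFinitePart (fun ε : ℝ => ∫ ξ in {ξ | ε < ‖ξ‖}, φ ξ • f ξ) (u φ)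

/-- `u ∗ v = w` in the sense of the exchange formula `𝓕(u ∗ v) = 𝓕u · 𝓕v`, for distributions whose
Fourier transforms are finite parts of functions `f`, `g` that are continuous outside the origin;
the product of `Fp f` and `Fp g` is `Fp (f g)`, with the Clifford product in this order. As `f` and
`g` are determined by `u` and `v` outside the origin, `u` and `v` determine `w`. -/
def IsConvolution {m : ℕ} (u v w : ClDistribution m) : Prop :=
  ∃ f g : Eu m → Cl m, ContinuousOn f {0}ᶜ ∧ ContinuousOn g {0}ᶜ ∧
    IsFinitePart f (𝓕 u) ∧ IsFinitePart g (𝓕 v) ∧ IsFinitePart (fun ξ => f ξ * g ξ) (𝓕 w)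

/-- The test function `y ↦ φ (x - y)`. -/
def reflTranslate {m : ℕ} (x : Eu m) : 𝓢(Eu m, ℂ) →L[ℂ] 𝓢(Eu m, ℂ) :=
  SchwartzMap.compCLMOfAntilipschitz (g := fun y : Eu m => x - y) (K := 1) ℂ (by fun_prop)
    (fun _ _ => by simp [edist_dist, dist_eq_norm, norm_sub_rev])

/-- The regularisation `(u ∗ φ)(x) = ⟨u, φ(x - ·)⟩`. -/
def regularize {m : ℕ} (u : ClDistribution m) (φ : 𝓢(Eu m, ℂ)) (x : Eu m) : Cl m :=
  u (reflTranslate x φ)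

/-- `u ∗ v = w` in the ordinary sense: for all test functions `φ`, `ψ` the convolution integral of
the functions `u ∗ φ` and `v ∗ ψ` converges absolutely, and `(u ∗ φ) ∗ (v ∗ ψ) = (w ∗ φ) ∗ ψ`. (By
translating `φ` it is enough to have this at the origin.) -/
def IsOrdinaryConvolution {m : ℕ} (u v w : ClDistribution m) : Prop :=
  ∀ φ ψ : 𝓢(Eu m, ℂ),
    Integrable (fun y => regularize u φ (-y) * regularize v ψ y) ∧
    ∫ y, regularize u φ (-y) * regularize v ψ y = ∫ y, ψ y • regularize w φ (-y)

end DiracPowers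

end

noncomputable section

namespace DiracPowers

/-! ### The Clifford algebra as a topological algebra -/

/-! With the Fourier transform normalised by `exp (-2πi⟨x, ξ⟩)`, the Dirac operator becomes left
multiplication by 2πi ξ = 2π|ξ| · iω, where ω = ξ/|ξ|. Since ω² = -1, iω is an involution and P± =
(1 ± iω)/2 are complementary idempotents. The transform of ∂^μ δ turns out to be the finite part of
(2π|ξ|)^μ (P₊ + e^{iπμ} P₋), which is `symbol`. Orthogonality of the idempotents makes this
multiplicative in μ away from the origin (`symbol_mul`). The exchange-formula statement then follows
from `fourier_diracPow` and `isFinitePart_homDist`.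

The transform is found on the homogeneous distributions Fp r^λ ω^k with k = 0, 1
(`homDist_fourier`). In the strip -m < Re μ < 0, both sides are integrals against locally integrable
functions and are compared by writing powers of |ξ| as Mellin transforms of Gaussians; holomorphy
extends the identity to all μ outside a discrete set of integers. The excluded exponents come in two
families. At μ = k + 2l the normalised distribution is a derivative of δ and is transformed
directly. At μ = -m - j with j + k even, admissibility forces m odd, and the parity factor (1 ±
e^{iπμ})/2 vanishes (`regularAt_or_parityFactor_eq_zero`).

For the ordinary convolution with neither exponent a natural number, each parity part is a multiple
of some Fp r^λ ω^k. Regularising by a test function gives growth at most (1 + |x|)^σ for every σ >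
Re λ, locally uniformly in λ (`norm_regularize_homDist_le`). With λ = -m - μ and λ' = -m - ν, the
condition Re(μ + ν) > -m says Re(λ + λ') < -m, so the convolution integral converges and is
holomorphic in μ along the line μ + ν = s. Where Re μ > 0 and Re ν > -m, it is evaluated by Fourier
inversion, and the identity theorem gives the rest (`integral_regularize_mul`).

If μ is a natural number, induction on μ uses ∂⁰δ = δ and ∂ ∂^μ δ = ∂^{μ+1} δ (`dirac_diracPow`),
starting from the symmetry (w ∗ φ) ∗ ψ = (w ∗ ψ) ∗ φ. If ν is a natural number, the reversal
anti-automorphism, which fixes all values of these kernels, exchanges the two factors. -/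

instance (m : ℕ) : CompleteSpace (Cl m) := FiniteDimensional.complete ℂ (Cl m)

/-- The Clifford product as a continuous bilinear map. -/
def mulCLM (m : ℕ) : Cl m →L[ℂ] Cl m →L[ℂ] Cl m :=
  LinearMap.toContinuousLinearMap
    ((LinearMap.toContinuousLinearMap : (Cl m →ₗ[ℂ] Cl m) ≃ₗ[ℂ] (Cl m →L[ℂ] Cl m)).toLinearMap
      ∘ₗ LinearMap.mul ℂ (Cl m))

@[simp] theorem mulCLM_apply {m : ℕ} (a b : Cl m) : mulCLM m a b = a * b := rfl

/-- The norm is transported from coordinates and need not be submultiplicative, hence the extra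
constant. -/
theorem norm_mul_le_mulCLM {m : ℕ} (a b : Cl m) : ‖a * b‖ ≤ ‖mulCLM m‖ * ‖a‖ * ‖b‖ :=
  (mulCLM m).le_opNorm₂ a b

instance (m : ℕ) : ContinuousMul (Cl m) where
  continuous_mul := (mulCLM m).continuous₂

theorem vec_smul {m : ℕ} (r : ℝ) (x : Eu m) : vec (r • x) = (r : ℂ) • vec x := by
  simp [vec, Finset.smul_sum, mul_smul]

theorem vec_neg {m : ℕ} (x : Eu m) : vec (-x) = -vec x := by
  simp [vec]

theorem vec_eq_iota {m : ℕ} (x : Eu m) : vec x = Cl.ι m (fun j => ((x j : ℝ) : ℂ)) := by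
  have : (fun j => ((x j : ℝ) : ℂ)) = ∑ j, ((x j : ℝ) : ℂ) • (Pi.single j (1 : ℂ) : Fin m → ℂ) := by
    ext i
    simp [Pi.single_apply]
  rw [this, map_sum]
  simp [vec, e]

/-- The source of all the algebra below: unit vectors square to -1, so i times a unit vector is an
involution. -/
theorem vec_mul_vec {m : ℕ} (x : Eu m) : vec x * vec x = (-((‖x‖ : ℂ) ^ 2)) • (1 : Cl m) := by
  have h := CliffordAlgebra.ι_sq_scalar (cliffordForm m) (fun j => ((x j : ℝ) : ℂ))
  have h2 : cliffordForm m (fun j => ((x j : ℝ) : ℂ)) = -((‖x‖ : ℂ) ^ 2) := by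
    rw [← Complex.ofReal_pow, EuclideanSpace.norm_sq_eq]
    simp [cliffordForm, QuadraticMap.weightedSumSquares_apply, pow_two]
  rw [vec_eq_iota]
  refine (show _ = _ from h).trans ?_
  rw [h2]
  exact Algebra.algebraMap_eq_smul_one (A := Cl m) _

theorem norm_vec_le {m : ℕ} : ∃ K : ℝ, 0 ≤ K ∧ ∀ x : Eu m, ‖(vec x : Cl m)‖ ≤ K * ‖x‖ := by
  refine ⟨∑ j : Fin m, ‖(e j : Cl m)‖, by positivity, fun x => ?_⟩
  unfold vec
  refine (norm_sum_le _ _).trans ?_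
  rw [Finset.sum_mul]
  refine Finset.sum_le_sum fun j _ => ?_
  rw [norm_smul, mul_comm]
  gcongr
  simpa using EuclideanSpace.norm_eq x ▸ PiLp.norm_apply_le x j

/-- The powers `ω ^ k` of the unit vector, as continuous functions on the sphere. -/
def vecPow (m k : ℕ) : C(Sph m, Cl m) :=
  ⟨fun ω => vec (ω : Eu m) ^ k, by
    have := continuous_vec (m := m)
    fun_prop⟩

@[simp] theorem vecPow_apply {m k : ℕ} (ω : Sph m) : vecPow m k ω = vec (ω : Eu m) ^ k := rfl

/-- The parity of ω^k decides which Taylor coefficients of a spherical mean vanish at 0, and so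
which poles in λ are absent. -/
theorem vecPow_neg {m k : ℕ} (ω : Sph m) : vecPow m k (-ω) = (-1 : ℂ) ^ k • vecPow m k ω := by
  rw [vecPow_apply, coe_neg_sphere, vec_neg, neg_pow]
  rcases Nat.even_or_odd k with h | h <;> simp [h.neg_one_pow]

/-- The reversal anti-automorphism of the Clifford algebra, as a continuous linear map. -/
def rev (m : ℕ) : Cl m →L[ℂ] Cl m :=
  LinearMap.toContinuousLinearMap
    (CliffordAlgebra.reverse (Q := cliffordForm m) : CliffordAlgebra _ →ₗ[ℂ] CliffordAlgebra _)

theorem rev_mul {m : ℕ} (a b : Cl m) : rev m (a * b) = rev m b * rev m a :=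
  CliffordAlgebra.reverse.map_mul (Q := cliffordForm m) a b

theorem rev_one {m : ℕ} : rev m 1 = 1 := CliffordAlgebra.reverse.map_one (Q := cliffordForm m)

theorem rev_vec {m : ℕ} (x : Eu m) : rev m (vec x) = vec x := by
  rw [vec_eq_iota]
  exact CliffordAlgebra.reverse_ι (Q := cliffordForm m) _

/-! ### Finite parts with a prescribed number of subtracted Taylor terms -/

section FpRay

variable {F : Type*} [NormedAddCommGroup F] [NormedSpace ℂ F]

/-- The formula for `fpRayFun`, with `n` Taylor terms subtracted. -/
def fpN (n : ℕ) (μ : ℂ) (g : ℝ → F) : F :=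
  (∫ r in Set.Ioc (0 : ℝ) 1, (r : ℂ) ^ μ • taylorRem n g r)
    + (∫ r in Set.Ioi (1 : ℝ), (r : ℂ) ^ μ • g r)
    + ∑ j ∈ Finset.range n, (1 / ((j.factorial : ℂ) * (μ + j + 1))) • iteratedDeriv j g 0

/-- Only a bound on [0, 1] enters, not a global seminorm. For spherical means of translated test
functions this keeps the decay in the translation parameter. -/
theorem norm_taylorRem_le_of_bound (n : ℕ) (g : 𝓢(ℝ, F)) {M : ℝ} (hM0 : 0 ≤ M)
    (hM : ∀ y ∈ Set.Icc (0 : ℝ) 1, ‖iteratedDeriv n g y‖ ≤ M) {r : ℝ} (hr : r ∈ Set.Icc (0 : ℝ) 1) :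
    ‖taylorRem n g r‖ ≤ M * r ^ n := by
  have hsm : ∀ k y, y ∈ Set.Icc (0 : ℝ) 1 →
      iteratedDerivWithin k g (Set.Icc 0 1) y = iteratedDeriv k g y := by
    intro k y hy
    exact iteratedDerivWithin_eq_iteratedDeriv (uniqueDiffOn_Icc zero_lt_one)
      (g.smooth k).contDiffAt hy
  cases n with
  | zero => simpa [taylorRem] using hM r hr
  | succ n =>
    have h := taylor_mean_remainder_bound (f := g) (n := n) (x := r) zero_le_one
      ((g.smooth (n + 1)).contDiffOn) hr (C := M)
      (fun y hy => by rw [hsm _ y hy]; exact hM y hy)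
    have h0 : (0 : ℝ) ∈ Set.Icc (0 : ℝ) 1 := by simp
    have heq : g r - taylorWithinEval g n (Set.Icc 0 1) 0 r = taylorRem (n + 1) g r := by
      rw [taylor_within_apply, taylorRem]
      congr 1
      refine Finset.sum_congr rfl fun k _ => ?_
      rw [hsm k 0 h0, sub_zero, Complex.coe_smul, mul_comm, div_eq_mul_inv]
    rw [heq, sub_zero] at h
    refine h.trans (div_le_self (mul_nonneg hM0 (pow_nonneg hr.1 _)) ?_)
    exact_mod_cast Nat.one_le_iff_ne_zero.mpr n.factorial_ne_zero

theorem integrableOn_rpow_Ioc {s : ℝ} (hs : -1 < s) :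
    IntegrableOn (fun r : ℝ => r ^ s) (Set.Ioc 0 1) := by
  rw [← intervalIntegrable_iff_integrableOn_Ioc_of_le zero_le_one]
  exact intervalIntegral.intervalIntegrable_rpow' hs

theorem integrableOn_cpow_smul_taylorRem_of_lt (n : ℕ) {μ : ℂ} (hn : -1 < μ.re + n)
    (g : 𝓢(ℝ, F)) :
    IntegrableOn (fun r : ℝ => (r : ℂ) ^ μ • taylorRem n g r) (Set.Ioc 0 1) := by
  refine Integrable.mono' ((integrableOn_rpow_Ioc hn).const_mul
    (SchwartzMap.seminorm ℂ 0 n g)) ?_ ?_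
  · refine ContinuousOn.aestronglyMeasurable ?_ measurableSet_Ioc
    exact ((continuousOn_cpow μ).mono (fun r hr => hr.1)).smul
      (continuous_taylorRem _ g).continuousOn
  · refine (ae_restrict_iff' measurableSet_Ioc).2 (Eventually.of_forall fun r hr => ?_)
    rw [norm_smul, Complex.norm_cpow_eq_rpow_re_of_pos hr.1, Real.rpow_add hr.1,
      Real.rpow_natCast]
    have h := norm_taylorRem_le n g (Set.Ioc_subset_Icc_self hr)
    have := Real.rpow_nonneg hr.1.le μ.re
    calc r ^ μ.re * ‖taylorRem n g r‖ ≤ r ^ μ.re * (SchwartzMap.seminorm ℂ 0 n g * r ^ n) := by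
          gcongr
      _ = _ := by ring

theorem integral_Ioc_cpow {a : ℂ} (ha : -1 < a.re) :
    ∫ r in Set.Ioc (0 : ℝ) 1, (r : ℂ) ^ a = 1 / (a + 1) := by
  rw [← intervalIntegral.integral_of_le zero_le_one, integral_cpow (Or.inl ha)]
  have : a + 1 ≠ 0 := fun h => by
    have := congrArg Complex.re h
    simp at this
    linarith
  simp [Complex.zero_cpow this]

theorem integrableOn_Ioc_cpow {a : ℂ} (ha : -1 < a.re) :
    IntegrableOn (fun r : ℝ => (r : ℂ) ^ a) (Set.Ioc 0 1) := by
  rw [← intervalIntegrable_iff_integrableOn_Ioc_of_le zero_le_one]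
  exact intervalIntegral.intervalIntegrable_cpow' ha

variable [CompleteSpace F]

/-- Once -1 < Re μ + n, the integral of r^(μ+n) over (0, 1] converges to 1/(μ + n + 1), so the n-th
Taylor term passes between the integral and the sum at no cost. -/
theorem fpN_succ (n : ℕ) {μ : ℂ} (hn : -1 < μ.re + n) (g : 𝓢(ℝ, F)) :
    fpN (n + 1) μ g = fpN n μ g := by
  have ha : -1 < (μ + n).re := by simpa using hn
  have h1 : ∀ r ∈ Set.Ioc (0 : ℝ) 1, (r : ℂ) ^ μ • taylorRem (n + 1) g r
      = (r : ℂ) ^ μ • taylorRem n g r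
        - (r : ℂ) ^ (μ + n) • ((1 / (n.factorial : ℂ)) • iteratedDeriv n g 0) := by
    intro r hr
    have hr0 : (r : ℂ) ≠ 0 := by exact_mod_cast hr.1.ne'
    rw [taylorRem, taylorRem, Finset.sum_range_succ, Complex.cpow_add _ _ hr0, Complex.cpow_natCast]
    rw [← sub_sub, smul_sub _ (_ - _), smul_smul, smul_smul]
    push_cast
    congr 2
    ring
  unfold fpN
  rw [setIntegral_congr_fun measurableSet_Ioc h1,
    integral_sub (integrableOn_cpow_smul_taylorRem_of_lt n hn g)
      ((integrableOn_Ioc_cpow ha).smul_const _), integral_smul_const, integral_Ioc_cpow ha,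
    Finset.sum_range_succ, smul_smul]
  have : (1 / (μ + n + 1) * (1 / (n.factorial : ℂ))) = 1 / ((n.factorial : ℂ) * (μ + n + 1)) := by
    rw [one_div_mul_one_div_rev]
  rw [this]
  abel

/-- `fpOrder` jumps with Re μ; this frees the number of subtracted terms, so that one n serves a
whole neighbourhood of an exponent. -/
theorem fpRayFun_eq_fpN (n : ℕ) {μ : ℂ} (hn : -1 < μ.re + n) (g : 𝓢(ℝ, F)) :
    fpRayFun μ g = fpN n μ g := by
  have key : ∀ (n k : ℕ), -1 < μ.re + n → fpN (n + k) μ g = fpN n μ g := by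
    intro n k hn
    induction k with
    | zero => rfl
    | succ k ih =>
      rw [← add_assoc, fpN_succ _ (by push_cast; have : (0 : ℝ) ≤ k := by positivity
                                      linarith), ih]
  have h0 : -1 < μ.re + fpOrder μ := by
    have := Nat.le_ceil (-μ.re)
    unfold fpOrder
    linarith
  change fpN (fpOrder μ) μ g = _
  rw [← key _ n h0, ← key n (fpOrder μ) hn, add_comm]

/-- The finite part is holomorphic in the exponent, away from the poles that are not cancelled by
vanishing derivatives. -/
theorem differentiableAt_fpRayFun (g : 𝓢(ℝ, F)) {μ₀ : ℂ}
    (h : ∀ j : ℕ, μ₀ + j + 1 = 0 → iteratedDeriv j g 0 = 0) :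
    DifferentiableAt ℂ (fun μ => fpRayFun μ g) μ₀ := by
  obtain ⟨n, hn⟩ := exists_nat_gt (-μ₀.re - 1)
  have hn' : -1 < μ₀.re + n := by linarith
  have hev : (fun μ => fpRayFun μ g) =ᶠ[𝓝 μ₀] fun μ => fpN n μ g := by
    have : ∀ᶠ μ : ℂ in 𝓝 μ₀, -1 < μ.re + n :=
      (isOpen_lt continuous_const (Complex.continuous_re.add continuous_const)).mem_nhds hn'
    filter_upwards [this] with μ hμ using fpRayFun_eq_fpN n hμ g
  refine DifferentiableAt.congr_of_eventuallyEq ?_ hev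
  -- Gluing the remainder on r ≤ 1 to g on r > 1 makes the two integrals one Mellin transform, to
  -- which the standard holomorphy theorem applies.
  set G : ℝ → F := fun r => if r ≤ 1 then taylorRem n g r else g r with hG
  have hsplit : ∀ᶠ μ : ℂ in 𝓝 μ₀, (∫ r in Set.Ioc (0 : ℝ) 1, (r : ℂ) ^ μ • taylorRem n g r)
    + (∫ r in Set.Ioi (1 : ℝ), (r : ℂ) ^ μ • g r) = mellin G (μ + 1) := by
    have : ∀ᶠ μ : ℂ in 𝓝 μ₀, -1 < μ.re + n :=
      (isOpen_lt continuous_const (Complex.continuous_re.add continuous_const)).mem_nhds hn'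
    filter_upwards [this] with μ hμ
    have e1 : ∀ r ∈ Set.Ioc (0 : ℝ) 1,
        (r : ℂ) ^ μ • taylorRem n g r = (r : ℂ) ^ (μ + 1 - 1) • G r := by
      intro r hr
      simp [hG, hr.2]
    have e2 : ∀ r ∈ Set.Ioi (1 : ℝ), (r : ℂ) ^ μ • g r = (r : ℂ) ^ (μ + 1 - 1) • G r := by
      intro r hr
      simp [hG, not_le.2 (Set.mem_Ioi.1 hr)]
    have i1 := (integrableOn_cpow_smul_taylorRem_of_lt n hμ g).congr_fun e1 measurableSet_Ioc
    have i2 := (integrableOn_cpow_smul μ g).congr_fun e2 measurableSet_Ioi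
    rw [mellin, ← Set.Ioc_union_Ioi_eq_Ioi (zero_le_one (α := ℝ)),
      setIntegral_union (Set.Ioc_disjoint_Ioi le_rfl) measurableSet_Ioi i1 i2,
      setIntegral_congr_fun measurableSet_Ioc e1, setIntegral_congr_fun measurableSet_Ioi e2]
  have hmel : DifferentiableAt ℂ (mellin G) (μ₀ + 1) := by
    have hmeas : AEStronglyMeasurable G volume := by
      have : G = Set.piecewise (Set.Iic 1) (taylorRem n g) g := by
        ext r; simp [hG, Set.piecewise]
      rw [this]
      exact AEStronglyMeasurable.piecewise measurableSet_Iic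
        (continuous_taylorRem n g).aestronglyMeasurable g.continuous.aestronglyMeasurable
    -- G is O(r^n) at 0 and rapidly decreasing at infinity; any a above Re μ₀ + 1 would do, and -n
    -- lies below Re μ₀ + 1 by the choice of n.
    refine mellin_differentiableAt_of_isBigO_rpow (a := μ₀.re + 2) (b := -n) ?_ ?_ ?_ ?_ ?_
    · have hloc : LocallyIntegrable G := by
        refine LocallyIntegrable.mono (f := fun r => ‖taylorRem n g r‖ + ‖g r‖) ?_ hmeas ?_
        · have := (continuous_taylorRem n g).norm.add g.continuous.norm
          exact this.locallyIntegrable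
        · refine Eventually.of_forall fun r => ?_
          rw [Real.norm_of_nonneg (by positivity)]
          simp only [hG]
          split_ifs
          · linarith [norm_nonneg (g r)]
          · linarith [norm_nonneg (taylorRem n g r)]
      exact hloc.locallyIntegrableOn _
    · have h1 : (g : ℝ → F) =O[atTop] fun r : ℝ => ‖r‖ ^ (-(μ₀.re + 2)) :=
        (g.isBigO_cocompact_rpow (-(μ₀.re + 2))).mono atTop_le_cocompact
      have h2 : G =ᶠ[atTop] g := by
        filter_upwards [eventually_gt_atTop 1] with r hr
        simp [hG, not_le.2 hr]
      refine (h1.congr' h2.symm ?_)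
      filter_upwards [eventually_gt_atTop 0] with r hr
      rw [Real.norm_of_nonneg hr.le]
    · simp
    · refine Asymptotics.IsBigO.of_bound (SchwartzMap.seminorm ℂ 0 n g) ?_
      filter_upwards [Ioc_mem_nhdsGT (zero_lt_one (α := ℝ))] with r hr
      simp only [hG, hr.2, if_true, neg_neg, Real.rpow_natCast]
      rw [Real.norm_of_nonneg (pow_nonneg hr.1.le n)]
      exact norm_taylorRem_le n g (Set.Ioc_subset_Icc_self hr)
    · simp; linarith
  have hsum : DifferentiableAt ℂ (fun μ : ℂ => ∑ j ∈ Finset.range n,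
      (1 / ((j.factorial : ℂ) * (μ + j + 1))) • iteratedDeriv j g 0) μ₀ := by
    refine DifferentiableAt.fun_sum fun j _ => ?_
    -- At a pole the coefficient is zero by hypothesis, so the whole term is constantly zero in μ.
    by_cases hj : μ₀ + j + 1 = 0
    · simp only [h j hj, smul_zero]
      exact differentiableAt_const _
    · refine DifferentiableAt.smul_const ?_ _
      refine (differentiableAt_const _).div (by fun_prop) ?_
      exact mul_ne_zero (by exact_mod_cast j.factorial_ne_zero) hj
  unfold fpN
  refine DifferentiableAt.add ?_ hsum
  refine DifferentiableAt.congr_of_eventuallyEq ?_ hsplit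
  exact DifferentiableAt.comp μ₀ (f := fun μ => μ + 1) hmel (by fun_prop)

/-- Multiplication by `r` shifts the exponent of the finite part. -/
theorem fpRayFun_of_eq_smul (μ : ℂ) {f g : 𝓢(ℝ, F)} (h : ∀ r : ℝ, f r = (r : ℂ) • g r) :
    fpRayFun μ f = fpRayFun (μ + 1) g := by
  obtain ⟨n, hn⟩ := exists_nat_gt (-μ.re - 1)
  -- Leibniz rule for r · g(r). At 0 it shifts the Taylor coefficients by one place.
  have hder : ∀ (j : ℕ) (x : ℝ), iteratedDeriv (j + 1) f x
      = (x : ℂ) • iteratedDeriv (j + 1) g x + ((j : ℂ) + 1) • iteratedDeriv j g x := by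
    have hd : ∀ (j : ℕ) (x : ℝ), HasDerivAt (iteratedDeriv j g) (iteratedDeriv (j + 1) g x) x := by
      intro j x
      rw [iteratedDeriv_succ]
      exact ((g.smooth (j + 1)).differentiable_iteratedDeriv j
        (by exact_mod_cast Nat.lt_succ_self j) x).hasDerivAt
    have hid : ∀ x : ℝ, HasDerivAt (fun r : ℝ => (r : ℂ)) 1 x := fun x =>
      Complex.ofRealCLM.hasDerivAt
    intro j
    induction j with
    | zero =>
      intro x
      have hf : (f : ℝ → F) = fun r : ℝ => (r : ℂ) • g r := funext h
      rw [hf, iteratedDeriv_one]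
      have := (hid x).smul (hd 0 x)
      simp only [iteratedDeriv_zero] at this
      refine (this.deriv : deriv (fun r : ℝ => (r : ℂ) • g r) x = _).trans ?_
      simp
    | succ j ih =>
      intro x
      rw [iteratedDeriv_succ, funext ih]
      have := ((hid x).smul (hd (j + 1) x)).add ((hd j x).const_smul ((j : ℂ) + 1))
      refine (this.deriv : deriv (fun x : ℝ => (x : ℂ) • iteratedDeriv (j + 1) g x
        + ((j : ℂ) + 1) • iteratedDeriv j g x) x = _).trans ?_
      push_cast
      module
  have h1 : -1 < μ.re + ((n + 1 : ℕ) : ℝ) := by push_cast; linarith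
  have h2 : -1 < (μ + 1).re + n := by simp; linarith
  -- f needs one term more than g: its zeroth Taylor coefficient vanishes, and the remaining n match
  -- those of g.
  rw [fpRayFun_eq_fpN (n + 1) h1, fpRayFun_eq_fpN n h2]
  have hf0 : f 0 = 0 := by simp [h 0]
  unfold fpN
  congr 1
  · congr 1
    · refine setIntegral_congr_fun measurableSet_Ioc fun r hr => ?_
      have hr0 : (r : ℂ) ≠ 0 := by exact_mod_cast hr.1.ne'
      simp only [taylorRem]
      rw [Finset.sum_range_succ', Complex.cpow_add _ _ hr0, Complex.cpow_one, mul_smul,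
        smul_sub (r : ℂ), Finset.smul_sum]
      simp only [iteratedDeriv_zero, hf0, smul_zero, add_zero, h r]
      congr 2
      refine Finset.sum_congr rfl fun j _ => ?_
      rw [hder]
      simp only [Complex.ofReal_zero, zero_smul, zero_add, smul_smul]
      congr 1
      rw [Nat.factorial_succ]
      have : (j.factorial : ℂ) ≠ 0 := by exact_mod_cast j.factorial_ne_zero
      have : (j : ℂ) + 1 ≠ 0 := by exact_mod_cast j.succ_ne_zero
      push_cast
      field_simp
      ring
    · refine setIntegral_congr_fun measurableSet_Ioi fun r hr => ?_
      have hr0 : (r : ℂ) ≠ 0 := by exact_mod_cast (zero_lt_one.trans hr).ne'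
      simp only [h r]
      rw [Complex.cpow_add _ _ hr0, Complex.cpow_one, mul_smul]
  · rw [Finset.sum_range_succ']
    simp only [iteratedDeriv_zero, hf0, smul_zero, add_zero]
    refine Finset.sum_congr rfl fun j _ => ?_
    rw [hder]
    simp only [Complex.ofReal_zero, zero_smul, zero_add, smul_smul]
    congr 1
    rw [Nat.factorial_succ]
    have : (j : ℂ) + 1 ≠ 0 := by exact_mod_cast j.succ_ne_zero
    push_cast
    rw [show μ + (j + 1) + 1 = μ + 1 + j + 1 by ring, mul_assoc, ← one_div_mul_one_div,
      mul_comm, ← mul_assoc, mul_one_div_cancel this, one_mul]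


/-- Needed for left multiplication by a generator and for the reversal. -/
theorem clm_fpRayFun {G : Type*} [NormedAddCommGroup G] [NormedSpace ℂ G] [CompleteSpace G]
    (L : F →L[ℂ] G) (μ : ℂ) {f : 𝓢(ℝ, F)} {g : 𝓢(ℝ, G)} (h : ∀ r : ℝ, g r = L (f r)) :
    fpRayFun μ g = L (fpRayFun μ f) := by
  have hder : ∀ (j : ℕ) (x : ℝ), iteratedDeriv j g x = L (iteratedDeriv j f x) := by
    intro j
    induction j with
    | zero => intro x; simpa using h x
    | succ j ih =>
      intro x
      rw [iteratedDeriv_succ, iteratedDeriv_succ, funext ih]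
      have hd := ((f.smooth (j + 1)).differentiable_iteratedDeriv j
        (by exact_mod_cast Nat.lt_succ_self j) x).hasDerivAt
      exact ((L.restrictScalars ℝ).hasFDerivAt.comp_hasDerivAt x hd).deriv
  have ht : ∀ n r, taylorRem n g r = L (taylorRem n f r) := by
    intro n r
    simp [taylorRem, map_sub, map_sum, map_smul, h r, hder]
  unfold fpRayFun
  simp only [map_add, map_sum, map_smul, hder, ht]
  congr 2
  · rw [← L.integral_comp_comm (integrableOn_cpow_smul_taylorRem μ f)]
    simp
  · rw [← L.integral_comp_comm (integrableOn_cpow_smul μ f)]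
    simp [h]

end FpRay

/-! ### Polar coordinates and parity -/

section Polar

variable {m : ℕ}

/-- The surface measure of a set is a multiple of the Lebesgue measure of the cone over it, and
Lebesgue measure is invariant under x ↦ -x. -/
theorem measurePreserving_neg_surface :
    MeasurePreserving (fun ω : Sph m => -ω) (surface m) (surface m) := by
  refine ⟨continuous_neg.measurable, Measure.ext fun s hs => ?_⟩
  rw [Measure.map_apply continuous_neg.measurable hs, surface,
    Measure.toSphere_apply' _ hs, Measure.toSphere_apply' _ (continuous_neg.measurable hs)]
  congr 1
  rw [← Measure.measure_preimage_neg]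
  congr 1
  ext x
  simp only [Set.mem_preimage, Set.mem_smul, Set.mem_image]
  constructor
  · rintro ⟨r, hr, y, ⟨ω, hω, rfl⟩, hx⟩
    exact ⟨r, hr, _, ⟨-ω, hω, rfl⟩, by rw [coe_neg_sphere, smul_neg, hx, neg_neg]⟩
  · rintro ⟨r, hr, y, ⟨ω, hω, rfl⟩, hx⟩
    refine ⟨r, hr, _, ⟨-ω, ?_, rfl⟩, by rw [coe_neg_sphere, smul_neg, hx]⟩
    simpa using hω

theorem sphericalMean_apply (h : C(Sph m, Cl m)) (φ : 𝓢(Eu m, ℂ)) (r : ℝ) :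
    sphericalMean h φ r = ∫ ω, φ (r • (ω : Eu m)) • h ω ∂(surface m) := rfl

theorem iteratedDeriv_sphericalMean (h : C(Sph m, Cl m)) (φ : 𝓢(Eu m, ℂ)) (j : ℕ) (r : ℝ) :
    iteratedDeriv j (sphericalMean h φ) r
      = ∫ ω, iteratedFDeriv ℝ j φ (r • (ω : Eu m)) (fun _ => (ω : Eu m)) • h ω ∂(surface m) := by
  have := congrFun (iteratedDeriv_sphereIntegral h.continuous φ j) r
  simp only [iteratedDeriv_radial] at this
  exact this

/-- The Taylor coefficients of a spherical mean of the wrong parity vanish. -/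
theorem iteratedDeriv_sphericalMean_zero {h : C(Sph m, Cl m)} {k : ℕ}
    (hh : ∀ ω, h (-ω) = (-1 : ℂ) ^ k • h ω) (φ : 𝓢(Eu m, ℂ)) {j : ℕ} (hj : Odd (j + k)) :
    iteratedDeriv j (sphericalMean h φ) 0 = 0 := by
  rw [iteratedDeriv_sphericalMean]
  simp only [zero_smul]
  set I := ∫ ω : Sph m, iteratedFDeriv ℝ j φ 0 (fun _ => (ω : Eu m)) • h ω ∂(surface m) with hI
  -- The substitution ω ↦ -ω multiplies the integrand by (-1)^(j + k) = -1.
  have h1 : I = -I := by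
    conv_lhs => rw [hI, ← measurePreserving_neg_surface.integral_comp
      (Homeomorph.neg (Sph m)).measurableEmbedding]
    rw [hI, ← integral_neg]
    refine integral_congr_ae (Eventually.of_forall fun ω => ?_)
    have e1 : (fun _ : Fin j => ((-ω : Sph m) : Eu m)) = fun i : Fin j => (-1 : ℝ) • (ω : Eu m) := by
      ext; simp
    simp only
    rw [e1, ContinuousMultilinearMap.map_smul_univ, hh]
    simp only [Finset.prod_const, Finset.card_univ, Fintype.card_fin]
    have : ((-1 : ℝ) ^ j • iteratedFDeriv ℝ j φ 0 (fun _ => (ω : Eu m)))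
      = (-1 : ℂ) ^ j * iteratedFDeriv ℝ j φ 0 (fun _ => (ω : Eu m)) := by
      rw [Complex.real_smul]; simp
    rw [this, smul_smul, mul_right_comm, ← pow_add, hj.neg_one_pow, neg_one_mul, neg_smul]
  have h2 : (2 : ℂ) • I = 0 := by
    rw [two_smul]
    nth_rewrite 1 [h1]
    simp
  exact (smul_eq_zero.1 h2).resolve_left two_ne_zero

theorem integrable_polar {F : Type*} [NormedAddCommGroup F] {f : Eu m → F} (hf : Integrable f) :
    Integrable (fun p : Sph m × Set.Ioi (0 : ℝ) => f ((p.2 : ℝ) • (p.1 : Eu m)))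
      ((surface m).prod (Measure.volumeIoiPow (m - 1))) := by
  have h := ((volume : Measure (Eu m)).measurePreserving_homeomorphUnitSphereProd).integrable_comp_emb
    (g := fun p : Sph m × Set.Ioi (0 : ℝ) => f ((p.2 : ℝ) • (p.1 : Eu m)))
    (Homeomorph.measurableEmbedding _)
  rw [finrank_euclideanSpace_fin] at h
  refine h.1 ?_
  have h2 : ((fun p : Sph m × Set.Ioi (0 : ℝ) => f ((p.2 : ℝ) • (p.1 : Eu m))) ∘
      homeomorphUnitSphereProd (Eu m)) = f ∘ Subtype.val := by
    ext x
    have : ‖(x : Eu m)‖ ≠ 0 := norm_ne_zero_iff.2 x.2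
    simp [smul_smul, mul_inv_cancel₀ this]
  rw [h2, ← integrableOn_iff_comap_subtypeVal (measurableSet_singleton _).compl]
  exact hf.integrableOn

variable {F : Type*} [NormedAddCommGroup F] [NormedSpace ℝ F]

theorem integral_volumeIoiPow (n : ℕ) (g : ℝ → F) :
    ∫ r : Set.Ioi (0 : ℝ), g r ∂(Measure.volumeIoiPow n) = ∫ r in Set.Ioi (0 : ℝ), r ^ n • g r := by
  simp only [Measure.volumeIoiPow, ENNReal.ofReal]
  rw [integral_withDensity_eq_integral_smul,
    integral_subtype_comap measurableSet_Ioi fun a ↦ Real.toNNReal (a ^ n) • g a,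
    setIntegral_congr_fun measurableSet_Ioi fun x hx ↦ ?_]
  · rw [NNReal.smul_def, Real.coe_toNNReal _ (pow_nonneg hx.out.le _)]
  · exact (measurable_subtype_coe.pow_const _).real_toNNReal

theorem integral_polar (hm : 1 ≤ m) {f : Eu m → F} (hf : Integrable f) :
    ∫ x, f x = ∫ r in Set.Ioi (0 : ℝ), r ^ (m - 1) • ∫ ω, f (r • (ω : Eu m)) ∂(surface m) := by
  have : Nonempty (Fin m) := ⟨⟨0, hm⟩⟩
  calc ∫ x, f x = ∫ x : ({(0)}ᶜ : Set (Eu m)), f (x : Eu m) ∂(volume.comap Subtype.val) := by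
        rw [integral_subtype_comap (measurableSet_singleton _).compl f, restrict_compl_singleton]
    _ = ∫ p : Sph m × Set.Ioi (0 : ℝ), f ((p.2 : ℝ) • (p.1 : Eu m))
          ∂((surface m).prod (Measure.volumeIoiPow (m - 1))) := by
        have h := ((volume : Measure (Eu m)).measurePreserving_homeomorphUnitSphereProd).integral_comp
          (Homeomorph.measurableEmbedding _)
          (fun p : Sph m × Set.Ioi (0 : ℝ) => f ((p.2 : ℝ) • (p.1 : Eu m)))
        rw [finrank_euclideanSpace_fin] at h
        rw [surface, ← h]
        refine integral_congr_ae (Eventually.of_forall fun x => ?_)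
        have : ‖(x : Eu m)‖ ≠ 0 := norm_ne_zero_iff.2 x.2
        simp [smul_smul, mul_inv_cancel₀ this]
    _ = ∫ r : Set.Ioi (0 : ℝ), ∫ ω, f ((r : ℝ) • (ω : Eu m)) ∂(surface m)
          ∂(Measure.volumeIoiPow (m - 1)) := integral_prod_symm _ (integrable_polar hf)
    _ = _ := integral_volumeIoiPow _ (fun r => ∫ ω, f (r • (ω : Eu m)) ∂(surface m))

theorem setIntegral_polar (hm : 1 ≤ m) {f : Eu m → F} {ε : ℝ} (hε : 0 ≤ ε)
    (hf : IntegrableOn f {x | ε < ‖x‖}) :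
    ∫ x in {x | ε < ‖x‖}, f x
      = ∫ r in Set.Ioi ε, r ^ (m - 1) • ∫ ω, f (r • (ω : Eu m)) ∂(surface m) := by
  have hs : MeasurableSet {x : Eu m | ε < ‖x‖} := measurableSet_lt measurable_const measurable_norm
  rw [← integral_indicator hs, integral_polar hm ((integrable_indicator_iff hs).2 hf),
    ← integral_indicator measurableSet_Ioi, ← integral_indicator measurableSet_Ioi]
  congr 1
  ext r
  by_cases h0 : r ∈ Set.Ioi (0 : ℝ)
  · have hn : ∀ ω : Sph m, ‖r • (ω : Eu m)‖ = r := fun ω => by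
      rw [norm_smul, Real.norm_of_nonneg (le_of_lt h0)]; simp
    rw [Set.indicator_of_mem h0]
    by_cases h1 : r ∈ Set.Ioi ε
    · rw [Set.indicator_of_mem h1]
      congr 2
      ext ω
      rw [Set.indicator_of_mem]
      simpa [hn] using h1
    · rw [Set.indicator_of_notMem h1]
      have : ∀ ω : Sph m, Set.indicator {x : Eu m | ε < ‖x‖} f (r • (ω : Eu m)) = 0 := by
        intro ω
        rw [Set.indicator_of_notMem]
        simpa [hn] using h1
      simp [this]
  · rw [Set.indicator_of_notMem h0, Set.indicator_of_notMem]
    exact fun h => h0 (lt_of_le_of_lt hε h)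

end Polar

/-! ### Integrability of powers of the norm -/

section Integrability

variable {m : ℕ}

/-- In polar coordinates the density is r^(σ+m-1)(1+r)^(-N): the first condition handles r → 0, the
second r → ∞. -/
theorem integrable_norm_rpow_mul (hm : 1 ≤ m) {σ N : ℝ} (hσ : -(m : ℝ) < σ) (hN : σ + m < N) :
    Integrable (fun x : Eu m => ‖x‖ ^ σ * (1 + ‖x‖) ^ (-N)) := by
  have : Nonempty (Fin m) := ⟨⟨0, hm⟩⟩
  have h := integrable_fun_norm_addHaar (volume : Measure (Eu m))
    (f := fun r : ℝ => r ^ σ * (1 + r) ^ (-N))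
  rw [finrank_euclideanSpace_fin] at h
  refine h.2 ?_
  have hcont : ContinuousOn (fun y : ℝ => y ^ (m - 1) • (y ^ σ * (1 + y) ^ (-N))) (Set.Ioi 0) := by
    intro y hy
    have hy0 : 0 < y := hy
    have h1 : y ≠ 0 := hy0.ne'
    have h2 : 1 + y ≠ 0 := by positivity
    refine ContinuousAt.continuousWithinAt ?_
    fun_prop (disch := first | assumption | exact Or.inl h1 | exact Or.inl h2)
  have hmm : ((m - 1 : ℕ) : ℝ) = m - 1 := by push_cast [hm]; ring
  have heq : ∀ y : ℝ, 0 < y → y ^ (m - 1) • (y ^ σ * (1 + y) ^ (-N))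
      = y ^ (σ + m - 1) * (1 + y) ^ (-N) := by
    intro y hy
    rw [smul_eq_mul, ← mul_assoc, ← Real.rpow_natCast, ← Real.rpow_add hy, hmm]
    congr 2; ring
  have hN0 : 0 < N := by linarith
  rw [← Set.Ioc_union_Ioi_eq_Ioi (zero_le_one (α := ℝ))]
  refine IntegrableOn.union ?_ ?_
  · refine Integrable.mono' (integrableOn_rpow_Ioc (s := σ + m - 1) (by linarith)) ?_ ?_
    · exact (hcont.mono fun r hr => hr.1).aestronglyMeasurable measurableSet_Ioc
    · refine (ae_restrict_iff' measurableSet_Ioc).2 (Eventually.of_forall fun r hr => ?_)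
      have hr0 : 0 < r := hr.1
      rw [heq r hr0, Real.norm_of_nonneg (by positivity)]
      refine mul_le_of_le_one_right (by positivity) ?_
      exact Real.rpow_le_one_of_one_le_of_nonpos (by linarith) (by linarith)
  · refine Integrable.mono' (integrableOn_Ioi_rpow_of_lt (a := σ + m - 1 - N) (by linarith)
      zero_lt_one) ?_ ?_
    · exact (hcont.mono (Set.Ioi_subset_Ioi zero_le_one)).aestronglyMeasurable measurableSet_Ioi
    · refine (ae_restrict_iff' measurableSet_Ioi).2 (Eventually.of_forall fun r hr => ?_)
      have hr0 : 0 < r := zero_lt_one.trans hr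
      rw [heq r hr0, Real.norm_of_nonneg (by positivity), sub_eq_add_neg _ N, Real.rpow_add hr0]
      gcongr ?_ * ?_
      exact Real.rpow_le_rpow_of_nonpos hr0 (by linarith) (by linarith)

theorem schwartz_norm_le {E F : Type*} [NormedAddCommGroup E] [NormedSpace ℝ E]
    [NormedAddCommGroup F] [NormedSpace ℝ F] (φ : 𝓢(E, F)) (n : ℕ) (N : ℝ) :
    ∃ C : ℝ, 0 ≤ C ∧ ∀ x, ‖iteratedFDeriv ℝ n φ x‖ ≤ C * (1 + ‖x‖) ^ (-N) := by
  obtain ⟨k, hk⟩ := exists_nat_ge N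
  refine ⟨2 ^ k * (Finset.Iic (k, n)).sup (fun p => SchwartzMap.seminorm ℝ p.1 p.2) φ,
    by positivity, fun x => ?_⟩
  have h := SchwartzMap.one_add_le_sup_seminorm_apply (𝕜 := ℝ) (m := (k, n)) le_rfl le_rfl φ x
  rw [Real.rpow_neg (by positivity), ← div_eq_mul_inv, le_div_iff₀ (by positivity), mul_comm]
  refine le_trans ?_ h
  gcongr
  rw [← Real.rpow_natCast]
  exact Real.rpow_le_rpow_of_exponent_le (by linarith [norm_nonneg x]) hk

theorem schwartz_norm_le' {E F : Type*} [NormedAddCommGroup E] [NormedSpace ℝ E]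
    [NormedAddCommGroup F] [NormedSpace ℝ F] (φ : 𝓢(E, F)) (N : ℝ) :
    ∃ C : ℝ, 0 ≤ C ∧ ∀ x, ‖φ x‖ ≤ C * (1 + ‖x‖) ^ (-N) := by
  obtain ⟨C, h0, hC⟩ := schwartz_norm_le φ 0 N
  exact ⟨C, h0, fun x => by simpa using hC x⟩

theorem integrable_norm_rpow_mul_schwartz (hm : 1 ≤ m) {σ : ℝ} (hσ : -(m : ℝ) < σ)
    {F : Type*} [NormedAddCommGroup F] [NormedSpace ℝ F] (φ : 𝓢(Eu m, F)) :
    Integrable (fun x : Eu m => ‖x‖ ^ σ * ‖φ x‖) := by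
  obtain ⟨C, -, hC⟩ := schwartz_norm_le' φ (σ + m + 1)
  refine Integrable.mono' ((integrable_norm_rpow_mul hm hσ (lt_add_one _)).const_mul C) ?_ ?_
  · have : Measurable fun x : Eu m => ‖x‖ ^ σ := measurable_norm.pow_const σ
    exact this.aestronglyMeasurable.mul φ.continuous.norm.aestronglyMeasurable
  · refine Eventually.of_forall fun x => ?_
    rw [Real.norm_of_nonneg (by positivity)]
    calc ‖x‖ ^ σ * ‖φ x‖ ≤ ‖x‖ ^ σ * (C * (1 + ‖x‖) ^ (-(σ + m + 1))) := by
          gcongr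
          exact hC x
      _ = _ := by ring

theorem integrableOn_norm_rpow_mul_schwartz (hm : 1 ≤ m) (σ : ℝ) {ε : ℝ} (hε : 0 < ε)
    {F : Type*} [NormedAddCommGroup F] [NormedSpace ℝ F] (φ : 𝓢(Eu m, F)) :
    IntegrableOn (fun x : Eu m => ‖x‖ ^ σ * ‖φ x‖) {x | ε < ‖x‖} := by
  have hs : MeasurableSet {x : Eu m | ε < ‖x‖} := measurableSet_lt measurable_const measurable_norm
  have hm' : (0 : ℝ) < m := by exact_mod_cast hm
  have h := integrable_norm_rpow_mul_schwartz hm (σ := max σ 0)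
    (lt_max_of_lt_right (by linarith)) φ
  refine Integrable.mono' ((h.const_mul (ε ^ (σ - max σ 0))).integrableOn) ?_ ?_
  · have : Measurable fun x : Eu m => ‖x‖ ^ σ := measurable_norm.pow_const σ
    exact (this.aestronglyMeasurable.mul φ.continuous.norm.aestronglyMeasurable).restrict
  · refine (ae_restrict_iff' hs).2 (Eventually.of_forall fun x hx => ?_)
    have hx0 : 0 < ‖x‖ := hε.trans hx
    rw [Real.norm_of_nonneg (by positivity), ← mul_assoc]
    gcongr
    calc ‖x‖ ^ σ = ‖x‖ ^ (σ - max σ 0) * ‖x‖ ^ max σ 0 := by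
          rw [← Real.rpow_add hx0]; congr 1; ring
      _ ≤ _ := mul_le_mul_of_nonneg_right (Real.rpow_le_rpow_of_nonpos hε (le_of_lt hx)
          (sub_nonpos.2 (le_max_left _ _))) (by positivity)

end Integrability

/-! ### Homogeneous finite part distributions -/

section Homogeneous

variable {m : ℕ}

/-- The distribution `Fp r^λ h(ω)`. -/
def homDist (h : C(Sph m, Cl m)) (lam : ℂ) : ClDistribution m :=
  ContinuousLinearMap.toPointwiseConvergenceCLM _ _ _ _
    ((fpRay (lam + m - 1)).comp (sphericalMean h))

theorem homDist_apply (h : C(Sph m, Cl m)) (lam : ℂ) (φ : 𝓢(Eu m, ℂ)) :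
    homDist h lam φ = fpRayFun (lam + m - 1) (sphericalMean h φ) := rfl

theorem T_eq_homDist (lam : ℂ) : T m lam = homDist (vecPow m 0) lam := by
  have : vecPow m 0 = ContinuousMap.const (Sph m) (1 : Cl m) := by ext; simp
  rw [homDist, this]; rfl

theorem U_eq_homDist (lam : ℂ) : U m lam = homDist (vecPow m 1) lam := by
  have : vecPow m 1 = ⟨fun ω : Sph m => vec (ω : Eu m),
    continuous_vec.comp continuous_subtype_val⟩ := by ext; simp
  rw [homDist, this]; rfl

/-- `f` is continuous outside the origin and equal to `r ^ μ h(ω)` there. -/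
structure IsHom (f : Eu m → Cl m) (h : C(Sph m, Cl m)) (μ : ℂ) : Prop where
  cont : ContinuousOn f {0}ᶜ
  eq : ∀ (ω : Sph m) (r : ℝ), 0 < r → f (r • (ω : Eu m)) = (r : ℂ) ^ μ • h ω

theorem IsHom.norm_le {f : Eu m → Cl m} {h : C(Sph m, Cl m)} {μ : ℂ} (hf : IsHom f h μ) :
    ∀ ξ, ξ ≠ 0 → ‖f ξ‖ ≤ ‖h‖ * ‖ξ‖ ^ μ.re := by
  intro ξ hξ
  have h0 : 0 < ‖ξ‖ := norm_pos_iff.2 hξ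
  have h1 : ‖‖ξ‖⁻¹ • ξ‖ = 1 := by
    rw [norm_smul, norm_inv, norm_norm, inv_mul_cancel₀ h0.ne']
  have h2 := hf.eq ⟨‖ξ‖⁻¹ • ξ, by simpa using h1⟩ ‖ξ‖ h0
  simp only [smul_smul, mul_inv_cancel₀ h0.ne', one_smul] at h2
  rw [h2, norm_smul, Complex.norm_cpow_eq_rpow_re_of_pos h0, mul_comm]
  gcongr
  exact h.norm_coe_le_norm _

theorem IsHom.aestronglyMeasurable {f : Eu m → Cl m} {h : C(Sph m, Cl m)} {μ : ℂ}
    (hm : 1 ≤ m) (hf : IsHom f h μ) : AEStronglyMeasurable f := by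
  have : Nonempty (Fin m) := ⟨⟨0, hm⟩⟩
  have h1 : AEStronglyMeasurable f (volume.restrict ({0}ᶜ : Set (Eu m))) :=
    hf.cont.aestronglyMeasurable (measurableSet_singleton _).compl
  rwa [restrict_compl_singleton] at h1

theorem ae_ne_zero (hm : 1 ≤ m) : ∀ᵐ x : Eu m, x ≠ 0 := by
  have : Nonempty (Fin m) := ⟨⟨0, hm⟩⟩
  simp [ae_iff]

theorem IsHom.integrable (hm : 1 ≤ m) {f : Eu m → Cl m} {h : C(Sph m, Cl m)} {μ : ℂ}
    (hf : IsHom f h μ) (hμ : -(m : ℝ) < μ.re) (φ : 𝓢(Eu m, ℂ)) :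
    Integrable (fun ξ => φ ξ • f ξ) := by
  refine Integrable.mono' ((integrable_norm_rpow_mul_schwartz hm hμ φ).const_mul ‖h‖)
    (φ.continuous.aestronglyMeasurable.smul (hf.aestronglyMeasurable hm)) ?_
  filter_upwards [ae_ne_zero hm] with ξ hξ
  rw [norm_smul]
  calc ‖φ ξ‖ * ‖f ξ‖ ≤ ‖φ ξ‖ * (‖h‖ * ‖ξ‖ ^ μ.re) := by
        gcongr
        exact hf.norm_le ξ hξ
    _ = _ := by ring

theorem IsHom.integrableOn (hm : 1 ≤ m) {f : Eu m → Cl m} {h : C(Sph m, Cl m)} {μ : ℂ}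
    (hf : IsHom f h μ) (φ : 𝓢(Eu m, ℂ)) {ε : ℝ} (hε : 0 < ε) :
    IntegrableOn (fun ξ => φ ξ • f ξ) {ξ | ε < ‖ξ‖} := by
  refine Integrable.mono' ((integrableOn_norm_rpow_mul_schwartz hm μ.re hε φ).const_mul ‖h‖)
    (φ.continuous.aestronglyMeasurable.smul (hf.aestronglyMeasurable hm)).restrict ?_
  refine ae_restrict_of_ae ?_
  filter_upwards [ae_ne_zero hm] with ξ hξ
  rw [norm_smul]
  calc ‖φ ξ‖ * ‖f ξ‖ ≤ ‖φ ξ‖ * (‖h‖ * ‖ξ‖ ^ μ.re) := by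
        gcongr
        exact hf.norm_le ξ hξ
    _ = _ := by ring

/-- The Jacobian r^(m-1) accounts for the shift λ + m - 1 in the definition of the distributions. -/
theorem IsHom.polar_integrand (hm : 1 ≤ m) {f : Eu m → Cl m} {h : C(Sph m, Cl m)} {μ : ℂ}
    (hf : IsHom f h μ) (φ : 𝓢(Eu m, ℂ)) {r : ℝ} (hr : 0 < r) :
    r ^ (m - 1) • ∫ ω, φ (r • (ω : Eu m)) • f (r • (ω : Eu m)) ∂(surface m)
      = (r : ℂ) ^ (μ + m - 1) • sphericalMean h φ r := by
  have hr0 : (r : ℂ) ≠ 0 := by exact_mod_cast hr.ne'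
  simp only [fun ω : Sph m => hf.eq ω r hr, smul_comm _ ((r : ℂ) ^ μ)]
  rw [integral_smul, sphericalMean_apply, ← Complex.coe_smul, smul_smul]
  congr 1
  rw [show μ + m - 1 = ((m - 1 : ℕ) : ℂ) + μ by push_cast [hm]; ring, Complex.cpow_add _ _ hr0,
    Complex.cpow_natCast]
  push_cast
  rfl

/-- In the locally integrable range, the finite part is an ordinary integral. -/
theorem homDist_eq_integral (hm : 1 ≤ m) {f : Eu m → Cl m} {h : C(Sph m, Cl m)} {μ : ℂ}
    (hf : IsHom f h μ) (hμ : -(m : ℝ) < μ.re) (φ : 𝓢(Eu m, ℂ)) :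
    homDist h μ φ = ∫ ξ, φ ξ • f ξ := by
  have hre : -1 < (μ + m - 1).re := by simp; linarith
  -- The ray exponent has real part above -1, so no Taylor term has to be subtracted.
  rw [integral_polar hm (hf.integrable hm hμ φ), homDist_apply, fpRayFun_eq_fpN 0 (by simpa using hre),
    setIntegral_congr_fun measurableSet_Ioi (fun r hr => hf.polar_integrand hm φ hr),
    ← Set.Ioc_union_Ioi_eq_Ioi (zero_le_one (α := ℝ)),
    setIntegral_union (Set.Ioc_disjoint_Ioi le_rfl) measurableSet_Ioi _
      (integrableOn_cpow_smul _ _)]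
  · simp [fpN, taylorRem]
  · simpa [taylorRem] using integrableOn_cpow_smul_taylorRem_of_lt 0
      (by simpa using hre) (sphericalMean h φ)

end Homogeneous

/-! ### Finite parts as limits -/

section FinitePart

/-- The exponent -1 is the only source of logarithms in the finite parts. -/
theorem integral_Ioc_cpow_of_pos (a : ℂ) {ε : ℝ} (h0 : 0 < ε) (h1 : ε ≤ 1) :
    ∫ r in Set.Ioc ε 1, (r : ℂ) ^ a
      = if a + 1 = 0 then -(Real.log ε : ℂ) else (1 - (ε : ℂ) ^ (a + 1)) / (a + 1) := by
  rw [← intervalIntegral.integral_of_le h1]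
  have hnot : (0 : ℝ) ∉ Set.uIcc ε 1 := by
    rw [Set.uIcc_of_le h1]
    exact fun h => absurd h.1 (not_le.2 h0)
  split_ifs with h
  · have ha : a = -1 := eq_neg_of_add_eq_zero_left h
    subst ha
    simp only [Complex.cpow_neg_one]
    have : ∀ x : ℝ, ((x : ℂ))⁻¹ = ((x⁻¹ : ℝ) : ℂ) := fun x => by simp
    simp only [this]
    rw [intervalIntegral.integral_ofReal, integral_inv hnot]
    simp
  · rw [integral_cpow (Or.inr ⟨fun h' => h (by rw [h']; ring), hnot⟩)]
    simp

/-- On (ε, 1] the function is its Taylor polynomial plus a remainder. The remainder part converges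
as ε → 0, while the j-th Taylor term contributes a constant and a multiple of ε^(μ+j+1), or a
multiple of log ε. Discarding the latter when they do not tend to 0 leaves exactly the constants in
`fpRayFun`. -/
theorem hasFinitePart_integral_Ioi {F : Type*} [NormedAddCommGroup F] [NormedSpace ℂ F]
    [CompleteSpace F] (μ : ℂ) (g : 𝓢(ℝ, F)) :
    HasFinitePart (fun ε : ℝ => ∫ r in Set.Ioi ε, (r : ℂ) ^ μ • g r) (fpRayFun μ g) := by
  classical
  set N := fpOrder μ with hN
  set J := (Finset.range N).filter (fun j : ℕ => (μ + j + 1).re ≤ 0) with hJ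
  set P : ℕ → ℂ × ℕ := fun j => (-(μ + j + 1), if μ + j + 1 = 0 then 1 else 0) with hP
  set v : ℕ → F := fun j => if μ + j + 1 = 0 then -((1 / (j.factorial : ℂ)) • iteratedDeriv j g 0)
    else -((1 / ((j.factorial : ℂ) * (μ + j + 1))) • iteratedDeriv j g 0) with hv
  set w : ℝ → ℕ → ℂ := fun ε j => (ε : ℂ) ^ (-(P j).1) * (Real.log ε : ℂ) ^ (P j).2 with hw
  -- J collects the Taylor terms whose ε-dependent part must be removed; the others vanish in the
  -- limit. P records the exponent and the power of the logarithm. Summing v over the fibres of P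
  -- avoids proving P injective.
  refine ⟨J.image P, fun p => ∑ j ∈ J.filter (fun j => P j = p), v j, ?_, ?_⟩
  · intro p hp
    obtain ⟨j, hj, rfl⟩ := Finset.mem_image.1 hp
    have hj' := (Finset.mem_filter.1 hj).2
    refine ⟨by simp only [hP, Complex.neg_re]; linarith, fun h => ?_⟩
    have h1 := congrArg Prod.fst h
    have h2 := congrArg Prod.snd h
    simp only [hP, neg_eq_zero] at h1 h2
    rw [if_pos h1] at h2
    exact one_ne_zero h2
  · have hsum : ∀ ε : ℝ, ∑ p ∈ J.image P, ((ε : ℂ) ^ (-p.1) * (Real.log ε : ℂ) ^ p.2) •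
        ∑ j ∈ J.filter (fun j => P j = p), v j = ∑ j ∈ J, w ε j • v j := by
      intro ε
      rw [← Finset.sum_fiberwise_of_maps_to (fun j hj => Finset.mem_image_of_mem P hj)
        (fun j => w ε j • v j)]
      refine Finset.sum_congr rfl fun p _ => ?_
      rw [Finset.smul_sum]
      refine Finset.sum_congr rfl fun j hj => ?_
      rw [← (Finset.mem_filter.1 hj).2]
    simp only [hsum]
    have hint := integrableOn_cpow_smul_taylorRem μ g
    -- the contribution of one Taylor term
    set t : ℝ → ℕ → F := fun ε j => (∫ r in Set.Ioc ε 1, (r : ℂ) ^ (μ + j)) •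
      ((1 / (j.factorial : ℂ)) • iteratedDeriv j g 0) - (if j ∈ J then w ε j • v j else 0) with ht
    have hev : ∀ᶠ ε : ℝ in 𝓝[>] 0, (∫ r in Set.Ioi ε, (r : ℂ) ^ μ • g r) - ∑ j ∈ J, w ε j • v j
        = (∫ r in ε..1, (r : ℂ) ^ μ • taylorRem N g r)
          + (∫ r in Set.Ioi (1 : ℝ), (r : ℂ) ^ μ • g r) + ∑ j ∈ Finset.range N, t ε j := by
      filter_upwards [Ioc_mem_nhdsGT (zero_lt_one (α := ℝ))] with ε hε
      have hsub : Set.Ioc ε 1 ⊆ Set.Ioc 0 1 := Set.Ioc_subset_Ioc_left hε.1.le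
      have hpow : ∀ a : ℂ, IntegrableOn (fun r : ℝ => (r : ℂ) ^ a) (Set.Ioc ε 1) := by
        intro a
        have hc : ContinuousOn (fun r : ℝ => (r : ℂ) ^ a) (Set.Icc ε 1) :=
          (continuousOn_cpow a).mono fun r hr => hε.1.trans_le hr.1
        exact hc.integrableOn_Icc.mono_set Set.Ioc_subset_Icc_self
      have hd : ∀ r ∈ Set.Ioc ε 1, (r : ℂ) ^ μ • g r = (r : ℂ) ^ μ • taylorRem N g r
          + ∑ j ∈ Finset.range N,
            (r : ℂ) ^ (μ + j) • ((1 / (j.factorial : ℂ)) • iteratedDeriv j g 0) := by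
        intro r hr
        have hr0 : (r : ℂ) ≠ 0 := by exact_mod_cast (hε.1.trans hr.1).ne'
        rw [taylorRem, smul_sub, Finset.smul_sum, sub_add_eq_add_sub, add_sub_assoc,
          ← Finset.sum_sub_distrib, Finset.sum_eq_zero, add_zero]
        intro j _
        rw [Complex.cpow_add _ _ hr0, Complex.cpow_natCast, smul_smul, smul_smul, sub_eq_zero]
        congr 1
        push_cast
        ring
      have hi2 : ∀ j ∈ Finset.range N, IntegrableOn (fun r : ℝ => (r : ℂ) ^ (μ + j) •
          ((1 / (j.factorial : ℂ)) • iteratedDeriv j g 0)) (Set.Ioc ε 1) :=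
        fun j _ => (hpow _).smul_const _
      rw [← Set.Ioc_union_Ioi_eq_Ioi hε.2, setIntegral_union (Set.Ioc_disjoint_Ioi le_rfl)
        measurableSet_Ioi _ (integrableOn_cpow_smul μ g), setIntegral_congr_fun measurableSet_Ioc hd,
        integral_add (hint.mono_set hsub) (integrable_finsetSum _ hi2),
        integral_finsetSum _ hi2, intervalIntegral.integral_of_le hε.2]
      · simp only [ht, Finset.sum_sub_distrib, integral_smul_const]
        rw [Finset.sum_ite_mem, Finset.inter_eq_right.2 (Finset.filter_subset _ _)]
        abel
      · refine (IntegrableOn.congr_fun ?_ (fun r hr => (hd r hr).symm) measurableSet_Ioc)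
        exact (hint.mono_set hsub).add (integrable_finsetSum _ hi2)
    refine Tendsto.congr' (EventuallyEq.symm hev) ?_
    refine Tendsto.add (Tendsto.add ?_ tendsto_const_nhds) (tendsto_finsetSum _ fun j hj => ?_)
    · have hint' : IntegrableOn (fun r : ℝ => (r : ℂ) ^ μ • taylorRem N g r) (Set.uIcc 0 1) := by
        rw [Set.uIcc_of_le zero_le_one, integrableOn_Icc_iff_integrableOn_Ioc]
        exact hint
      have hc := intervalIntegral.continuousOn_primitive_interval_left hint'
      have h0 : (0 : ℝ) ∈ Set.uIcc (0 : ℝ) 1 := by simp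
      have := (hc 0 h0).tendsto
      rw [intervalIntegral.integral_of_le zero_le_one] at this
      refine this.mono_left ?_
      rw [Set.uIcc_of_le zero_le_one, nhdsWithin_le_iff]
      exact mem_of_superset (Ioc_mem_nhdsGT zero_lt_one) Set.Ioc_subset_Icc_self
    · have hev2 : ∀ᶠ ε : ℝ in 𝓝[>] 0, t ε j
          = if j ∈ J then (1 / ((j.factorial : ℂ) * (μ + j + 1))) • iteratedDeriv j g 0
            else ((1 - (ε : ℂ) ^ (μ + j + 1)) / (j.factorial * (μ + j + 1))) • iteratedDeriv j g 0 := by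
        filter_upwards [Ioc_mem_nhdsGT (zero_lt_one (α := ℝ))] with ε hε
        simp only [ht, integral_Ioc_cpow_of_pos _ hε.1 hε.2]
        have hf : (j.factorial : ℂ) ≠ 0 := by exact_mod_cast j.factorial_ne_zero
        by_cases hjJ : j ∈ J
        · simp only [hjJ, if_true, hw, hv, hP]
          by_cases hz : μ + j + 1 = 0
          -- The logarithm cancels completely; the constant left over is 0, in agreement with the
          -- convention 1 / 0 = 0.
          · simp [hz]
          · simp only [hz, if_false, pow_zero, mul_one, neg_neg, smul_neg, sub_neg_eq_add,
              smul_smul, ← add_smul]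
            congr 1
            field_simp
            ring
        · have hz : μ + j + 1 ≠ 0 := by
            intro hz
            refine hjJ (Finset.mem_filter.2 ⟨hj, ?_⟩)
            simp [hz]
          simp only [hjJ, if_false, hz, sub_zero, smul_smul]
          congr 1
          field_simp
      refine Tendsto.congr' (EventuallyEq.symm hev2) ?_
      by_cases hjJ : j ∈ J
      · simp only [hjJ, if_true]
        exact tendsto_const_nhds
      · simp only [hjJ, if_false]
        refine Tendsto.smul_const ?_ _
        have hre : 0 < (μ + j + 1).re := by
          by_contra hneg
          exact hjJ (Finset.mem_filter.2 ⟨hj, not_lt.1 hneg⟩)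
        have h1 : Tendsto (fun ε : ℝ => (ε : ℂ) ^ (μ + j + 1)) (𝓝[>] 0) (𝓝 0) := by
          have hne : μ + j + 1 ≠ 0 := fun h => by simp [h] at hre
          have := (Complex.continuousAt_ofReal_cpow 0 (μ + j + 1) (Or.inl hre)).tendsto
          have h2 : Tendsto (fun ε : ℝ => (ε : ℂ) ^ (μ + j + 1)) (𝓝 0)
              (𝓝 (((0 : ℝ) : ℂ) ^ (μ + j + 1))) :=
            (Complex.continuousAt_ofReal_cpow_const 0 (μ + j + 1) (Or.inl hre)).tendsto
          rw [Complex.ofReal_zero, Complex.zero_cpow hne] at h2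
          exact h2.mono_left nhdsWithin_le_nhds
        have h2 := (tendsto_const_nhds (x := (1 : ℂ)).sub h1).div_const
          ((j.factorial : ℂ) * (μ + j + 1))
        simpa using h2

theorem isFinitePart_homDist {m : ℕ} (hm : 1 ≤ m) {f : Eu m → Cl m} {h : C(Sph m, Cl m)} {μ : ℂ}
    (hf : IsHom f h μ) : IsFinitePart f (homDist h μ) := by
  intro φ
  refine ⟨fun ε hε => hf.integrableOn hm φ hε, ?_⟩
  obtain ⟨s, a, hs, ht⟩ := hasFinitePart_integral_Ioi (μ + m - 1) (sphericalMean h φ)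
  refine ⟨s, a, hs, ?_⟩
  rw [homDist_apply]
  refine ht.congr' ?_
  filter_upwards [self_mem_nhdsWithin] with ε hε
  have hε0 : 0 < ε := hε
  rw [setIntegral_polar hm hε0.le (hf.integrableOn hm φ hε0),
    setIntegral_congr_fun measurableSet_Ioi
      (fun r hr => hf.polar_integrand hm φ (hε0.trans hr))]

end FinitePart

/-! ### Gaussian integrals -/

section Gaussian

variable {m : ℕ}

/-- The Gaussian `exp (-π t |x|²)`. -/
def gaussian (m : ℕ) (t : ℝ) (x : Eu m) : ℂ := Complex.exp (-((Real.pi * t * ‖x‖ ^ 2 : ℝ) : ℂ))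

theorem continuous_gaussian : Continuous (fun p : ℝ × Eu m => gaussian m p.1 p.2) := by
  unfold gaussian
  fun_prop

theorem continuous_gaussian_right (t : ℝ) : Continuous (gaussian m t) := by
  unfold gaussian
  fun_prop

theorem norm_gaussian (t : ℝ) (x : Eu m) : ‖gaussian m t x‖ = Real.exp (-(Real.pi * t * ‖x‖ ^ 2)) := by
  rw [gaussian, ← Complex.ofReal_neg, ← Complex.ofReal_exp, Complex.norm_real,
    Real.norm_of_nonneg (Real.exp_pos _).le]

theorem norm_gaussian_le {t : ℝ} (ht : 0 ≤ t) (x : Eu m) : ‖gaussian m t x‖ ≤ 1 := by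
  rw [norm_gaussian, Real.exp_le_one_iff]
  have := Real.pi_pos
  simp only [Left.neg_nonpos_iff]
  positivity

theorem integrable_gaussian {t : ℝ} (ht : 0 < t) : Integrable (gaussian m t) := by
  have h := GaussianFourier.integrable_cexp_neg_mul_sq_norm_add (V := Eu m)
    (b := ((Real.pi * t : ℝ) : ℂ)) (by simpa using by positivity) 0 0
  refine h.congr (Eventually.of_forall fun x => ?_)
  simp [gaussian]

theorem fourier_gaussian {t : ℝ} (ht : 0 < t) (x : Eu m) :
    𝓕 (gaussian m t) x = ((t ^ (-(m : ℝ) / 2) : ℝ) : ℂ) * gaussian m t⁻¹ x := by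
  have h := fourier_gaussian_innerProductSpace (V := Eu m) (b := ((Real.pi * t : ℝ) : ℂ))
    (by simpa using by positivity) x
  have h1 : (fun v : Eu m => Complex.exp (-((Real.pi * t : ℝ) : ℂ) * (‖v‖ : ℂ) ^ 2)) = gaussian m t := by
    ext v
    simp [gaussian]
  rw [h1] at h
  rw [h, finrank_euclideanSpace_fin, gaussian]
  have hpi : (Real.pi : ℂ) ≠ 0 := by exact_mod_cast Real.pi_pos.ne'
  have ht' : (t : ℂ) ≠ 0 := by exact_mod_cast ht.ne'
  congr 1
  · have : (Real.pi : ℂ) / ((Real.pi * t : ℝ) : ℂ) = ((t⁻¹ : ℝ) : ℂ) := by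
      push_cast
      field_simp
    rw [this, show ((m : ℂ) / 2) = (((m : ℝ) / 2 : ℝ) : ℂ) by push_cast; ring,
      ← Complex.ofReal_cpow (by positivity), Real.inv_rpow ht.le, ← Real.rpow_neg ht.le, neg_div]
  · congr 1
    push_cast
    field_simp

theorem integral_gaussian_fourier {t : ℝ} (ht : 0 < t) (φ : 𝓢(Eu m, ℂ)) :
    ∫ ξ, gaussian m t ξ * 𝓕 φ ξ
      = ((t ^ (-(m : ℝ) / 2) : ℝ) : ℂ) * ∫ x, gaussian m t⁻¹ x * φ x := by
  have h := VectorFourier.integral_bilin_fourierIntegral_eq_flip (ContinuousLinearMap.mul ℂ ℂ)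
    (L := innerₗ (Eu m)) Real.continuous_fourierChar continuous_inner
    (integrable_gaussian (m := m) ht) (φ.integrable (μ := volume))
  have h2 : ∫ ξ, 𝓕 (gaussian m t) ξ * φ ξ = ∫ x, gaussian m t x * 𝓕 φ x := by
    simpa using! h
  rw [← h2, ← integral_const_mul]
  refine integral_congr_ae (Eventually.of_forall fun x => ?_)
  simp only
  rw [fourier_gaussian ht, mul_assoc]

theorem fderiv_gaussian_apply (t : ℝ) (x v : Eu m) :
    HasFDerivAt (gaussian m t) (fderiv ℝ (gaussian m t) x) x ∧
    fderiv ℝ (gaussian m t) x v = gaussian m t x * ((-(2 * Real.pi * t) * inner ℝ x v : ℝ) : ℂ) := by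
  have h1 : HasFDerivAt (fun x : Eu m => -((Real.pi * t * ‖x‖ ^ 2 : ℝ)))
      (-((Real.pi * t) • (2 • innerSL ℝ x))) x :=
    ((hasStrictFDerivAt_norm_sq x).hasFDerivAt.const_mul (Real.pi * t)).neg
  have h2 := (Complex.ofRealCLM.hasFDerivAt.comp x h1).cexp
  have h3 : gaussian m t = fun x => Complex.exp ((Complex.ofRealCLM ∘
      (fun x : Eu m => -((Real.pi * t * ‖x‖ ^ 2 : ℝ)))) x) := by
    ext x; simp [gaussian]
  rw [← h3] at h2
  refine ⟨h2.differentiableAt.hasFDerivAt, ?_⟩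
  rw [h2.fderiv]
  have h4 := congrFun h3 x
  simp only [smul_apply, smul_eq_mul, ContinuousLinearMap.comp_apply, neg_apply, innerSL_apply_apply,
    Complex.ofRealCLM_apply]
  rw [← h4]
  congr 2
  simp only [nsmul_eq_mul]
  push_cast
  ring

theorem integrable_gaussian_mul {t : ℝ} (ht : 0 ≤ t) {f : Eu m → ℂ} (hf : Integrable f) :
    Integrable (fun x => gaussian m t x * f x) :=
  hf.bdd_mul (continuous_gaussian_right t).aestronglyMeasurable
    (Eventually.of_forall fun x => norm_gaussian_le ht x)

theorem integrable_coord_mul (φ : 𝓢(Eu m, ℂ)) (j : Fin m) :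
    Integrable (fun x : Eu m => ((x j : ℝ) : ℂ) * φ x) := by
  refine Integrable.mono' (φ.integrable_pow_mul volume 1) ?_ (Eventually.of_forall fun x => ?_)
  · have := φ.continuous
    exact Continuous.aestronglyMeasurable (by fun_prop)
  · rw [norm_mul, pow_one, Complex.norm_real]
    gcongr
    exact PiLp.norm_apply_le x j

theorem inner_single (x : Eu m) (j : Fin m) : inner ℝ x (EuclideanSpace.single j (1 : ℝ)) = x j := by
  rw [EuclideanSpace.inner_single_right]
  simp

theorem coord_mul_fourier (φ : 𝓢(Eu m, ℂ)) (j : Fin m) (ξ : Eu m) :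
    ((ξ j : ℝ) : ℂ) * 𝓕 φ ξ
      = (2 * Real.pi * Complex.I)⁻¹ * 𝓕 (∂_{EuclideanSpace.single j (1 : ℝ)} φ) ξ := by
  rw [SchwartzMap.fourier_lineDerivOp_eq, smul_apply, SchwartzMap.smulLeftCLM_apply_apply (by fun_prop)]
  rw [inner_single]
  have hpi : (Real.pi : ℂ) ≠ 0 := by exact_mod_cast Real.pi_pos.ne'
  have := Complex.I_ne_zero
  simp only [Complex.real_smul, smul_eq_mul]
  field_simp

/-- ξⱼ times a transform is, up to 2πi, the transform of a derivative. Integration by parts moves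
that derivative to the Gaussian of parameter 1/t, which returns the coordinate xⱼ and an additional
factor 1/t. -/
theorem integral_gaussian_coord_fourier {t : ℝ} (ht : 0 < t) (φ : 𝓢(Eu m, ℂ)) (j : Fin m) :
    ∫ ξ, gaussian m t ξ * (((ξ j : ℝ) : ℂ) * 𝓕 φ ξ)
      = ((t ^ (-((m : ℝ) / 2 + 1)) : ℝ) : ℂ) *
        ∫ x, gaussian m t⁻¹ x * (-Complex.I * (((x j : ℝ) : ℂ) * φ x)) := by
  set v : Eu m := EuclideanSpace.single j (1 : ℝ) with hv
  have h1 : ∫ ξ, gaussian m t ξ * (((ξ j : ℝ) : ℂ) * 𝓕 φ ξ)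
      = (2 * Real.pi * Complex.I)⁻¹ * ∫ ξ, gaussian m t ξ * 𝓕 (∂_{v} φ) ξ := by
    rw [← integral_const_mul]
    refine integral_congr_ae (Eventually.of_forall fun ξ => ?_)
    simp only [coord_mul_fourier]
    ring
  have hti : 0 ≤ t⁻¹ := by positivity
  have hd : ∀ x : Eu m, fderiv ℝ (gaussian m t⁻¹) x v
      = gaussian m t⁻¹ x * (-(2 * Real.pi * t⁻¹) * (x j : ℝ)) := by
    intro x
    rw [(fderiv_gaussian_apply t⁻¹ x v).2, inner_single]
    push_cast
    rfl
  have h2 := integral_mul_fderiv_eq_neg_fderiv_mul_of_integrable (𝕜 := ℂ) (μ := volume)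
    (f := gaussian m t⁻¹) (g := φ) (v := v) ?_ ?_ ?_
    (fun x _ => (fderiv_gaussian_apply t⁻¹ x v).1.differentiableAt) (fun x _ => φ.differentiableAt)
  · have h3 : ∫ ξ, gaussian m t ξ * 𝓕 (∂_{v} φ) ξ = ((t ^ (-(m : ℝ) / 2) : ℝ) : ℂ) *
        ∫ x, gaussian m t⁻¹ x * fderiv ℝ φ x v := by
      rw [integral_gaussian_fourier ht]
      rfl
    rw [h1, h3, h2, ← integral_neg, ← integral_const_mul, ← integral_const_mul, ← integral_const_mul]
    refine integral_congr_ae (Eventually.of_forall fun x => ?_)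
    simp only [hd]
    have hpi : (Real.pi : ℂ) ≠ 0 := by exact_mod_cast Real.pi_pos.ne'
    have ht' : (t : ℂ) ≠ 0 := by exact_mod_cast ht.ne'
    have e1 : t ^ (-((m : ℝ) / 2 + 1)) = t ^ (-(m : ℝ) / 2) * t⁻¹ := by
      rw [neg_add, Real.rpow_add ht, Real.rpow_neg_one, neg_div]
    rw [e1]
    have hI := Complex.I_ne_zero
    have hI2 : Complex.I ^ 2 = -1 := Complex.I_sq
    push_cast
    field_simp
    rw [hI2]
    ring
  · have := (integrable_gaussian_mul hti (integrable_coord_mul φ j)).const_mul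
      (-(2 * Real.pi * t⁻¹) : ℂ)
    refine this.congr (Eventually.of_forall fun x => ?_)
    simp only [hd]
    push_cast
    ring
  · exact integrable_gaussian_mul hti ((∂_{v} φ : 𝓢(Eu m, ℂ)).integrable)
  · exact integrable_gaussian_mul hti φ.integrable

/-- The Gaussian identities behind the Fourier transforms of `T_λ` (`k = 0`) and `U_λ` (`k = 1`). -/
theorem integral_gaussian_vec_pow_fourier {t : ℝ} (ht : 0 < t) (φ : 𝓢(Eu m, ℂ)) {k : ℕ} (hk : k ≤ 1) :
    ∫ ξ, gaussian m t ξ • (𝓕 φ ξ • (vec ξ ^ k : Cl m))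
      = ((t ^ (-((m : ℝ) / 2 + k)) : ℝ) : ℂ) •
        ∫ x, gaussian m t⁻¹ x • (((-Complex.I) ^ k * φ x) • (vec x ^ k : Cl m)) := by
  have hti : 0 ≤ t⁻¹ := by positivity
  interval_cases k
  · simp only [pow_zero, smul_smul, one_mul]
    rw [integral_smul_const, integral_smul_const, integral_gaussian_fourier ht, mul_smul]
    simp [neg_div]
  · have h1 : ∀ (s : ℝ) (a : ℂ) (f : Eu m → ℂ) (x : Eu m),
        gaussian m s x • ((a * f x) • (vec x : Cl m))
        = ∑ j, (gaussian m s x * (a * (((x j : ℝ) : ℂ) * f x))) • (e j : Cl m) := by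
      intro s a f x
      rw [vec, Finset.smul_sum, Finset.smul_sum]
      refine Finset.sum_congr rfl fun j _ => ?_
      rw [smul_smul, smul_smul]
      congr 1
      ring
    have h2 : ∀ ξ, gaussian m t ξ • (𝓕 φ ξ • (vec ξ ^ 1 : Cl m)) =
        ∑ j, (gaussian m t ξ * (1 * (((ξ j : ℝ) : ℂ) * 𝓕 φ ξ))) • (e j : Cl m) := by
      intro ξ
      rw [← h1, pow_one, one_mul]
    have h3 : ∀ x, gaussian m t⁻¹ x • (((-Complex.I) ^ 1 * φ x) • (vec x ^ 1 : Cl m)) =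
        ∑ j, (gaussian m t⁻¹ x * (-Complex.I * (((x j : ℝ) : ℂ) * φ x))) • (e j : Cl m) := by
      intro ξ
      rw [← h1, pow_one, pow_one]
    simp only [h2, h3]
    rw [integral_finsetSum, integral_finsetSum, Finset.smul_sum]
    · refine Finset.sum_congr rfl fun j _ => ?_
      simp only [one_mul]
      rw [integral_smul_const, integral_smul_const, integral_gaussian_coord_fourier ht, mul_smul]
      simp
    · intro j _
      exact (integrable_gaussian_mul hti ((integrable_coord_mul φ j).const_mul _)).smul_const _
    · intro j _
      simp only [one_mul]
      exact (integrable_gaussian_mul ht.le (integrable_coord_mul (𝓕 φ) j)).smul_const _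

/-- The Mellin transform in `t` of Gaussian integrals. -/
theorem mellin_integral_gaussian (hm : 1 ≤ m) {a : ℂ} (ha : 0 < a.re) {Φ : Eu m → Cl m}
    (hΦ : AEStronglyMeasurable Φ volume) (hint : Integrable (fun ξ => ‖ξ‖ ^ (-2 * a.re) * ‖Φ ξ‖)) :
    mellin (fun t => ∫ ξ, gaussian m t ξ • Φ ξ) a
      = (Complex.Gamma a * (Real.pi : ℂ) ^ (-a)) • ∫ ξ, (‖ξ‖ : ℂ) ^ (-2 * a) • Φ ξ := by
  have hpi := Real.pi_pos
  have hmeas : AEStronglyMeasurable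
      (fun p : ℝ × Eu m => (p.1 : ℂ) ^ (a - 1) • (gaussian m p.1 p.2 • Φ p.2))
      ((volume.restrict (Set.Ioi 0)).prod volume) := by
    refine AEStronglyMeasurable.fun_smul ?_ (AEStronglyMeasurable.fun_smul ?_ hΦ.comp_snd)
    · exact ((continuousOn_cpow (a - 1)).aestronglyMeasurable measurableSet_Ioi).comp_fst
    · exact continuous_gaussian.aestronglyMeasurable
  have hr : ∀ ξ : Eu m, ξ ≠ 0 → 0 < Real.pi * ‖ξ‖ ^ 2 := by
    intro ξ hξ
    have := norm_pos_iff.2 hξ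
    positivity
  have hg : ∀ (t : ℝ) (ξ : Eu m), Real.exp (-(Real.pi * t * ‖ξ‖ ^ 2))
      = Real.exp (-(Real.pi * ‖ξ‖ ^ 2 * t)) := by
    intro t ξ; congr 1; ring
  have hnorm : ∀ (ξ : Eu m) (t : ℝ), t ∈ Set.Ioi (0 : ℝ) →
      ‖(t : ℂ) ^ (a - 1) • (gaussian m t ξ • Φ ξ)‖
        = (t ^ (a.re - 1) * Real.exp (-(Real.pi * ‖ξ‖ ^ 2 * t))) * ‖Φ ξ‖ := by
    intro ξ t ht
    rw [norm_smul, norm_smul, norm_gaussian, Complex.norm_cpow_eq_rpow_re_of_pos ht, hg, Complex.sub_re, Complex.one_re]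
    ring
  -- Fubini: integrating norms in t first gives Γ(Re a)(π|ξ|²)^(-Re a)‖Φ(ξ)‖, so `hint` is exactly
  -- what is required.
  have hF : Integrable (Function.uncurry fun (t : ℝ) (ξ : Eu m) =>
      (t : ℂ) ^ (a - 1) • (gaussian m t ξ • Φ ξ)) ((volume.restrict (Set.Ioi 0)).prod volume) := by
    refine (integrable_prod_iff' hmeas).2 ⟨?_, ?_⟩
    · filter_upwards [ae_ne_zero hm] with ξ hξ
      have h1 : IntegrableOn (fun t : ℝ => t ^ (a.re - 1) * Real.exp (-(Real.pi * ‖ξ‖ ^ 2 * t)))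
          (Set.Ioi 0) := by
        have := integrableOn_rpow_mul_exp_neg_mul_rpow (s := a.re - 1) (p := 1) (by linarith) one_pos (hr ξ hξ)
        refine this.congr_fun (fun t _ => ?_) measurableSet_Ioi
        simp
      refine Integrable.mono' (h1.mul_const ‖Φ ξ‖) ?_ ?_
      · refine ContinuousOn.aestronglyMeasurable ?_ measurableSet_Ioi
        have h2 : Continuous fun t : ℝ => gaussian m t ξ :=
          continuous_gaussian.comp (by fun_prop : Continuous fun t : ℝ => (t, ξ))
        exact (continuousOn_cpow (a - 1)).smul (h2.smul continuous_const).continuousOn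
      · exact (ae_restrict_iff' measurableSet_Ioi).2
          (Eventually.of_forall fun t ht => (hnorm ξ t ht).le)
    · refine (hint.const_mul (Real.Gamma a.re * Real.pi ^ (-a.re))).congr ?_
      filter_upwards [ae_ne_zero hm] with ξ hξ
      rw [setIntegral_congr_fun measurableSet_Ioi (hnorm ξ), integral_mul_const,
        Real.integral_rpow_mul_exp_neg_mul_Ioi ha (hr ξ hξ), one_div,
        Real.inv_rpow (hr ξ hξ).le, Real.mul_rpow hpi.le (by positivity), mul_inv,
        ← Real.rpow_neg hpi.le, ← Real.rpow_natCast, ← Real.rpow_mul (norm_nonneg _),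
        ← Real.rpow_neg (norm_nonneg _)]
      push_cast
      rw [show -(2 * a.re) = -2 * a.re by ring]
      ring
  have h1 : mellin (fun t => ∫ ξ, gaussian m t ξ • Φ ξ) a
      = ∫ t in Set.Ioi (0 : ℝ), ∫ ξ, (t : ℂ) ^ (a - 1) • (gaussian m t ξ • Φ ξ) := by
    rw [mellin]
    refine setIntegral_congr_fun measurableSet_Ioi fun t _ => ?_
    rw [integral_smul]
  rw [h1, integral_integral_swap hF, ← integral_smul]
  refine integral_congr_ae ?_
  filter_upwards [ae_ne_zero hm] with ξ hξ
  have h2 : ∀ t : ℝ, (t : ℂ) ^ (a - 1) • (gaussian m t ξ • Φ ξ)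
      = ((t : ℂ) ^ (a - 1) * Complex.exp (-((Real.pi * ‖ξ‖ ^ 2 : ℝ) * t))) • Φ ξ := by
    intro t
    rw [smul_smul, gaussian]
    congr 3
    push_cast
    ring
  have hn0 : 0 < ‖ξ‖ := norm_pos_iff.2 hξ
  simp only [h2]
  rw [integral_smul_const, Complex.integral_cpow_mul_exp_neg_mul_Ioi ha (hr ξ hξ), smul_smul]
  congr 1
  have e1 : (1 / ((Real.pi * ‖ξ‖ ^ 2 : ℝ) : ℂ)) ^ a = (Real.pi : ℂ) ^ (-a) * (‖ξ‖ : ℂ) ^ (-2 * a) := by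
    have harg : Complex.arg ((Real.pi * ‖ξ‖ ^ 2 : ℝ) : ℂ) ≠ Real.pi := by
      rw [Complex.arg_ofReal_of_nonneg (hr ξ hξ).le]; exact Real.pi_pos.ne
    rw [one_div, Complex.inv_cpow _ _ harg, Complex.ofReal_mul,
      Complex.mul_cpow_ofReal_nonneg hpi.le (by positivity), mul_inv, ← Complex.cpow_neg,
      ← Complex.cpow_neg]
    congr 1
    rw [Complex.ofReal_pow, ← Complex.cpow_nat_mul' (x := (‖ξ‖ : ℂ)) (n := 2) (y := -a)]
    · congr 1; push_cast; ring
    · rw [Complex.arg_ofReal_of_nonneg hn0.le]; simp [hpi]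
    · rw [Complex.arg_ofReal_of_nonneg hn0.le]; simp [hpi.le]
  rw [e1]
  ring

end Gaussian

/-! ### The homogeneous kernels -/

section Kernel

variable {m : ℕ}

/-- The kernel `|ξ| ^ (μ - k) ξ ^ k`, homogeneous of degree `μ`. -/
def homKer (k : ℕ) (μ : ℂ) (ξ : Eu m) : Cl m := (‖ξ‖ : ℂ) ^ (μ - k) • vec ξ ^ k

theorem isHom_homKer (k : ℕ) (μ : ℂ) : IsHom (m := m) (homKer k μ) (vecPow m k) μ where
  cont := by
    intro ξ hξ
    have h0 : 0 < ‖ξ‖ := norm_pos_iff.2 hξ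
    have h1 : ContinuousAt (fun ξ : Eu m => (‖ξ‖ : ℂ) ^ (μ - k)) ξ :=
      (Complex.continuousAt_ofReal_cpow_const ‖ξ‖ (μ - k) (Or.inr h0.ne')).comp
        (f := fun ξ : Eu m => ‖ξ‖) continuous_norm.continuousAt
    exact (h1.smul (continuous_vec.pow k).continuousAt).continuousWithinAt
  eq ω r hr := by
    have hr0 : (r : ℂ) ≠ 0 := by exact_mod_cast hr.ne'
    have hn : ‖r • (ω : Eu m)‖ = r := by
      rw [norm_smul, Real.norm_of_nonneg hr.le]; simp
    rw [homKer, hn, vec_smul, smul_pow, smul_smul, vecPow_apply, ← Complex.cpow_natCast,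
      ← Complex.cpow_add _ _ hr0, sub_add_cancel]

end Kernel

/-! ### Identity theorem -/

theorem intSet_closed (A : Set ℤ) : IsClosed ((fun n : ℤ => (n : ℂ)) '' A) := by
  have h : Topology.IsClosedEmbedding (fun n : ℤ => (n : ℂ)) := by
    have := Complex.isometry_ofReal.isClosedEmbedding.comp Int.isClosedEmbedding_coe_real
    convert this using 1
    ext n
    simp
  exact h.isClosedMap _ (isClosed_discrete A)

theorem intSet_countable (A : Set ℤ) : ((fun n : ℤ => (n : ℂ)) '' A).Countable :=
  (Set.to_countable A).image _

/-- The complement of a countable set in ℂ is connected and dense: density supplies a base point in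
V off S, connectedness lets the identity theorem spread from it. -/
theorem eq_of_differentiable_off_countable {F : Type*} [NormedAddCommGroup F] [NormedSpace ℂ F]
    [CompleteSpace F] {S V : Set ℂ} (hc : S.Countable) (hcl : IsClosed S) {f g : ℂ → F}
    (hf : ∀ z ∉ S, DifferentiableAt ℂ f z) (hg : ∀ z ∉ S, DifferentiableAt ℂ g z)
    (hV : IsOpen V) (hne : V.Nonempty) (heq : ∀ z ∈ V, z ∉ S → f z = g z) :
    ∀ z ∉ S, f z = g z := by
  have hopen : IsOpen Sᶜ := hcl.isOpen_compl
  have hconn : IsPreconnected Sᶜ :=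
    (hc.isConnected_compl_of_one_lt_rank (by simp)).isPreconnected
  have hdense : Dense Sᶜ := hc.dense_compl ℂ
  obtain ⟨z₀, hz₀V, hz₀S⟩ := hdense.inter_open_nonempty V hV hne
  have ha : ∀ {f : ℂ → F}, (∀ z ∉ S, DifferentiableAt ℂ f z) → AnalyticOnNhd ℂ f Sᶜ :=
    fun h => DifferentiableOn.analyticOnNhd (fun z hz => (h z hz).differentiableWithinAt) hopen
  have hev : f =ᶠ[𝓝 z₀] g := by
    filter_upwards [(hV.inter hopen).mem_nhds ⟨hz₀V, hz₀S⟩] with z hz using heq z hz.1 hz.2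
  exact fun z hz => (ha hf).eqOn_of_preconnected_of_eventuallyEq (ha hg) hconn hz₀S hev hz

/-! ### Fourier transforms of the homogeneous distributions -/

section Fourier

variable {m : ℕ}

/-- The exponents `λ` at which `Fp r^λ ω^k` has no pole. -/
def RegularAt (m k : ℕ) (lam : ℂ) : Prop := ∀ j : ℕ, Even (j + k) → lam ≠ -m - j

/-- The possible pole at λ = -m - j has the j-th derivative of the spherical mean at 0 as its
coefficient; that derivative vanishes when j + k is odd. -/
theorem differentiableAt_homDist {h : C(Sph m, Cl m)} {k : ℕ}
    (hh : ∀ ω, h (-ω) = (-1 : ℂ) ^ k • h ω) (φ : 𝓢(Eu m, ℂ)) {lam : ℂ} (hlam : RegularAt m k lam) :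
    DifferentiableAt ℂ (fun l => homDist h l φ) lam := by
  have h1 : DifferentiableAt ℂ (fun μ => fpRayFun μ (sphericalMean h φ)) (lam + m - 1) := by
    refine differentiableAt_fpRayFun _ fun j hj => iteratedDeriv_sphericalMean_zero hh φ ?_
    rw [← Nat.not_even_iff_odd]
    exact fun hev => hlam j hev (by linear_combination hj)
  exact DifferentiableAt.comp lam (f := fun l : ℂ => l + m - 1) h1 (by fun_prop)

/-- The set of excluded exponents in the Fourier transform of type `k`. -/
def poles (m k : ℕ) : Set ℂ :=
  (fun n : ℤ => (n : ℂ)) '' {n : ℤ | ∃ j : ℕ, Even (j + k) ∧ (n = -m - j ∨ n = j)}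

theorem notMem_poles_iff {k : ℕ} {μ : ℂ} :
    μ ∉ poles m k ↔ RegularAt m k μ ∧ RegularAt m k (-m - μ) := by
  constructor
  · intro h
    refine ⟨fun j hj hμ => h ⟨-m - j, ⟨j, hj, Or.inl rfl⟩, by simp [hμ]⟩, fun j hj hμ =>
      h ⟨j, ⟨j, hj, Or.inr rfl⟩, ?_⟩⟩
    simp only [Int.cast_natCast]
    linear_combination hμ
  · rintro ⟨h1, h2⟩ ⟨n, ⟨j, hj, hn | hn⟩, rfl⟩
    · exact h1 j hj (by simp [hn])
    · exact h2 j hj (by simp [hn])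

/-- The constant in the Fourier transform `Fp r^(-m-μ) ω^k ↦ C Fp r^μ ω^k`. -/
def fourierConst (m k : ℕ) (μ : ℂ) : ℂ :=
  (-Complex.I) ^ k * (Real.pi : ℂ) ^ (μ + m / 2) *
    (Complex.Gamma ((k - μ) / 2) * (Complex.Gamma ((μ + m + k) / 2))⁻¹)

/-- 1/Γ is entire, and the numerator Γ((k - μ)/2) is singular only at μ = k + 2n, which belongs to
`poles`. -/
theorem differentiableAt_fourierConst {k : ℕ} {μ : ℂ} (hμ : μ ∉ poles m k) :
    DifferentiableAt ℂ (fourierConst m k) μ := by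
  have hpi : (Real.pi : ℂ) ≠ 0 := by exact_mod_cast Real.pi_pos.ne'
  have h1 : DifferentiableAt ℂ (fun μ : ℂ => Complex.Gamma ((k - μ) / 2)) μ := by
    refine DifferentiableAt.comp μ (f := fun μ : ℂ => ((k : ℂ) - μ) / 2)
      (Complex.differentiableAt_Gamma _ fun n hn => ?_) (by fun_prop)
    refine hμ ⟨k + 2 * n, ⟨k + 2 * n, by simp [parity_simps], Or.inr (by push_cast; rfl)⟩, ?_⟩
    push_cast
    linear_combination 2 * hn
  have h2 : DifferentiableAt ℂ (fun μ : ℂ => (Complex.Gamma ((μ + m + k) / 2))⁻¹) μ :=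
    DifferentiableAt.comp μ (f := fun μ : ℂ => (μ + m + k) / 2)
      (Complex.differentiable_one_div_Gamma _) (by fun_prop)
  have h3 : DifferentiableAt ℂ (fun μ : ℂ => (Real.pi : ℂ) ^ (μ + m / 2)) μ :=
    DifferentiableAt.const_cpow (by fun_prop) (Or.inl hpi)
  exact ((differentiableAt_const _).mul h3).mul (h1.mul h2)

/-- Both kernels are locally integrable here. With 2a = m + μ + k and 2b = k - μ, the weights
|ξ|^(-2a) and |x|^(-2b) are Mellin transforms of Gaussians at a and b, and the Gaussian Fourier
identity links the two. -/
theorem homDist_fourier_of_mem_strip (hm : 1 ≤ m) {k : ℕ} (hk : k ≤ 1) {μ : ℂ}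
    (h1 : -(m : ℝ) < μ.re) (h2 : μ.re < 0) (φ : 𝓢(Eu m, ℂ)) :
    homDist (vecPow m k) (-m - μ) (𝓕 φ) = fourierConst m k μ • homDist (vecPow m k) μ φ := by
  have hre : -(m : ℝ) < (-m - μ : ℂ).re := by simp; linarith
  rw [homDist_eq_integral hm (isHom_homKer k _) hre, homDist_eq_integral hm (isHom_homKer k μ) h1]
  set a : ℂ := (m + μ + k) / 2 with ha
  set b : ℂ := (k - μ) / 2 with hb
  have hare : a.re = (m + μ.re + k) / 2 := by
    rw [ha, show (m + μ + k : ℂ) / 2 = ((1 / 2 : ℝ) : ℂ) * (m + μ + k) by push_cast; ring,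
      Complex.re_ofReal_mul]
    simp; ring
  have hbre : b.re = (k - μ.re) / 2 := by
    rw [hb, show (k - μ : ℂ) / 2 = ((1 / 2 : ℝ) : ℂ) * (k - μ) by push_cast; ring,
      Complex.re_ofReal_mul]
    simp; ring
  have hk0 : (0 : ℝ) ≤ k := by positivity
  have ha0 : 0 < a.re := by rw [hare]; linarith
  have hb0 : 0 < b.re := by rw [hbre]; linarith
  set Φ : Eu m → Cl m := fun ξ => 𝓕 φ ξ • (vec ξ ^ k : Cl m) with hΦ
  set Ψ : Eu m → Cl m := fun x => ((-Complex.I) ^ k * φ x) • (vec x ^ k : Cl m) with hΨ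
  have hΦm : Continuous Φ := (𝓕 φ).continuous.smul (continuous_vec.pow k)
  have hΨm : Continuous Ψ := (continuous_const.mul φ.continuous).smul (continuous_vec.pow k)
  obtain ⟨K, hK0, hK⟩ : ∃ K : ℝ, 0 ≤ K ∧ ∀ x : Eu m, ‖(vec x ^ k : Cl m)‖ ≤ K * ‖x‖ ^ k := by
    interval_cases k
    · exact ⟨‖(1 : Cl m)‖, norm_nonneg _, fun x => by simp⟩
    · simpa using norm_vec_le (m := m)
  have hbound : ∀ (σ : ℝ) (hσ : -(m : ℝ) < σ) (ψ : 𝓢(Eu m, ℂ)) (c : ℂ),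
      Integrable (fun x : Eu m => ‖x‖ ^ (σ - k) * ‖(c * ψ x) • (vec x ^ k : Cl m)‖) := by
    intro σ hσ ψ c
    refine Integrable.mono' ((integrable_norm_rpow_mul_schwartz hm hσ ψ).const_mul (‖c‖ * K)) ?_ ?_
    · have h1 : Measurable fun x : Eu m => ‖x‖ ^ (σ - k) := measurable_norm.pow_const _
      exact h1.aestronglyMeasurable.mul
        ((continuous_const.mul ψ.continuous).smul (continuous_vec.pow k)).norm.aestronglyMeasurable
    · filter_upwards [ae_ne_zero hm] with x hx
      have hx0 : 0 < ‖x‖ := norm_pos_iff.2 hx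
      rw [Real.norm_of_nonneg (by positivity), norm_smul, norm_mul]
      calc ‖x‖ ^ (σ - k) * (‖c‖ * ‖ψ x‖ * ‖(vec x ^ k : Cl m)‖)
          ≤ ‖x‖ ^ (σ - k) * (‖c‖ * ‖ψ x‖ * (K * ‖x‖ ^ k)) := by
            gcongr
            exact hK x
        _ = ‖c‖ * K * ((‖x‖ ^ (σ - k) * ‖x‖ ^ (k : ℝ)) * ‖ψ x‖) := by
            rw [Real.rpow_natCast]; ring
        _ = ‖c‖ * K * (‖x‖ ^ σ * ‖ψ x‖) := by
            rw [← Real.rpow_add hx0, sub_add_cancel]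
  have hΦi : Integrable (fun ξ => ‖ξ‖ ^ (-2 * a.re) * ‖Φ ξ‖) := by
    have := hbound (-m - μ.re) (by linarith) (𝓕 φ) 1
    simp only [one_mul] at this
    rwa [show (-m - μ.re - k : ℝ) = -2 * a.re by rw [hare]; ring] at this
  have hΨi : Integrable (fun ξ => ‖ξ‖ ^ (-2 * b.re) * ‖Ψ ξ‖) := by
    have := hbound μ.re h1 φ ((-Complex.I) ^ k)
    rwa [show (μ.re - k : ℝ) = -2 * b.re by rw [hbre]; ring] at this
  have m1 := mellin_integral_gaussian hm ha0 hΦm.aestronglyMeasurable hΦi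
  have m2 := mellin_integral_gaussian hm hb0 hΨm.aestronglyMeasurable hΨi
  -- The Gaussian identity replaces t by 1/t with a factor t^(-(m/2 + k)), which turns the Mellin
  -- variable a into m/2 + k - a = b.
  have m3 : mellin (fun t => ∫ ξ, gaussian m t ξ • Φ ξ) a
      = mellin (fun t => ∫ ξ, gaussian m t ξ • Ψ ξ) b := by
    have e1 : mellin (fun t => ∫ ξ, gaussian m t ξ • Φ ξ) a
        = mellin (fun t : ℝ => (t : ℂ) ^ (-((m : ℂ) / 2 + k)) •
            (fun t => ∫ ξ, gaussian m t ξ • Ψ ξ) t⁻¹) a := by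
      refine setIntegral_congr_fun measurableSet_Ioi fun t ht => ?_
      have ht0 : 0 < t := ht
      simp only [hΦ, hΨ]
      rw [integral_gaussian_vec_pow_fourier ht0 φ hk]
      congr 2
      rw [Complex.ofReal_cpow ht0.le]
      push_cast
      rfl
    rw [e1, mellin_cpow_smul, mellin_comp_inv (fun t => ∫ ξ, gaussian m t ξ • Ψ ξ)]
    congr 1
    rw [ha, hb]
    ring
  rw [m1, m2] at m3
  have hpi : (Real.pi : ℂ) ≠ 0 := by exact_mod_cast Real.pi_pos.ne'
  have hGa : Complex.Gamma a ≠ 0 := Complex.Gamma_ne_zero_of_re_pos ha0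
  have hpa : (Real.pi : ℂ) ^ (-a) ≠ 0 := by simp [Complex.cpow_eq_zero_iff, hpi]
  have i1 : ∫ ξ, 𝓕 φ ξ • homKer k (-m - μ) ξ = ∫ ξ : Eu m, (‖ξ‖ : ℂ) ^ (-2 * a) • Φ ξ := by
    refine integral_congr_ae (Eventually.of_forall fun ξ => ?_)
    simp only [homKer, hΦ]
    rw [smul_comm, show -2 * a = -m - μ - k by rw [ha]; ring]
  have i2 : ∫ ξ : Eu m, (‖ξ‖ : ℂ) ^ (-2 * b) • Ψ ξ = (-Complex.I) ^ k • ∫ ξ, φ ξ • homKer k μ ξ := by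
    rw [← integral_smul]
    refine integral_congr_ae (Eventually.of_forall fun ξ => ?_)
    simp only [homKer, hΨ]
    rw [show -2 * b = μ - k by rw [hb]; ring, mul_smul, smul_comm, smul_comm _ (φ ξ)]
  rw [i2] at m3
  rw [i1, ← smul_right_inj (mul_ne_zero hGa hpa), m3, smul_smul, smul_smul]
  congr 1
  have e2 : (Real.pi : ℂ) ^ (-b) = (Real.pi : ℂ) ^ (-a) * (Real.pi : ℂ) ^ (μ + m / 2) := by
    rw [← Complex.cpow_add _ _ hpi]
    congr 1
    rw [ha, hb]; ring
  rw [fourierConst, ← hb, show (μ + m + k : ℂ) / 2 = a by rw [ha]; ring, e2]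
  field_simp

/-- The Fourier transforms of `T_λ` (`k = 0`) and `U_λ` (`k = 1`). -/
theorem homDist_fourier (hm : 1 ≤ m) {k : ℕ} (hk : k ≤ 1) {μ : ℂ} (hμ : μ ∉ poles m k)
    (φ : 𝓢(Eu m, ℂ)) :
    homDist (vecPow m k) (-m - μ) (𝓕 φ) = fourierConst m k μ • homDist (vecPow m k) μ φ := by
  have hm' : (0 : ℝ) < m := by exact_mod_cast hm
  refine eq_of_differentiable_off_countable (S := poles m k)
    (V := {μ : ℂ | -(m : ℝ) < μ.re ∧ μ.re < 0})
    (f := fun μ => homDist (vecPow m k) (-m - μ) (𝓕 φ))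
    (g := fun μ => fourierConst m k μ • homDist (vecPow m k) μ φ)
    (intSet_countable _) (intSet_closed _) ?_ ?_ ?_ ?_ ?_ μ hμ
  · intro z hz
    exact DifferentiableAt.comp z (f := fun μ : ℂ => -m - μ)
      (differentiableAt_homDist (k := k) vecPow_neg (𝓕 φ) (notMem_poles_iff.1 hz).2) (by fun_prop)
  · intro z hz
    exact (differentiableAt_fourierConst hz).smul
      (differentiableAt_homDist (k := k) vecPow_neg φ (notMem_poles_iff.1 hz).1)
  · exact (isOpen_lt continuous_const Complex.continuous_re).inter
      (isOpen_lt Complex.continuous_re continuous_const)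
  · exact ⟨((-(m : ℝ) / 2 : ℝ) : ℂ), by constructor <;> simp only [Complex.ofReal_re] <;> linarith⟩
  · intro z hz _
    exact homDist_fourier_of_mem_strip hm hk hz.1 hz.2 φ

end Fourier

/-! ### Fourier transform of the Dirac operator -/

section Dirac

variable {m : ℕ}

theorem sum_dist_apply {ι : Type*} (s : Finset ι) (u : ι → ClDistribution m) (φ : 𝓢(Eu m, ℂ)) :
    (∑ i ∈ s, u i) φ = ∑ i ∈ s, u i φ :=
  map_sum ({ toFun := fun u : ClDistribution m => u φ, map_zero' := rfl,
             map_add' := fun _ _ => rfl } : ClDistribution m →+ Cl m) u s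

theorem dirac_apply (u : ClDistribution m) (φ : 𝓢(Eu m, ℂ)) :
    dirac u φ = ∑ j, e j * u (-∂_{EuclideanSpace.single j (1 : ℝ)} φ) := by
  rw [dirac, sum_dist_apply]
  rfl

theorem delta_apply (φ : 𝓢(Eu m, ℂ)) : delta m φ = φ 0 • (1 : Cl m) := rfl

/-- Multiplication of a test function by the coordinate `ξⱼ`. -/
def coordMul (j : Fin m) (φ : 𝓢(Eu m, ℂ)) : 𝓢(Eu m, ℂ) :=
  SchwartzMap.smulLeftCLM ℂ (fun ξ : Eu m => inner ℝ ξ (EuclideanSpace.single j (1 : ℝ))) φ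

theorem coordMul_apply (j : Fin m) (φ : 𝓢(Eu m, ℂ)) (ξ : Eu m) :
    coordMul j φ ξ = ((ξ j : ℝ) : ℂ) * φ ξ := by
  rw [coordMul, SchwartzMap.smulLeftCLM_apply_apply (by fun_prop), inner_single]
  simp

theorem neg_lineDeriv_fourier (j : Fin m) (φ : 𝓢(Eu m, ℂ)) :
    -∂_{EuclideanSpace.single j (1 : ℝ)} (𝓕 φ) = (2 * Real.pi * Complex.I) • 𝓕 (coordMul j φ) := by
  rw [SchwartzMap.lineDerivOp_fourier_eq, neg_smul, FourierTransform.fourier_neg, neg_neg,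
    FourierTransform.fourier_smul]
  rfl

theorem fourier_dirac_apply (u : ClDistribution m) (φ : 𝓢(Eu m, ℂ)) :
    𝓕 (dirac u) φ = (2 * Real.pi * Complex.I) • ∑ j, e j * 𝓕 u (coordMul j φ) := by
  rw [TemperedDistribution.fourier_apply, dirac_apply, Finset.smul_sum]
  refine Finset.sum_congr rfl fun j _ => ?_
  rw [neg_lineDeriv_fourier, map_smul, mul_smul_comm, TemperedDistribution.fourier_apply]

theorem fourier_neg_laplacian_apply (u : ClDistribution m) (φ : 𝓢(Eu m, ℂ)) :
    𝓕 (-Laplacian.laplacian u) φ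
      = (4 * Real.pi ^ 2 : ℂ) • ∑ j, 𝓕 u (coordMul j (coordMul j φ)) := by
  have h1 : 𝓕 (-Laplacian.laplacian u) φ = -(u (Laplacian.laplacian (𝓕 φ))) := by
    rw [TemperedDistribution.fourier_apply, ← TemperedDistribution.laplacian_apply_apply]
    rfl
  have hc : ((2 * Real.pi * Complex.I) * (2 * Real.pi * Complex.I) : ℂ) = -(4 * Real.pi ^ 2) := by
    have := Complex.I_mul_I
    linear_combination (4 * Real.pi ^ 2 : ℂ) * this
  have h2 : ∀ j : Fin m, ∂_{EuclideanSpace.single j (1 : ℝ)}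
      (∂_{EuclideanSpace.single j (1 : ℝ)} (𝓕 φ))
      = -((4 * Real.pi ^ 2 : ℂ) • 𝓕 (coordMul j (coordMul j φ))) := by
    intro j
    have h3 := neg_lineDeriv_fourier j φ
    rw [neg_eq_iff_eq_neg] at h3
    rw [h3, LineDeriv.lineDerivOp_neg, LineDeriv.lineDerivOp_smul, ← smul_neg,
      neg_lineDeriv_fourier, smul_smul, hc, neg_smul]
  rw [h1, SchwartzMap.laplacian_eq_sum (EuclideanSpace.basisFun (Fin m) ℝ), map_sum,
    ← Finset.sum_neg_distrib, Finset.smul_sum]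
  refine Finset.sum_congr rfl fun j _ => ?_
  rw [EuclideanSpace.basisFun_apply, h2, map_neg, neg_neg, map_smul, TemperedDistribution.fourier_apply]

/-- The Fourier transform of `u` is integration against `f`. -/
structure FourierIsFun (u : ClDistribution m) (f : Eu m → Cl m) : Prop where
  integrable : ∀ φ : 𝓢(Eu m, ℂ), Integrable (fun ξ => φ ξ • f ξ)
  eq : ∀ φ : 𝓢(Eu m, ℂ), 𝓕 u φ = ∫ ξ, φ ξ • f ξ

theorem fourierIsFun_delta : FourierIsFun (delta m) (fun _ => 1) where
  integrable φ := φ.integrable.smul_const _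
  eq φ := by
    rw [integral_smul_const, TemperedDistribution.fourier_apply, delta_apply,
      SchwartzMap.fourier_coe, Real.fourier_eq]
    simp

theorem smul_vec_mul_eq_sum (c : ℂ) (ξ : Eu m) (a : Cl m) :
    c • (vec ξ * a) = ∑ j, e j * ((((ξ j : ℝ) : ℂ) * c) • a) := by
  rw [vec, Finset.sum_mul, Finset.smul_sum]
  refine Finset.sum_congr rfl fun j _ => ?_
  rw [smul_mul_assoc, mul_smul_comm, smul_smul, mul_comm]

theorem FourierIsFun.dirac {u : ClDistribution m} {f : Eu m → Cl m} (h : FourierIsFun u f) :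
    FourierIsFun (dirac u) (fun ξ => (2 * Real.pi * Complex.I) • (vec ξ * f ξ)) := by
  have h1 : ∀ (φ : 𝓢(Eu m, ℂ)) (ξ : Eu m), φ ξ • ((2 * Real.pi * Complex.I) • (vec ξ * f ξ))
      = (2 * Real.pi * Complex.I) • ∑ j, mulCLM m (e j) (coordMul j φ ξ • f ξ) := by
    intro φ ξ
    rw [smul_comm, smul_vec_mul_eq_sum]
    simp [coordMul_apply]
  have h2 : ∀ (φ : 𝓢(Eu m, ℂ)) (j : Fin m),
      Integrable (fun ξ => mulCLM m (e j) (coordMul j φ ξ • f ξ)) :=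
    fun φ j => (mulCLM m (e j)).integrable_comp (h.integrable _)
  constructor
  · intro φ
    simp only [h1]
    exact (integrable_finsetSum _ fun j _ => h2 φ j).smul (2 * Real.pi * Complex.I)
  · intro φ
    simp only [h1]
    rw [integral_smul, integral_finsetSum _ fun j _ => h2 φ j, fourier_dirac_apply]
    congr 1
    refine Finset.sum_congr rfl fun j _ => ?_
    rw [(mulCLM m (e j)).integral_comp_comm (h.integrable _), h.eq, mulCLM_apply]

theorem FourierIsFun.neg_laplacian {u : ClDistribution m} {f : Eu m → Cl m}
    (h : FourierIsFun u f) :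
    FourierIsFun (-Laplacian.laplacian u)
      (fun ξ => (4 * Real.pi ^ 2 * (‖ξ‖ : ℂ) ^ 2 : ℂ) • f ξ) := by
  have h1 : ∀ (φ : 𝓢(Eu m, ℂ)) (ξ : Eu m), φ ξ • ((4 * Real.pi ^ 2 * (‖ξ‖ : ℂ) ^ 2 : ℂ) • f ξ)
      = (4 * Real.pi ^ 2 : ℂ) • ∑ j, (coordMul j (coordMul j φ) ξ • f ξ) := by
    intro φ ξ
    rw [← Finset.sum_smul, smul_smul, smul_smul]
    congr 1
    simp only [coordMul_apply]
    have h2 : (‖ξ‖ : ℂ) ^ 2 = ∑ j, ((ξ j : ℝ) : ℂ) ^ 2 := by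
      rw [← Complex.ofReal_pow, EuclideanSpace.norm_sq_eq]
      simp [← Complex.ofReal_pow]
    rw [h2, Finset.mul_sum, Finset.mul_sum, Finset.mul_sum]
    exact Finset.sum_congr rfl fun j _ => by ring
  constructor
  · intro φ
    simp only [h1]
    exact (integrable_finsetSum _ fun j _ => h.integrable _).smul (4 * Real.pi ^ 2 : ℂ)
  · intro φ
    simp only [h1]
    rw [integral_smul, integral_finsetSum _ fun j _ => h.integrable _, fourier_neg_laplacian_apply]
    congr 1
    exact Finset.sum_congr rfl fun j _ => h.eq _

theorem FourierIsFun.iterate_dirac (n : ℕ) :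
    FourierIsFun (DiracPowers.dirac^[n] (delta m))
      (fun ξ => (2 * Real.pi * Complex.I) ^ n • vec ξ ^ n) := by
  induction n with
  | zero => simpa using fourierIsFun_delta
  | succ n ih =>
    rw [Function.iterate_succ_apply']
    convert ih.dirac using 2 with ξ
    rw [mul_smul_comm, smul_smul, ← pow_succ', ← pow_succ']

theorem FourierIsFun.iterate_neg_laplacian (l : ℕ) :
    FourierIsFun ((fun u : ClDistribution m => -Laplacian.laplacian u)^[l] (delta m))
      (fun ξ => (4 * Real.pi ^ 2 * (‖ξ‖ : ℂ) ^ 2 : ℂ) ^ l • 1) := by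
  induction l with
  | zero => simpa using fourierIsFun_delta
  | succ n ih =>
    rw [Function.iterate_succ_apply']
    convert ih.neg_laplacian using 2 with ξ
    rw [smul_smul, ← pow_succ']

end Dirac

/-! ### The symbol of the complex power -/

section Symbol

variable {m : ℕ}

/-- The factors `(1 ± exp(iπμ)) / 2`. -/
def parityFactor (k : ℕ) (μ : ℂ) : ℂ := (1 + (-1) ^ k * Complex.exp (Complex.I * Real.pi * μ)) / 2

/-- The symbol of `∂^μ` on the unit sphere. -/
def symbolSphere (m : ℕ) (μ : ℂ) : C(Sph m, Cl m) :=
  ((2 * Real.pi : ℂ) ^ μ * parityFactor 0 μ) • vecPow m 0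
    + ((2 * Real.pi : ℂ) ^ μ * parityFactor 1 μ * Complex.I) • vecPow m 1

/-- The symbol of `∂^μ`. -/
def symbol (m : ℕ) (μ : ℂ) (ξ : Eu m) : Cl m :=
  ((2 * Real.pi : ℂ) ^ μ * parityFactor 0 μ) • homKer 0 μ ξ
    + ((2 * Real.pi : ℂ) ^ μ * parityFactor 1 μ * Complex.I) • homKer 1 μ ξ

theorem isHom_symbol (μ : ℂ) : IsHom (symbol m μ) (symbolSphere m μ) μ where
  cont := by
    have h0 := (isHom_homKer (m := m) 0 μ).cont
    have h1 := (isHom_homKer (m := m) 1 μ).cont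
    unfold symbol
    fun_prop
  eq ω r hr := by
    rw [symbol, (isHom_homKer 0 μ).eq ω r hr, (isHom_homKer 1 μ).eq ω r hr, symbolSphere]
    simp only [ContinuousMap.add_apply, ContinuousMap.smul_apply, smul_add]
    congr 1
    · exact smul_comm _ _ _
    · exact smul_comm _ _ _

/-- In terms of P± = (1 ± iω)/2 the symbol is (2π|ξ|)^μ (P₊ + e^{iπμ} P₋), and P± are orthogonal
idempotents. The proof checks this by comparing the coefficients of 1 and of ξ. At ξ = 0 the powers
of |ξ| do not add up in general. -/
theorem symbol_mul (μ ν : ℂ) {ξ : Eu m} (hξ : ξ ≠ 0) :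
    symbol m μ ξ * symbol m ν ξ = symbol m (μ + ν) ξ := by
  have h0 : (‖ξ‖ : ℂ) ≠ 0 := by exact_mod_cast (norm_pos_iff.2 hξ).ne'
  have hpi : (2 * Real.pi : ℂ) ≠ 0 := by
    exact_mod_cast (mul_pos two_pos Real.pi_pos).ne'
  have hv := vec_mul_vec ξ
  simp only [symbol, homKer, pow_zero, pow_one, Nat.cast_zero, sub_zero, Nat.cast_one, parityFactor]
  rw [add_mul, mul_add, mul_add]
  simp only [smul_mul_assoc, mul_smul_comm, one_mul, mul_one, hv, smul_smul]
  rw [Complex.cpow_sub _ _ h0, Complex.cpow_sub _ _ h0, Complex.cpow_sub _ _ h0, Complex.cpow_add _ _ h0,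
    Complex.cpow_add _ _ hpi, mul_add, Complex.exp_add, Complex.cpow_one]
  set A := (‖ξ‖ : ℂ) ^ μ
  set B := (‖ξ‖ : ℂ) ^ ν
  set r := (‖ξ‖ : ℂ)
  set E := Complex.exp (Complex.I * Real.pi * μ)
  set G := Complex.exp (Complex.I * Real.pi * ν)
  set P := (2 * Real.pi : ℂ) ^ μ
  set Q := (2 * Real.pi : ℂ) ^ ν
  have hI : Complex.I * Complex.I = -1 := Complex.I_mul_I
  have e1 : ∀ a b c d : ℂ, ∀ x : Cl m, a • (1 : Cl m) + b • x + (c • x + d • (1 : Cl m))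
      = (a + d) • (1 : Cl m) + (b + c) • x := by
    intro a b c d x
    module
  rw [e1]
  congr 2
  · field_simp
    have hI2 : Complex.I ^ 2 = -1 := Complex.I_sq
    ring_nf
    rw [hI2]
    ring
  · field_simp
    ring

theorem sphericalMean_add (h h' : C(Sph m, Cl m)) (φ : 𝓢(Eu m, ℂ)) :
    sphericalMean (h + h') φ = sphericalMean h φ + sphericalMean h' φ := by
  ext r
  simp only [add_apply, sphericalMean_apply, ContinuousMap.add_apply, smul_add]
  exact integral_add (integrable_sphere h.continuous φ r) (integrable_sphere h'.continuous φ r)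

theorem sphericalMean_smul (c : ℂ) (h : C(Sph m, Cl m)) (φ : 𝓢(Eu m, ℂ)) :
    sphericalMean (c • h) φ = c • sphericalMean h φ := by
  ext r
  simp only [smul_apply, sphericalMean_apply, ContinuousMap.smul_apply, smul_comm _ c]
  exact integral_smul c _

theorem homDist_add (h h' : C(Sph m, Cl m)) (lam : ℂ) (φ : 𝓢(Eu m, ℂ)) :
    homDist (h + h') lam φ = homDist h lam φ + homDist h' lam φ := by
  rw [homDist_apply, sphericalMean_add, fpRayFun_add]; rfl

theorem homDist_smul (c : ℂ) (h : C(Sph m, Cl m)) (lam : ℂ) (φ : 𝓢(Eu m, ℂ)) :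
    homDist (c • h) lam φ = c • homDist h lam φ := by
  rw [homDist_apply, sphericalMean_smul, fpRayFun_smul]; rfl

theorem homDist_symbolSphere (μ lam : ℂ) (φ : 𝓢(Eu m, ℂ)) :
    homDist (symbolSphere m μ) lam φ
      = ((2 * Real.pi : ℂ) ^ μ * parityFactor 0 μ) • homDist (vecPow m 0) lam φ
        + ((2 * Real.pi : ℂ) ^ μ * parityFactor 1 μ * Complex.I) • homDist (vecPow m 1) lam φ := by
  rw [symbolSphere, homDist_add, homDist_smul, homDist_smul]

end Symbol

/-! ### The Fourier transform of the kernel of the complex power -/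

section Main

variable {m : ℕ}

/-- The exponents for which the kernel of `∂^μ` is defined. -/
def Admissible (m : ℕ) (μ : ℂ) : Prop := Even m → ∀ n : ℕ, μ ≠ -m - n

theorem exp_I_pi_int (n : ℤ) : Complex.exp (Complex.I * Real.pi * n) = (-1) ^ n := by
  rw [show Complex.I * Real.pi * n = n * (Real.pi * Complex.I) by ring, Complex.exp_int_mul,
    Complex.exp_pi_mul_I]

theorem parityFactor_eq_zero {k : ℕ} {n : ℤ} (hn : Odd (n + k)) : parityFactor k n = 0 := by
  rw [parityFactor, exp_I_pi_int, ← zpow_natCast, ← zpow_add₀ (by norm_num), add_comm (k : ℤ) n,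
    hn.neg_one_zpow]
  simp

/-- At a pole of the distribution of type `k`, the parity factor vanishes. -/
theorem regularAt_or_parityFactor_eq_zero {μ : ℂ} (hμ : Admissible m μ) (k : ℕ) :
    RegularAt m k μ ∨ parityFactor k μ = 0 := by
  by_contra hcon
  rw [not_or, RegularAt] at hcon
  push Not at hcon
  obtain ⟨⟨j, hj, rfl⟩, h2⟩ := hcon
  -- Even m is excluded by admissibility. For odd m, the integer -m - j + k is odd because j + k is
  -- even.
  rcases Nat.even_or_odd m with he | ho
  · exact hμ he j rfl
  · refine h2 ?_
    have h3 : (-m - j : ℂ) = ((-m - j : ℤ) : ℂ) := by push_cast; rfl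
    rw [h3]
    refine parityFactor_eq_zero ?_
    have h4 : Odd ((m + (j + k) : ℕ) : ℤ) := by exact_mod_cast ho.add_even hj
    have h5 : (-m - j + k : ℤ) = ((m + (j + k) : ℕ) : ℤ) - 2 * (m + j) := by push_cast; ring
    rw [h5]
    exact h4.sub_even (even_two_mul _)

/-- The coefficients of the (finite part) distributions in `∂^μ δ`. -/
def powCoeff (m k : ℕ) (μ : ℂ) : ℂ :=
  (-1) ^ k * (parityFactor k μ * ((2 : ℂ) ^ μ * Complex.Gamma ((m + μ + k) / 2) /
    (Real.pi : ℂ) ^ ((m - μ + k) / 2)) * ((Real.pi : ℂ) ^ ((k - μ) / 2) / Complex.Gamma ((k - μ) / 2)))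

theorem two_mul_pi_cpow (μ : ℂ) : (2 * Real.pi : ℂ) ^ μ = (2 : ℂ) ^ μ * (Real.pi : ℂ) ^ μ := by
  have h := Complex.mul_cpow_ofReal_nonneg (a := 2) (b := Real.pi) zero_le_two Real.pi_pos.le μ
  simpa using h

/-- The Gamma factors in the normalisation of ∂^μ δ are the inverses of those in the Fourier
constant; off the poles they cancel, leaving the coefficient of the symbol. -/
theorem powCoeff_mul_fourierConst {k : ℕ} {μ : ℂ} (hμ : μ ∉ poles m k) :
    powCoeff m k μ * fourierConst m k μ = (2 * Real.pi : ℂ) ^ μ * parityFactor k μ * Complex.I ^ k := by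
  have hpi : (Real.pi : ℂ) ≠ 0 := by exact_mod_cast Real.pi_pos.ne'
  have h1 : Complex.Gamma ((m + μ + k) / 2) ≠ 0 := by
    refine Complex.Gamma_ne_zero fun n hn => ?_
    refine (notMem_poles_iff.1 hμ).1 (k + 2 * n) (by simp [parity_simps]) ?_
    push_cast
    linear_combination 2 * hn
  have h2 : Complex.Gamma ((k - μ) / 2) ≠ 0 := by
    refine Complex.Gamma_ne_zero fun n hn => ?_
    refine (notMem_poles_iff.1 hμ).2 (k + 2 * n) (by simp [parity_simps]) ?_
    push_cast
    linear_combination 2 * hn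
  have e1 : (Real.pi : ℂ) ^ ((k - μ) / 2) * (Real.pi : ℂ) ^ (μ + m / 2)
      = (Real.pi : ℂ) ^ μ * (Real.pi : ℂ) ^ ((m - μ + k) / 2) := by
    rw [← Complex.cpow_add _ _ hpi, ← Complex.cpow_add _ _ hpi]
    congr 1; ring
  have h3 : (Real.pi : ℂ) ^ ((m - μ + k) / 2) ≠ 0 := by simp [Complex.cpow_eq_zero_iff, hpi]
  have e2 : (-1 : ℂ) ^ k * (-Complex.I) ^ k = Complex.I ^ k := by
    rw [← mul_pow]; simp
  rw [powCoeff, fourierConst, two_mul_pi_cpow, show (μ + m + k : ℂ) = m + μ + k by ring, ← e2]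
  calc _ = (-1 : ℂ) ^ k * (-Complex.I) ^ k * parityFactor k μ * (2 : ℂ) ^ μ *
        ((Real.pi : ℂ) ^ ((k - μ) / 2) * (Real.pi : ℂ) ^ (μ + m / 2))
        / (Real.pi : ℂ) ^ ((m - μ + k) / 2) *
        (Complex.Gamma ((m + μ + k) / 2) * (Complex.Gamma ((m + μ + k) / 2))⁻¹) *
        (Complex.Gamma ((k - μ) / 2) / Complex.Gamma ((k - μ) / 2)) := by ring
    _ = _ := by
      rw [e1, mul_inv_cancel₀ h1, div_self h2]
      field_simp

/-- The degree k + 2l is non-negative, hence above -m, and the finite part is an honest integral. -/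
theorem homDist_natCast (hm : 1 ≤ m) (k l : ℕ) {u : ClDistribution m} {c : ℂ}
    (h : FourierIsFun u (fun ξ => c • homKer k ((k : ℂ) + 2 * l) ξ)) (φ : 𝓢(Eu m, ℂ)) :
    𝓕 u φ = c • homDist (vecPow m k) ((k : ℂ) + 2 * l) φ := by
  rw [h.eq, homDist_eq_integral hm (isHom_homKer k _), ← integral_smul]
  · refine integral_congr_ae (Eventually.of_forall fun ξ => ?_)
    simp only [smul_comm c]
  · have : ((k : ℂ) + 2 * l).re = k + 2 * l := by simp
    rw [this]
    have : (0 : ℝ) < m := by exact_mod_cast hm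
    have h1 : (0 : ℝ) ≤ k + 2 * l := by positivity
    linarith

end Main

/-! ### The parity parts of ∂^μ δ, their Fourier transforms, and the exchange formula -/

section Kernel

variable {m : ℕ}

/-- The index l is determined by the exponent, so the chosen witness in the definition is the given
one. -/
theorem TStar_even (l : ℕ) :
    TStar m (-m - 2 * l) = ((Real.pi : ℂ) ^ ((m : ℂ) / 2 - l)
        / (2 ^ (2 * l) * Complex.Gamma ((m : ℂ) / 2 + l))) •
      (fun u : ClDistribution m => -Laplacian.laplacian u)^[l] (delta m) := by
  have h : ∃ l' : ℕ, (-m - 2 * l : ℂ) = -m - 2 * l' := ⟨l, rfl⟩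
  have hl : h.choose = l := by
    have h1 := h.choose_spec
    have h2 : (l : ℂ) = h.choose := by linear_combination (-1 / 2 : ℂ) * h1
    exact_mod_cast h2.symm
  rw [TStar, dif_pos h, hl]

theorem TStar_of_ne {lam : ℂ} (h : ∀ l : ℕ, lam ≠ -m - 2 * l) :
    TStar m lam = ((Real.pi : ℂ) ^ ((lam + m) / 2) / Complex.Gamma ((lam + m) / 2)) • T m lam := by
  rw [TStar, dif_neg (not_exists.2 h)]

theorem UStar_odd (l : ℕ) :
    UStar m (-m - 2 * l - 1) = (-((Real.pi : ℂ) ^ ((m : ℂ) / 2 - l)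
        / (2 ^ (2 * l + 1) * Complex.Gamma ((m : ℂ) / 2 + l + 1)))) •
      dirac^[2 * l + 1] (delta m) := by
  have h : ∃ l' : ℕ, (-m - 2 * l - 1 : ℂ) = -m - 2 * l' - 1 := ⟨l, rfl⟩
  have hl : h.choose = l := by
    have h1 := h.choose_spec
    have h2 : (l : ℂ) = h.choose := by linear_combination (-1 / 2 : ℂ) * h1
    exact_mod_cast h2.symm
  rw [UStar, dif_pos h, hl]

theorem UStar_of_ne {lam : ℂ} (h : ∀ l : ℕ, lam ≠ -m - 2 * l - 1) :
    UStar m lam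
      = ((Real.pi : ℂ) ^ ((lam + m + 1) / 2) / Complex.Gamma ((lam + m + 1) / 2)) • U m lam := by
  rw [UStar, dif_neg (not_exists.2 h)]

/-- The part of `∂^μ δ` of parity `k`. -/
def powPart (m k : ℕ) (μ : ℂ) : ClDistribution m :=
  if k = 0 then
    ((1 + Complex.exp (Complex.I * Real.pi * μ)) / 2 *
      ((2 : ℂ) ^ μ * Complex.Gamma ((m + μ) / 2) / (Real.pi : ℂ) ^ ((m - μ) / 2))) •
    TStar m (-m - μ)
  else (-((1 - Complex.exp (Complex.I * Real.pi * μ)) / 2 *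
      ((2 : ℂ) ^ μ * Complex.Gamma ((m + μ + 1) / 2) / (Real.pi : ℂ) ^ ((m - μ + 1) / 2)))) •
    UStar m (-m - μ)

theorem diracPow_eq_add (μ : ℂ) : diracPow m μ = powPart m 0 μ + powPart m 1 μ := by
  rw [diracPow, powPart, powPart, if_pos rfl, if_neg one_ne_zero, neg_smul, sub_eq_add_neg]

theorem powPart_eq_zero {k : ℕ} (hk : k ≤ 1) {μ : ℂ} (h : parityFactor k μ = 0) :
    powPart m k μ = 0 := by
  interval_cases k
  · have h1 : (1 + Complex.exp (Complex.I * Real.pi * μ)) / 2 = 0 := by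
      simpa [parityFactor] using h
    rw [powPart, if_pos rfl, h1, zero_mul, zero_smul]
  · have h1 : (1 - Complex.exp (Complex.I * Real.pi * μ)) / 2 = 0 := by
      simpa [parityFactor, ← sub_eq_add_neg] using h
    rw [powPart, if_neg one_ne_zero, h1, zero_mul, neg_zero, zero_smul]

theorem smul_dist_apply (c : ℂ) (u : ClDistribution m) (φ : 𝓢(Eu m, ℂ)) : (c • u) φ = c • u φ := rfl

/-- The values μ = k + 2l are exactly those at which the normalised distribution of exponent -m - μ
is defined by derivatives of δ. -/
theorem powPart_eq_homDist {k : ℕ} (hk : k ≤ 1) {μ : ℂ} (h : ∀ l : ℕ, μ ≠ k + 2 * l)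
    (φ : 𝓢(Eu m, ℂ)) :
    powPart m k μ φ = powCoeff m k μ • homDist (vecPow m k) (-m - μ) φ := by
  interval_cases k
  · rw [powPart, if_pos rfl, TStar_of_ne, smul_dist_apply, smul_dist_apply, T_eq_homDist, smul_smul]
    · congr 1
      rw [powCoeff, parityFactor]
      have e1 : (-m - μ + m : ℂ) = -μ := by ring
      simp [e1]
    · intro l hl
      refine h l ?_
      push_cast
      linear_combination -hl
  · rw [powPart, if_neg one_ne_zero, UStar_of_ne, smul_dist_apply, smul_dist_apply, U_eq_homDist,
      smul_smul]
    · congr 1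
      rw [powCoeff, parityFactor]
      have e1 : (-m - μ + m + 1 : ℂ) = 1 - μ := by ring
      simp only [e1, Nat.cast_one, pow_one]
      ring
    · intro l hl
      refine h l ?_
      push_cast
      linear_combination -hl

/-- The parity factor equals 1, and the remaining prefactor is inverse to the constant in the
exceptional normalisation. -/
theorem powPart_zero_even (hm : 1 ≤ m) (l : ℕ) :
    powPart m 0 ((0 : ℕ) + 2 * l) = (fun u : ClDistribution m => -Laplacian.laplacian u)^[l] (delta m) := by
  have hm0 : (0 : ℝ) < m := by exact_mod_cast hm
  have hpi : (Real.pi : ℂ) ≠ 0 := by exact_mod_cast Real.pi_pos.ne'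
  have e1 : Complex.exp (Complex.I * Real.pi * (2 * l)) = 1 := by
    have := exp_I_pi_int (2 * l)
    push_cast at this
    rw [this, even_two_mul (l : ℤ) |>.neg_one_zpow]
  have hG : Complex.Gamma ((m : ℂ) / 2 + l) ≠ 0 := by
    refine Complex.Gamma_ne_zero_of_re_pos ?_
    have : ((m : ℂ) / 2 + l).re = m / 2 + l := by simp
    rw [this]; positivity
  have hP : (Real.pi : ℂ) ^ ((m : ℂ) / 2 - l) ≠ 0 := by simp [Complex.cpow_eq_zero_iff, hpi]
  rw [powPart, if_pos rfl, Nat.cast_zero, zero_add, TStar_even, smul_smul, e1]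
  rw [show ((m : ℂ) + 2 * l) / 2 = m / 2 + l by ring, show ((m : ℂ) - 2 * l) / 2 = m / 2 - l by ring]
  have e2 : (2 : ℂ) ^ (2 * l : ℂ) = 2 ^ (2 * l) := by
    rw [← Complex.cpow_natCast]; push_cast; rfl
  rw [e2]
  set G := Complex.Gamma ((m : ℂ) / 2 + l)
  convert one_smul ℂ _ using 2
  field_simp
  norm_num

theorem powPart_one_odd (hm : 1 ≤ m) (l : ℕ) :
    powPart m 1 ((1 : ℕ) + 2 * l) = dirac^[2 * l + 1] (delta m) := by
  have hm0 : (0 : ℝ) < m := by exact_mod_cast hm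
  have hpi : (Real.pi : ℂ) ≠ 0 := by exact_mod_cast Real.pi_pos.ne'
  have e1 : Complex.exp (Complex.I * Real.pi * (1 + 2 * l)) = -1 := by
    have := exp_I_pi_int (1 + 2 * l)
    push_cast at this
    rw [this, Odd.neg_one_zpow ⟨l, by ring⟩]
  have hG : Complex.Gamma ((m : ℂ) / 2 + l + 1) ≠ 0 := by
    refine Complex.Gamma_ne_zero_of_re_pos ?_
    have : ((m : ℂ) / 2 + l + 1).re = m / 2 + l + 1 := by simp
    rw [this]; positivity
  have hP : (Real.pi : ℂ) ^ ((m : ℂ) / 2 - l) ≠ 0 := by simp [Complex.cpow_eq_zero_iff, hpi]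
  rw [powPart, if_neg one_ne_zero, Nat.cast_one,
    show (-m - (1 + 2 * l) : ℂ) = -m - 2 * l - 1 by ring, UStar_odd, smul_smul, e1]
  rw [show ((m : ℂ) + (1 + 2 * l) + 1) / 2 = m / 2 + l + 1 by ring,
    show ((m : ℂ) - (1 + 2 * l) + 1) / 2 = m / 2 - l by ring]
  have e2 : (2 : ℂ) ^ (1 + 2 * l : ℂ) = 2 ^ (2 * l + 1) := by
    rw [← Complex.cpow_natCast]; push_cast; rw [add_comm]
  rw [e2]
  set G := Complex.Gamma ((m : ℂ) / 2 + l + 1)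
  convert one_smul ℂ _ using 2
  field_simp
  norm_num

theorem vec_pow_odd (ξ : Eu m) (l : ℕ) :
    vec ξ ^ (2 * l + 1) = ((-1) ^ l * (‖ξ‖ : ℂ) ^ (2 * l)) • vec ξ := by
  rw [pow_succ, pow_mul, sq, vec_mul_vec, smul_pow, one_pow, smul_mul_assoc, one_mul, neg_pow,
    ← pow_mul]

/-- Three cases: at a singular exponent of the target both sides vanish with the parity factor; at μ
= k + 2l a differentiated δ has a polynomial transform; otherwise μ avoids `poles` and
`homDist_fourier` applies. -/
theorem fourier_powPart (hm : 1 ≤ m) {k : ℕ} (hk : k ≤ 1) {μ : ℂ} (hμ : Admissible m μ)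
    (φ : 𝓢(Eu m, ℂ)) :
    𝓕 (powPart m k μ) φ
      = ((2 * Real.pi : ℂ) ^ μ * parityFactor k μ * Complex.I ^ k) • homDist (vecPow m k) μ φ := by
  rcases regularAt_or_parityFactor_eq_zero hμ k with hreg | hzero
  swap
  · rw [powPart_eq_zero hk hzero, hzero, TemperedDistribution.fourier_apply]
    simp
  by_cases hl : ∃ l : ℕ, μ = k + 2 * l
  · obtain ⟨l, rfl⟩ := hl
    have hpi : (2 * Real.pi : ℂ) ≠ 0 := by exact_mod_cast (mul_pos two_pos Real.pi_pos).ne'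
    interval_cases k
    · rw [powPart_zero_even hm]
      refine homDist_natCast hm 0 l ?_ φ
      convert FourierIsFun.iterate_neg_laplacian l using 2 with ξ
      have e1 : Complex.exp (Complex.I * Real.pi * (2 * l)) = 1 := by
        have := exp_I_pi_int (2 * l)
        push_cast at this
        rw [this, even_two_mul (l : ℤ) |>.neg_one_zpow]
      have e2 : ∀ z : ℂ, z ^ (2 * l : ℂ) = z ^ (2 * l) := fun z => by
        rw [← Complex.cpow_natCast]; push_cast; rfl
      simp only [homKer, parityFactor, Nat.cast_zero, zero_add, e1, e2, sub_zero, pow_zero, smul_smul]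
      congr 1
      rw [pow_mul, pow_mul, mul_pow (4 * (Real.pi : ℂ) ^ 2)]
      norm_num [mul_pow]
    · rw [powPart_one_odd hm]
      refine homDist_natCast hm 1 l ?_ φ
      convert FourierIsFun.iterate_dirac (2 * l + 1) using 2 with ξ
      have e1 : Complex.exp (Complex.I * Real.pi * (1 + 2 * l)) = -1 := by
        have := exp_I_pi_int (1 + 2 * l)
        push_cast at this
        rw [this, Odd.neg_one_zpow ⟨l, by ring⟩]
      have e2 : ∀ z : ℂ, z ^ (2 * l : ℂ) = z ^ (2 * l) := fun z => by
        rw [← Complex.cpow_natCast]; push_cast; rfl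
      have e3 : (2 * Real.pi : ℂ) ^ (1 + 2 * l : ℂ) = (2 * Real.pi) ^ (2 * l + 1) := by
        rw [← Complex.cpow_natCast]; push_cast; rw [add_comm]
      have e4 : (1 + 2 * l - 1 : ℂ) = 2 * l := by ring
      have e5 : Complex.I ^ (2 * l) = (-1) ^ l := by rw [pow_mul, Complex.I_sq]
      rw [vec_pow_odd]
      simp only [homKer, parityFactor, Nat.cast_one, e1, e2, e3, e4, pow_one, smul_smul]
      congr 1
      rw [mul_pow _ Complex.I, pow_succ Complex.I, e5]
      have e6 : ((-1 : ℂ) ^ l) * (-1) ^ l = 1 := by rw [← mul_pow]; simp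
      linear_combination -((2 * Real.pi : ℂ) ^ (2 * l + 1) * Complex.I * (‖ξ‖ : ℂ) ^ (2 * l)) * e6
  · rw [not_exists] at hl
    have hμ' : μ ∉ poles m k := by
      refine notMem_poles_iff.2 ⟨hreg, fun j hj h => ?_⟩
      have hj1 : μ = j := by linear_combination -h
      -- From j + k = 2a and k ≤ 1 one gets a ≥ k and j = k + 2(a - k).
      obtain ⟨l, hl'⟩ : ∃ l, j = k + 2 * l := by
        obtain ⟨a, ha⟩ := hj
        exact ⟨a - k, by omega⟩
      exact hl l (by rw [hj1, hl']; push_cast; rfl)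
    rw [TemperedDistribution.fourier_apply, powPart_eq_homDist hk hl, homDist_fourier hm hk hμ',
      smul_smul, powCoeff_mul_fourierConst hμ']

/-- The Fourier transform of `∂^μ δ`. -/
theorem fourier_diracPow (hm : 1 ≤ m) {μ : ℂ} (hμ : Admissible m μ) (φ : 𝓢(Eu m, ℂ)) :
    𝓕 (diracPow m μ) φ = homDist (symbolSphere m μ) μ φ := by
  have h : 𝓕 (diracPow m μ) φ = 𝓕 (powPart m 0 μ) φ + 𝓕 (powPart m 1 μ) φ := by
    rw [diracPow_eq_add]; rfl
  rw [h, fourier_powPart hm zero_le_one hμ, fourier_powPart hm le_rfl hμ, homDist_symbolSphere,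
    pow_zero, mul_one, pow_one]

theorem isFinitePart_fourier_diracPow (hm : 1 ≤ m) {μ : ℂ} (hμ : Admissible m μ) {f : Eu m → Cl m}
    (hf : IsHom f (symbolSphere m μ) μ) : IsFinitePart f (𝓕 (diracPow m μ)) := by
  intro φ
  rw [fourier_diracPow hm hμ]
  exact isFinitePart_homDist hm hf φ

/-- The product of the two symbols is homogeneous with the sphere values of the symbol of ∂^(μ+ν);
`IsHom` ignores the origin, where the product rule may fail. -/
theorem isConvolution_diracPow (hm : 1 ≤ m) {μ ν : ℂ} (hμ : Admissible m μ) (hν : Admissible m ν)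
    (hs : Admissible m (μ + ν)) :
    IsConvolution (diracPow m μ) (diracPow m ν) (diracPow m (μ + ν)) := by
  refine ⟨symbol m μ, symbol m ν, (isHom_symbol μ).cont, (isHom_symbol ν).cont,
    isFinitePart_fourier_diracPow hm hμ (isHom_symbol μ),
    isFinitePart_fourier_diracPow hm hν (isHom_symbol ν),
    isFinitePart_fourier_diracPow hm hs ⟨(isHom_symbol μ).cont.mul (isHom_symbol ν).cont,
      fun ω r hr => ?_⟩⟩
  rw [symbol_mul, (isHom_symbol (μ + ν)).eq ω r hr]
  intro h0
  have := congrArg norm h0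
  rw [norm_smul] at this
  simp [hr.ne'] at this

end Kernel

/-! ### Integrals depending holomorphically on a parameter -/

/-- Cauchy's estimate on small circles converts the bound on F into a bound on its derivative in z,
and the derivative is measurable as a limit of difference quotients. -/
theorem differentiableAt_integral_of_bound {α E : Type*} [MeasurableSpace α] {ν : Measure α}
    [NormedAddCommGroup E] [NormedSpace ℂ E] [CompleteSpace E] {F : ℂ → α → E} {z₀ : ℂ} {b : α → ℝ}
    (hb : Integrable b ν) (hmeas : ∀ᶠ z in 𝓝 z₀, AEStronglyMeasurable (F z) ν)
    (hd : ∀ᶠ z in 𝓝 z₀, ∀ a, DifferentiableAt ℂ (fun z => F z a) z)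
    (hbd : ∀ᶠ z in 𝓝 z₀, ∀ a, ‖F z a‖ ≤ b a) :
    DifferentiableAt ℂ (fun z => ∫ a, F z a ∂ν) z₀ := by
  obtain ⟨ε, hε, hball⟩ := Metric.eventually_nhds_iff_ball.1 (hmeas.and (hd.and hbd))
  set r := ε / 2 with hr
  have hr0 : 0 < r := by positivity
  have hsub : ∀ z ∈ Metric.ball z₀ r, ∀ w ∈ Metric.closedBall z r, w ∈ Metric.ball z₀ ε := by
    intro z hz w hw
    rw [Metric.mem_ball] at hz ⊢
    rw [Metric.mem_closedBall] at hw
    linarith [dist_triangle w z z₀]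
  have hz₀ : z₀ ∈ Metric.ball z₀ ε := Metric.mem_ball_self hε
  have hderiv : ∀ a, ∀ z ∈ Metric.ball z₀ r, ‖deriv (fun z => F z a) z‖ ≤ b a / r := by
    intro a z hz
    refine Complex.norm_deriv_le_of_forall_mem_sphere_norm_le hr0 ?_ fun w hw =>
      (hball w (hsub z hz w (Metric.sphere_subset_closedBall hw))).2.2 a
    refine DifferentiableOn.diffContOnCl fun w hw => ?_
    rw [closure_ball z hr0.ne'] at hw
    exact ((hball w (hsub z hz w hw)).2.1 a).differentiableWithinAt
  have hmeas' : AEStronglyMeasurable (fun a => deriv (fun z => F z a) z₀) ν := by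
    set s : ℕ → ℂ := fun n => ((r / (n + 2) : ℝ) : ℂ) with hs
    have hs0 : ∀ n, s n ≠ 0 := fun n => by
      rw [hs]; simp only [ne_eq, Complex.ofReal_eq_zero]; positivity
    have hsr : ∀ n, z₀ + s n ∈ Metric.ball z₀ ε := fun n => by
      rw [Metric.mem_ball, dist_eq_norm, add_sub_cancel_left, hs, Complex.norm_real,
        Real.norm_of_nonneg (by positivity)]
      have : r / (n + 2) ≤ r := div_le_self hr0.le (by linarith [(Nat.cast_nonneg n : (0:ℝ) ≤ n)])
      linarith
    have hst : Tendsto s atTop (𝓝 0) := by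
      have h1 : Tendsto (fun n : ℕ => r / ((n : ℝ) + 2)) atTop (𝓝 0) :=
        Tendsto.div_atTop tendsto_const_nhds
          (tendsto_atTop_add_const_right _ _ tendsto_natCast_atTop_atTop)
      have h2 := (Complex.continuous_ofReal.tendsto 0).comp h1
      rwa [Complex.ofReal_zero] at h2
    refine aestronglyMeasurable_of_tendsto_ae atTop
      (f := fun n a => (s n)⁻¹ • (F (z₀ + s n) a - F z₀ a))
      (fun n => (((hball _ (hsr n)).1.sub (hball _ hz₀).1).const_smul _))
      (Eventually.of_forall fun a => ?_)
    have h1 := ((hball _ hz₀).2.1 a).hasDerivAt.tendsto_slope_zero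
    exact h1.comp (tendsto_nhdsWithin_iff.2 ⟨hst, Eventually.of_forall hs0⟩)
  refine (hasDerivAt_integral_of_dominated_loc_of_deriv_le (Metric.ball_mem_nhds z₀ hr0)
    (F' := fun z a => deriv (fun z => F z a) z) (bound := fun a => b a / r) hmeas ?_ hmeas'
    (Eventually.of_forall hderiv) (hb.div_const r)
    (Eventually.of_forall fun a z hz =>
      ((hball z (hsub z hz z (Metric.mem_closedBall_self hr0.le))).2.1 a).hasDerivAt)).2.differentiableAt
  exact hb.mono' (hball _ hz₀).1 (Eventually.of_forall fun a => (hball _ hz₀).2.2 a)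

/-! ### Regularisations are continuous -/

section Regularize

variable {m : ℕ}

theorem reflTranslate_apply (x y : Eu m) (φ : 𝓢(Eu m, ℂ)) : reflTranslate x φ y = φ (x - y) := rfl

theorem iteratedFDeriv_reflTranslate (n : ℕ) (x y : Eu m) (φ : 𝓢(Eu m, ℂ)) :
    iteratedFDeriv ℝ n (reflTranslate x φ) y = (-1 : ℝ) ^ n • iteratedFDeriv ℝ n φ (x - y) := by
  have h : (reflTranslate x φ : Eu m → ℂ)
      = (fun z => φ (x + z)) ∘ (-ContinuousLinearMap.id ℝ (Eu m)) := by
    ext y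
    simp [reflTranslate_apply, sub_eq_add_neg]
  have h1 : ContDiff ℝ n (fun z => φ (x + z)) := (φ.smooth n).comp (contDiff_const.add contDiff_id)
  rw [h, ContinuousLinearMap.iteratedFDeriv_comp_right _ h1 y le_rfl, iteratedFDeriv_comp_add_left]
  ext v
  have h2 : ∀ i, (-ContinuousLinearMap.id ℝ (Eu m)) (v i) = (-1 : ℝ) • v i := fun i => by simp
  simp only [ContinuousMultilinearMap.compContinuousLinearMap_apply, h2,
    ContinuousMultilinearMap.map_smul_univ, smul_apply]
  simp [sub_eq_add_neg]

theorem norm_iteratedFDeriv_reflTranslate (n : ℕ) (x y : Eu m) (φ : 𝓢(Eu m, ℂ)) :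
    ‖iteratedFDeriv ℝ n (reflTranslate x φ) y‖ = ‖iteratedFDeriv ℝ n φ (x - y)‖ := by
  rw [iteratedFDeriv_reflTranslate, norm_smul]
  simp

/-- The mean value inequality in x, with the decay of the derivative of order n + 1 absorbing the
weight ‖y‖^k uniformly in y. -/
theorem continuous_reflTranslate (φ : 𝓢(Eu m, ℂ)) : Continuous fun x => reflTranslate x φ := by
  refine continuous_iff_continuousAt.2 fun x => ?_
  refine ((schwartz_withSeminorms ℂ (Eu m) ℂ).tendsto_nhds _ _).2 fun ⟨k, n⟩ ε hε => ?_
  obtain ⟨C, hC0, hC⟩ := schwartz_norm_le φ (n + 1) k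
  set K : ℝ := C * (2 + ‖x‖) ^ k with hK
  have hK0 : 0 ≤ K := by positivity
  have hbound : ∀ x' ∈ Metric.closedBall x 1, ∀ y : Eu m,
      ‖y‖ ^ k * ‖iteratedFDeriv ℝ n φ (x' - y) - iteratedFDeriv ℝ n φ (x - y)‖ ≤ K * ‖x' - x‖ := by
    intro x' hx' y
    have h1 : ∀ z ∈ Metric.closedBall x 1,
        ‖fderiv ℝ (fun z => iteratedFDeriv ℝ n φ (z - y)) z‖ ≤ C * (1 + ‖z - y‖) ^ (-(k : ℝ)) := by
      intro z _
      rw [fderiv_comp_sub, norm_fderiv_iteratedFDeriv]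
      exact hC _
    have h2 : ∀ z ∈ Metric.closedBall x 1,
        ‖y‖ ^ k * (C * (1 + ‖z - y‖) ^ (-(k : ℝ))) ≤ K := by
      intro z hz
      have hz' : ‖z‖ ≤ ‖x‖ + 1 := by
        rw [mem_closedBall_iff_norm] at hz
        linarith [norm_sub_norm_le z x]
      -- As z stays within distance 1 of x, a large y forces a large z - y, where φ decays.
      have h3 : ‖y‖ ≤ (2 + ‖x‖) * (1 + ‖z - y‖) := by
        have := norm_sub_norm_le y z
        rw [norm_sub_rev] at this
        nlinarith [norm_nonneg x, norm_nonneg (z - y)]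
      rw [Real.rpow_neg (by positivity), Real.rpow_natCast, ← div_eq_mul_inv, ← mul_div_assoc,
        div_le_iff₀ (by positivity)]
      calc ‖y‖ ^ k * C ≤ ((2 + ‖x‖) * (1 + ‖z - y‖)) ^ k * C := by gcongr
        _ = _ := by rw [mul_pow, hK]; ring
    have hdiff : Differentiable ℝ (iteratedFDeriv ℝ n φ) :=
      (φ.smooth (n + 1)).differentiable_iteratedFDeriv (by exact_mod_cast Nat.lt_succ_self n)
    by_cases hy : ‖y‖ ^ k = 0
    · rw [hy, zero_mul]; positivity
    have hy0 : 0 < ‖y‖ ^ k := lt_of_le_of_ne (by positivity) (Ne.symm hy)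
    have h4 := (convex_closedBall x 1).norm_image_sub_le_of_norm_fderiv_le (𝕜 := ℝ)
      (f := fun z => iteratedFDeriv ℝ n φ (z - y)) (C := K / ‖y‖ ^ k)
      (fun z _ => (hdiff.comp (differentiable_id.sub_const y)) z)
      (fun z hz => (h1 z hz).trans (by
        rw [le_div_iff₀ hy0, mul_comm]; exact h2 z hz)) (Metric.mem_closedBall_self zero_le_one) hx'
    calc _ ≤ ‖y‖ ^ k * (K / ‖y‖ ^ k * ‖x' - x‖) := by gcongr
      _ = _ := by field_simp
  have hev : ∀ᶠ x' in 𝓝 x, K * ‖x' - x‖ < ε := by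
    have : Tendsto (fun x' => K * ‖x' - x‖) (𝓝 x) (𝓝 0) := by
      have h : Continuous fun x' : Eu m => K * ‖x' - x‖ := by fun_prop
      simpa using h.tendsto x
    exact this.eventually_lt_const hε
  filter_upwards [hev, Metric.closedBall_mem_nhds x zero_lt_one] with x' h1 h2
  refine lt_of_le_of_lt (SchwartzMap.seminorm_le_bound ℂ k n _ (by positivity) fun y => ?_) h1
  have h3 : iteratedFDeriv ℝ n (reflTranslate x' φ - reflTranslate x φ) y
      = (-1 : ℝ) ^ n • (iteratedFDeriv ℝ n φ (x' - y) - iteratedFDeriv ℝ n φ (x - y)) := by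
    rw [smul_sub, ← iteratedFDeriv_reflTranslate, ← iteratedFDeriv_reflTranslate]
    exact iteratedFDeriv_sub_apply ((reflTranslate x' φ).smooth n).contDiffAt
      ((reflTranslate x φ).smooth n).contDiffAt
  rw [h3, norm_smul]
  simpa using hbound x' h2 y

theorem continuous_regularize (u : ClDistribution m) (φ : 𝓢(Eu m, ℂ)) :
    Continuous (regularize u φ) :=
  (map_continuous u).comp (continuous_reflTranslate φ)

/-! ### Growth of the regularisations of homogeneous distributions -/

/-- Peetre's inequality. -/
theorem one_add_norm_rpow_le (x y : Eu m) (σ : ℝ) :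
    (1 + ‖y‖) ^ σ ≤ (1 + ‖x‖) ^ σ * (1 + ‖x - y‖) ^ |σ| := by
  have key : ∀ (x y : Eu m) (s : ℝ), 0 ≤ s →
      (1 + ‖y‖) ^ s ≤ (1 + ‖x‖) ^ s * (1 + ‖x - y‖) ^ s := by
    intro x y s hs
    rw [← Real.mul_rpow (by positivity) (by positivity)]
    refine Real.rpow_le_rpow (by positivity) ?_ hs
    have := norm_sub_norm_le y x
    rw [norm_sub_rev] at this
    nlinarith [norm_nonneg x, norm_nonneg (x - y)]
  rcases le_total 0 σ with hs | hs
  · rw [abs_of_nonneg hs]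
    exact key x y σ hs
  · rw [abs_of_nonpos hs]
    -- A negative exponent is reduced to a positive one by exchanging x and y.
    have h := key y x (-σ) (by linarith)
    rw [norm_sub_rev y x, Real.rpow_neg (by positivity) σ, Real.rpow_neg (by positivity) σ] at h
    rw [Real.rpow_neg (by positivity) σ, ← div_eq_mul_inv] at h ⊢
    rw [le_div_iff₀ (by positivity)]
    rw [inv_le_iff_one_le_mul₀ (by positivity)] at h
    have h1 : 0 < (1 + ‖y‖) ^ σ := by positivity
    field_simp at h
    linarith

/-- Only φ on the unit ball around x enters, so the decay in x beats every power: σ may be any real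
number. -/
theorem norm_iteratedDeriv_sphericalMean_reflTranslate_le (h : C(Sph m, Cl m)) (j : ℕ) (σ : ℝ)
    (φ : 𝓢(Eu m, ℂ)) : ∃ C : ℝ, 0 ≤ C ∧ ∀ x, ∀ r ∈ Set.Icc (0 : ℝ) 1,
      ‖iteratedDeriv j (sphericalMean h (reflTranslate x φ)) r‖ ≤ C * (1 + ‖x‖) ^ σ := by
  obtain ⟨C, hC0, hC⟩ := schwartz_norm_le φ j (-σ)
  refine ⟨C * 2 ^ |σ| * ‖h‖ * (surface m).real Set.univ, by positivity, fun x r hr => ?_⟩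
  rw [iteratedDeriv_sphericalMean]
  refine (norm_integral_le_of_norm_le_const (C := C * 2 ^ |σ| * ‖h‖ * (1 + ‖x‖) ^ σ)
    (Eventually.of_forall fun ω => ?_)).trans (le_of_eq (by ring))
  have hω : ‖(ω : Eu m)‖ = 1 := by simp
  rw [norm_smul]
  have h1 : ‖iteratedFDeriv ℝ j (reflTranslate x φ) (r • (ω : Eu m)) (fun _ => (ω : Eu m))‖
      ≤ C * (2 ^ |σ| * (1 + ‖x‖) ^ σ) := by
    refine (ContinuousMultilinearMap.le_opNorm _ _).trans ?_
    simp only [hω, Finset.prod_const_one, mul_one]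
    rw [norm_iteratedFDeriv_reflTranslate]
    refine (hC _).trans ?_
    rw [neg_neg]
    gcongr
    refine (one_add_norm_rpow_le x _ σ).trans ?_
    rw [mul_comm]
    gcongr
    rw [sub_sub_cancel, norm_smul, hω, mul_one, Real.norm_of_nonneg hr.1]
    linarith [hr.2]
  calc _ ≤ C * (2 ^ |σ| * (1 + ‖x‖) ^ σ) * ‖h‖ := by
        gcongr
        exact h.norm_coe_le_norm ω
    _ = _ := by ring

/-- Outside the unit ball |y|^(Re λ) ≤ |y|^σ, uniformly over Re λ ≤ σ. Peetre's inequality trades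
this for (1 + |x|)^σ, and the decay of φ(x - y) pays the price. -/
theorem norm_setIntegral_sphericalMean_reflTranslate_le (hm : 1 ≤ m) (k : ℕ) (σ : ℝ)
    (φ : 𝓢(Eu m, ℂ)) : ∃ C : ℝ, 0 ≤ C ∧ ∀ lam : ℂ, lam.re ≤ σ → ∀ x,
      ‖∫ r in Set.Ioi (1 : ℝ), (r : ℂ) ^ (lam + m - 1) •
        sphericalMean (vecPow m k) (reflTranslate x φ) r‖ ≤ C * (1 + ‖x‖) ^ σ := by
  obtain ⟨C, hC0, hC⟩ := schwartz_norm_le' φ (|σ| + (m + 1))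
  have hI : Integrable fun y : Eu m => (1 + ‖y‖) ^ (-(m + 1 : ℝ)) :=
    integrable_one_add_norm (by simp)
  set h := vecPow m k
  set J : ℝ := ∫ y : Eu m, (1 + ‖y‖) ^ (-(m + 1 : ℝ)) with hJ
  have hJ0 : 0 ≤ J := integral_nonneg fun y => by positivity
  refine ⟨C * ‖h‖ * 2 ^ |σ| * J, by positivity, fun lam hlam x => ?_⟩
  have hf := isHom_homKer (m := m) k lam
  rw [← setIntegral_congr_fun measurableSet_Ioi
      (fun r hr => hf.polar_integrand hm (reflTranslate x φ) (zero_lt_one.trans hr)),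
    ← setIntegral_polar hm zero_le_one (hf.integrableOn hm _ zero_lt_one)]
  have hs : MeasurableSet {x : Eu m | 1 < ‖x‖} := measurableSet_lt measurable_const measurable_norm
  have hI' : Integrable fun y : Eu m => C * ‖h‖ * 2 ^ |σ| * (1 + ‖x‖) ^ σ *
      (1 + ‖x - y‖) ^ (-(m + 1 : ℝ)) := (hI.comp_sub_left x).const_mul _
  refine (norm_integral_le_of_norm_le hI'.integrableOn ((ae_restrict_iff' hs).2
    (Eventually.of_forall fun y hy => ?_))).trans ?_
  · have hy1 : 1 < ‖y‖ := hy
    have hy0 : 0 < ‖y‖ := zero_lt_one.trans hy1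
    rw [norm_smul, reflTranslate_apply]
    have h1 : ‖y‖ ^ lam.re ≤ 2 ^ |σ| * ((1 + ‖x‖) ^ σ * (1 + ‖x - y‖) ^ |σ|) := by
      refine (Real.rpow_le_rpow_of_exponent_le hy1.le hlam).trans ?_
      have h2 : ‖y‖ ^ σ ≤ 2 ^ |σ| * (1 + ‖y‖) ^ σ := by
        rcases le_total 0 σ with hσ | hσ
        · rw [abs_of_nonneg hσ, ← Real.mul_rpow two_pos.le (by positivity)]
          exact Real.rpow_le_rpow hy0.le (by linarith) hσ
        · rw [abs_of_nonpos hσ, Real.rpow_neg two_pos.le, ← Real.inv_rpow two_pos.le,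
            ← Real.mul_rpow (by positivity) (by positivity)]
          exact Real.rpow_le_rpow_of_nonpos (by positivity) (by linarith) hσ
      exact h2.trans (by gcongr; exact one_add_norm_rpow_le x y σ)
    calc ‖φ (x - y)‖ * ‖homKer k lam y‖
        ≤ C * (1 + ‖x - y‖) ^ (-(|σ| + (m + 1))) *
          (‖h‖ * (2 ^ |σ| * ((1 + ‖x‖) ^ σ * (1 + ‖x - y‖) ^ |σ|))) := by
          gcongr
          · exact hC _
          · refine (hf.norm_le y (norm_pos_iff.1 hy0)).trans ?_
            gcongr
      _ = C * ‖h‖ * 2 ^ |σ| * (1 + ‖x‖) ^ σ *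
          ((1 + ‖x - y‖) ^ (-(|σ| + (m + 1))) * (1 + ‖x - y‖) ^ |σ|) := by ring
      _ = _ := by
          rw [← Real.rpow_add (by positivity)]
          congr 2
          ring
  · refine (setIntegral_le_integral hI' (Eventually.of_forall fun y => by positivity)).trans ?_
    rw [integral_const_mul, integral_sub_left_eq_self (fun y : Eu m => (1 + ‖y‖) ^ (-(m + 1 : ℝ)))]
    exact le_of_eq (by ring)

/-- The part near the singularity decays faster than any power of |x|; the part at infinity has the
growth of the kernel. The room between Re λ₀ and σ allows one constant for a neighbourhood of λ₀. -/
theorem norm_regularize_homDist_le (hm : 1 ≤ m) (k : ℕ) {lam₀ : ℂ} (hreg : RegularAt m k lam₀)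
    {σ : ℝ} (hσ : lam₀.re < σ) (φ : 𝓢(Eu m, ℂ)) :
    ∃ C : ℝ, ∀ᶠ lam in 𝓝 lam₀, ∀ x,
      ‖regularize (homDist (vecPow m k) lam) φ x‖ ≤ C * (1 + ‖x‖) ^ σ := by
  obtain ⟨n, hn⟩ := exists_nat_gt (-(lam₀.re + m - 1))
  choose A hA0 hA using fun j =>
    norm_iteratedDeriv_sphericalMean_reflTranslate_le (vecPow m k) j σ φ
  obtain ⟨B, hB0, hB⟩ := norm_setIntegral_sphericalMean_reflTranslate_le hm k σ φ
  -- The 1 is slack, so that by continuity the bound persists near λ₀. For j + k odd the coefficient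
  -- may blow up, but the derivative it multiplies is zero.
  set D : ℕ → ℝ := fun j => ‖1 / ((j.factorial : ℂ) * (lam₀ + m - 1 + j + 1))‖ + 1 with hD
  have hD0 : ∀ j, 0 ≤ D j := fun j => by positivity
  have ev1 : ∀ᶠ lam : ℂ in 𝓝 lam₀, lam.re < σ :=
    (isOpen_lt Complex.continuous_re continuous_const).mem_nhds hσ
  have ev2 : ∀ᶠ lam : ℂ in 𝓝 lam₀, -(lam.re + m - 1) < n :=
    (isOpen_lt (by fun_prop) continuous_const).mem_nhds hn
  have ev3 : ∀ᶠ lam : ℂ in 𝓝 lam₀, ∀ j ∈ Finset.range n, Even (j + k) →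
      ‖1 / ((j.factorial : ℂ) * (lam + m - 1 + j + 1))‖ ≤ D j := by
    rw [Filter.eventually_all_finset]
    intro j _
    by_cases hj : Even (j + k)
    · have hne : (j.factorial : ℂ) * (lam₀ + m - 1 + j + 1) ≠ 0 := by
        refine mul_ne_zero (by exact_mod_cast j.factorial_ne_zero) fun h0 => hreg j hj ?_
        linear_combination h0
      have hc : ContinuousAt
          (fun lam : ℂ => ‖1 / ((j.factorial : ℂ) * (lam + m - 1 + j + 1))‖) lam₀ := by
        fun_prop (disch := exact hne)
      filter_upwards [hc.eventually_lt_const (lt_add_one _)] with lam h1 _ using h1.le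
    · exact Eventually.of_forall fun lam h => absurd h hj
  refine ⟨A n + B + ∑ j ∈ Finset.range n, D j * A j, ?_⟩
  filter_upwards [ev1, ev2, ev3] with lam h1 h2 h3 x
  have hre : (lam + m - 1).re = lam.re + m - 1 := by simp
  have hx : 0 ≤ (1 + ‖x‖) ^ σ := by positivity
  rw [regularize, homDist_apply, fpRayFun_eq_fpN n (by rw [hre]; linarith), fpN]
  refine (norm_add₃_le).trans ?_
  rw [add_mul, add_mul]
  refine add_le_add (add_le_add ?_ (hB lam h1.le x)) ?_
  · refine (norm_setIntegral_le_of_norm_le_const (by simp) fun r hr => ?_).trans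
      (le_of_eq (b := A n * (1 + ‖x‖) ^ σ * volume.real (Set.Ioc (0 : ℝ) 1)) rfl) |>.trans (by simp)
    rw [norm_smul, Complex.norm_cpow_eq_rpow_re_of_pos hr.1]
    have h4 := norm_taylorRem_le_of_bound n (sphericalMean (vecPow m k) (reflTranslate x φ))
      (mul_nonneg (hA0 n) hx) (hA n x) (Set.Ioc_subset_Icc_self hr)
    calc _ ≤ r ^ (lam + m - 1).re * (A n * (1 + ‖x‖) ^ σ * r ^ n) := by
          gcongr
          exact Real.rpow_nonneg hr.1.le _
      _ = A n * (1 + ‖x‖) ^ σ * r ^ ((lam + m - 1).re + n) := by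
          rw [Real.rpow_add hr.1, Real.rpow_natCast]; ring
      _ ≤ A n * (1 + ‖x‖) ^ σ * 1 := by
          refine mul_le_mul_of_nonneg_left ?_ (mul_nonneg (hA0 n) hx)
          refine Real.rpow_le_one hr.1.le hr.2 ?_
          rw [hre]; linarith
      _ = _ := mul_one _
  · rw [Finset.sum_mul]
    refine (norm_sum_le _ _).trans (Finset.sum_le_sum fun j hj => ?_)
    rcases Nat.even_or_odd (j + k) with he | ho
    · rw [norm_smul, mul_assoc]
      exact mul_le_mul (h3 j hj he) (hA j x 0 (by simp)) (norm_nonneg _) (hD0 j)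
    · rw [iteratedDeriv_sphericalMean_zero vecPow_neg _ ho, smul_zero, norm_zero]
      exact mul_nonneg (mul_nonneg (hD0 j) (hA0 j)) hx

end Regularize

/-! ### Regularisations of distributions whose Fourier transform is a function -/

section Regularize

variable {m : ℕ}

theorem fourierInv_reflTranslate (x ξ : Eu m) (φ : 𝓢(Eu m, ℂ)) :
    (𝓕⁻ (reflTranslate x φ)) ξ = Real.fourierChar (inner ℝ ξ x) • 𝓕 φ ξ := by
  rw [SchwartzMap.fourierInv_coe, SchwartzMap.fourier_coe, Real.fourierInv_eq, Real.fourier_eq,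
    ← integral_sub_left_eq_self _ _ x, Circle.smul_def, ← integral_smul]
  refine integral_congr_ae (Eventually.of_forall fun y => ?_)
  simp only [reflTranslate_apply, sub_sub_cancel, Circle.smul_def, smul_smul]
  rw [← Circle.coe_mul, ← AddChar.map_add_eq_mul, inner_sub_left, real_inner_comm ξ x,
    sub_eq_add_neg]

theorem FourierIsFun.regularize_eq {w : ClDistribution m} {f : Eu m → Cl m} (h : FourierIsFun w f)
    (φ : 𝓢(Eu m, ℂ)) (x : Eu m) : regularize w φ x = 𝓕⁻ (fun ξ => 𝓕 φ ξ • f ξ) x := by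
  have h1 : regularize w φ x = 𝓕 w (𝓕⁻ (reflTranslate x φ)) := by
    rw [TemperedDistribution.fourier_apply, FourierTransform.fourier_fourierInv_eq]; rfl
  rw [h1, h.eq, Real.fourierInv_eq]
  refine integral_congr_ae (Eventually.of_forall fun ξ => ?_)
  simp only [fourierInv_reflTranslate, Circle.smul_def, smul_assoc]

theorem FourierIsFun.regularize_neg {w : ClDistribution m} {f : Eu m → Cl m} (h : FourierIsFun w f)
    (φ : 𝓢(Eu m, ℂ)) (x : Eu m) : regularize w φ (-x) = 𝓕 (fun ξ => 𝓕 φ ξ • f ξ) x := by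
  rw [h.regularize_eq, Real.fourierInv_eq_fourier_neg, neg_neg]

/-- `(w ∗ φ) ∗ ψ = (w ∗ ψ) ∗ φ`, with absolutely convergent integrals. -/
def IsSymmetricAction (w : ClDistribution m) : Prop :=
  ∀ φ ψ : 𝓢(Eu m, ℂ), Integrable (fun y => ψ y • regularize w φ (-y)) ∧
    ∫ y, ψ y • regularize w φ (-y) = ∫ y, φ y • regularize w ψ (-y)

theorem FourierIsFun.integrable_smul_regularize {w : ClDistribution m} {f : Eu m → Cl m}
    (h : FourierIsFun w f) (φ ψ : 𝓢(Eu m, ℂ)) :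
    Integrable (fun y => ψ y • regularize w φ (-y)) := by
  refine Integrable.mono' (ψ.integrable.norm.mul_const (∫ ξ, ‖𝓕 φ ξ • f ξ‖))
    (ψ.continuous.smul ((continuous_regularize w φ).comp continuous_neg)).aestronglyMeasurable
    (Eventually.of_forall fun y => ?_)
  rw [norm_smul, h.regularize_neg]
  gcongr
  exact VectorFourier.norm_fourierIntegral_le_integral_norm _ _ _ _ _

/-- The multiplication formula moves the transform onto ψ; the result is visibly symmetric in φ and
ψ. -/
theorem FourierIsFun.integral_smul_regularize {w : ClDistribution m} {f : Eu m → Cl m}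
    (h : FourierIsFun w f) (φ ψ : 𝓢(Eu m, ℂ)) :
    ∫ y, ψ y • regularize w φ (-y) = ∫ ξ, (𝓕 φ ξ * 𝓕 ψ ξ) • f ξ := by
  simp only [h.regularize_neg]
  have h1 := VectorFourier.integral_fourierIntegral_smul_eq_flip (L := innerₗ (Eu m))
    (μ := volume) (ν := volume)
    Real.continuous_fourierChar continuous_inner ψ.integrable (h.integrable (𝓕 φ))
  have h2 : ∫ y, ψ y • 𝓕 (fun ξ => 𝓕 φ ξ • f ξ) y = ∫ ξ, 𝓕 ψ ξ • (𝓕 φ ξ • f ξ) := by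
    rw [SchwartzMap.fourier_coe ψ]
    simpa using! h1.symm
  rw [h2]
  refine integral_congr_ae (Eventually.of_forall fun ξ => ?_)
  simp only [smul_smul, mul_comm]

theorem FourierIsFun.isSymmetricAction {w : ClDistribution m} {f : Eu m → Cl m}
    (h : FourierIsFun w f) : IsSymmetricAction w := by
  refine fun φ ψ => ⟨h.integrable_smul_regularize φ ψ, ?_⟩
  rw [h.integral_smul_regularize, h.integral_smul_regularize]
  simp only [mul_comm]

theorem regularize_add (u v : ClDistribution m) (φ : 𝓢(Eu m, ℂ)) (x : Eu m) :
    regularize (u + v) φ x = regularize u φ x + regularize v φ x := rfl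

theorem regularize_smul (c : ℂ) (u : ClDistribution m) (φ : 𝓢(Eu m, ℂ)) (x : Eu m) :
    regularize (c • u) φ x = c • regularize u φ x := rfl

theorem IsSymmetricAction.add {u v : ClDistribution m} (hu : IsSymmetricAction u)
    (hv : IsSymmetricAction v) : IsSymmetricAction (u + v) := by
  intro φ ψ
  simp only [regularize_add, smul_add]
  refine ⟨(hu φ ψ).1.add (hv φ ψ).1, ?_⟩
  rw [integral_add (hu φ ψ).1 (hv φ ψ).1, integral_add (hu ψ φ).1 (hv ψ φ).1, (hu φ ψ).2, (hv φ ψ).2]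

theorem IsSymmetricAction.smul (c : ℂ) {u : ClDistribution m} (hu : IsSymmetricAction u) :
    IsSymmetricAction (c • u) := by
  intro φ ψ
  simp only [regularize_smul, smul_comm _ c]
  refine ⟨(hu φ ψ).1.smul c, ?_⟩
  rw [integral_smul, integral_smul, (hu φ ψ).2]

/-! ### Homogeneous distributions -/

theorem fourierIsFun_homDist (hm : 1 ≤ m) {k : ℕ} (hk : k ≤ 1) {μ : ℂ} (hμ : μ ∉ poles m k)
    (hre : -(m : ℝ) < μ.re) :
    FourierIsFun (homDist (vecPow m k) (-m - μ)) (fun ξ => fourierConst m k μ • homKer k μ ξ) where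
  integrable φ := by
    simp only [smul_comm _ (fourierConst m k μ)]
    exact ((isHom_homKer k μ).integrable hm hre φ).smul (fourierConst m k μ)
  eq φ := by
    simp only [smul_comm _ (fourierConst m k μ)]
    rw [TemperedDistribution.fourier_apply, homDist_fourier hm hk hμ,
      homDist_eq_integral hm (isHom_homKer k μ) hre, integral_smul]

theorem isClosed_poles (m k : ℕ) : IsClosed (poles m k) := intSet_closed _

theorem countable_poles (m k : ℕ) : (poles m k).Countable := intSet_countable _

theorem differentiableAt_regularize_homDist {k : ℕ} {lam : ℂ} (h : RegularAt m k lam)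
    (φ : 𝓢(Eu m, ℂ)) (x : Eu m) :
    DifferentiableAt ℂ (fun lam => regularize (homDist (vecPow m k) lam) φ x) lam :=
  differentiableAt_homDist vecPow_neg _ h

theorem integrable_smul_regularize_homDist (hm : 1 ≤ m) {k : ℕ} {lam : ℂ} (h : RegularAt m k lam)
    (φ ψ : 𝓢(Eu m, ℂ)) :
    Integrable (fun y => ψ y • regularize (homDist (vecPow m k) lam) φ (-y)) := by
  obtain ⟨C, hC⟩ := norm_regularize_homDist_le hm k h (lt_add_one _) φ
  obtain ⟨D, hD0, hD⟩ := schwartz_norm_le' ψ (lam.re + 1 + (m + 1))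
  have hI : Integrable fun y : Eu m => (1 + ‖y‖) ^ (-(m + 1 : ℝ)) :=
    integrable_one_add_norm (by simp)
  refine Integrable.mono' (hI.const_mul (D * C))
    (ψ.continuous.smul ((continuous_regularize _ φ).comp continuous_neg)).aestronglyMeasurable
    (Eventually.of_forall fun y => ?_)
  have h1 := hC.self_of_nhds (-y)
  rw [norm_neg] at h1
  rw [norm_smul]
  calc _ ≤ D * (1 + ‖y‖) ^ (-(lam.re + 1 + (m + 1))) * (C * (1 + ‖y‖) ^ (lam.re + 1)) := by
        gcongr
        exact hD y
    _ = D * C * ((1 + ‖y‖) ^ (-(lam.re + 1 + (m + 1))) * (1 + ‖y‖) ^ (lam.re + 1)) := by ring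
    _ = _ := by
        rw [← Real.rpow_add (by positivity)]
        congr 2
        ring

/-- The locally uniform polynomial growth of the regularisation is dominated by the Schwartz decay
of ψ. -/
theorem differentiableAt_integral_smul_regularize_homDist (hm : 1 ≤ m) {k : ℕ} {μ : ℂ}
    (hμ : μ ∉ poles m k) (φ ψ : 𝓢(Eu m, ℂ)) :
    DifferentiableAt ℂ
      (fun μ => ∫ y, ψ y • regularize (homDist (vecPow m k) (-m - μ)) φ (-y)) μ := by
  have hreg : ∀ᶠ μ' in 𝓝 μ, μ' ∉ poles m k := (isClosed_poles m k).isOpen_compl.mem_nhds hμ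
  have hcont : Tendsto (fun μ : ℂ => (-m - μ : ℂ)) (𝓝 μ) (𝓝 (-m - μ)) :=
    (continuous_const.sub continuous_id).tendsto μ
  set lam : ℂ := -m - μ with hlam
  obtain ⟨C, hC⟩ := norm_regularize_homDist_le hm k (notMem_poles_iff.1 hμ).2 (lt_add_one _) φ
  obtain ⟨D, hD0, hD⟩ := schwartz_norm_le' ψ (lam.re + 1 + (m + 1))
  have hI : Integrable fun y : Eu m => (1 + ‖y‖) ^ (-(m + 1 : ℝ)) :=
    integrable_one_add_norm (by simp)
  refine differentiableAt_integral_of_bound (hI.const_mul (D * C)) ?_ ?_ ?_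
  · exact Eventually.of_forall fun μ' => (ψ.continuous.smul
      ((continuous_regularize _ φ).comp continuous_neg)).aestronglyMeasurable
  · filter_upwards [hreg] with μ' hμ' y
    have h1 := differentiableAt_regularize_homDist (notMem_poles_iff.1 hμ').2 φ (-y)
    have h2 : DifferentiableAt ℂ (fun μ : ℂ => (-m - μ : ℂ)) μ' := by fun_prop
    exact (DifferentiableAt.comp μ' h1 h2).const_smul (ψ y)
  · filter_upwards [hcont.eventually hC] with μ' h1 y
    have h2 := h1 (-y)
    rw [norm_neg] at h2
    rw [norm_smul]
    calc _ ≤ D * (1 + ‖y‖) ^ (-(lam.re + 1 + (m + 1))) * (C * (1 + ‖y‖) ^ (lam.re + 1)) := by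
          gcongr
          exact hD y
      _ = D * C * ((1 + ‖y‖) ^ (-(lam.re + 1 + (m + 1))) * (1 + ‖y‖) ^ (lam.re + 1)) := by ring
      _ = _ := by
          rw [← Real.rpow_add (by positivity)]
          congr 2
          ring

/-- For Re μ > -m the transform is a function and symmetry is immediate; both sides then continue
holomorphically. -/
theorem isSymmetricAction_homDist (hm : 1 ≤ m) {k : ℕ} (hk : k ≤ 1) {μ : ℂ} (hμ : μ ∉ poles m k) :
    IsSymmetricAction (homDist (vecPow m k) (-m - μ)) := by
  intro φ ψ
  refine ⟨integrable_smul_regularize_homDist hm (notMem_poles_iff.1 hμ).2 φ ψ, ?_⟩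
  refine eq_of_differentiable_off_countable (countable_poles m k) (isClosed_poles m k)
    (fun z hz => differentiableAt_integral_smul_regularize_homDist hm hz φ ψ)
    (fun z hz => differentiableAt_integral_smul_regularize_homDist hm hz ψ φ)
    (V := {z : ℂ | -(m : ℝ) < z.re}) (isOpen_lt continuous_const Complex.continuous_re)
    ⟨0, ?_⟩ (fun z hz hz' => ((fourierIsFun_homDist hm hk hz' hz).isSymmetricAction φ ψ).2) μ hμ
  have : (0 : ℝ) < m := by exact_mod_cast hm
  simpa using this

/-! ### Symmetry of the action of `∂^ν δ` -/

theorem dist_ext {u v : ClDistribution m} (h : ∀ φ, u φ = v φ) : u = v := DFunLike.ext _ _ h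

theorem powPart_eq_smul_homDist {k : ℕ} (hk : k ≤ 1) {μ : ℂ} (h : ∀ l : ℕ, μ ≠ k + 2 * l) :
    powPart m k μ = powCoeff m k μ • homDist (vecPow m k) (-m - μ) :=
  dist_ext fun φ => powPart_eq_homDist hk h φ

theorem notMem_poles_of_ne {k : ℕ} {μ : ℂ} (hreg : RegularAt m k μ) (h : ∀ n : ℕ, μ ≠ n) :
    μ ∉ poles m k :=
  notMem_poles_iff.2 ⟨hreg, fun j _ hj => h j (by linear_combination -hj)⟩

theorem isSymmetricAction_powPart (hm : 1 ≤ m) {k : ℕ} (hk : k ≤ 1) {μ : ℂ} (hμ : Admissible m μ)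
    (h : ∀ n : ℕ, μ ≠ n) : IsSymmetricAction (powPart m k μ) := by
  rcases regularAt_or_parityFactor_eq_zero hμ k with hreg | hzero
  · rw [powPart_eq_smul_homDist hk fun l hl => h (k + 2 * l) (by rw [hl]; push_cast; rfl)]
    exact (isSymmetricAction_homDist hm hk (notMem_poles_of_ne hreg h)).smul _
  · rw [powPart_eq_zero hk hzero]
    intro φ ψ
    have h0 : ∀ (φ : 𝓢(Eu m, ℂ)) x, regularize (0 : ClDistribution m) φ x = 0 := fun _ _ => rfl
    simp [h0]

theorem fourierIsFun_diracPow (hm : 1 ≤ m) {μ : ℂ} (hμ : Admissible m μ) (hre : -(m : ℝ) < μ.re) :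
    FourierIsFun (diracPow m μ) (symbol m μ) where
  integrable φ := (isHom_symbol μ).integrable hm hre φ
  eq φ := by rw [fourier_diracPow hm hμ, homDist_eq_integral hm (isHom_symbol μ) hre]

/-- Natural exponents may lie in `poles`, beyond the reach of the continuation, but there the
transform is already a function. -/
theorem isSymmetricAction_diracPow (hm : 1 ≤ m) {μ : ℂ} (hμ : Admissible m μ) :
    IsSymmetricAction (diracPow m μ) := by
  by_cases h : ∃ n : ℕ, μ = n
  · obtain ⟨n, rfl⟩ := h
    refine (fourierIsFun_diracPow hm hμ ?_).isSymmetricAction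
    have : (0 : ℝ) < m := by exact_mod_cast hm
    rw [Complex.natCast_re]
    have : (0 : ℝ) ≤ n := n.cast_nonneg
    linarith
  · rw [not_exists] at h
    rw [diracPow_eq_add]
    exact (isSymmetricAction_powPart hm zero_le_one hμ h).add (isSymmetricAction_powPart hm le_rfl hμ h)

end Regularize

section Convolution

variable {m : ℕ}

/-! ### Convolution of homogeneous distributions -/

theorem exists_bound_regularize_mul (hm : 1 ≤ m) {k k' : ℕ} {lam lam' : ℂ} (h : RegularAt m k lam)
    (h' : RegularAt m k' lam') (hsum : (lam + lam').re < -m) (φ ψ : 𝓢(Eu m, ℂ)) :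
    ∃ b : Eu m → ℝ, Integrable b ∧ ∀ᶠ p in 𝓝 lam ×ˢ 𝓝 lam', ∀ y,
      ‖regularize (homDist (vecPow m k) p.1) φ (-y) * regularize (homDist (vecPow m k') p.2) ψ y‖
        ≤ b y := by
  rw [Complex.add_re] at hsum
  -- The gap below -m is 4d. Each factor is allowed d, so the total decay exponent is -(m + 2d).
  set d : ℝ := (-m - (lam.re + lam'.re)) / 4 with hd
  have hd0 : 0 < d := by rw [hd]; linarith
  obtain ⟨C, hC⟩ := norm_regularize_homDist_le hm k h (lt_add_of_pos_right _ hd0) φ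
  obtain ⟨D, hD⟩ := norm_regularize_homDist_le hm k' h' (lt_add_of_pos_right _ hd0) ψ
  have hI : Integrable fun y : Eu m => (1 + ‖y‖) ^ (-(m + 2 * d : ℝ)) :=
    integrable_one_add_norm (by simp [hd0])
  refine ⟨_, hI.const_mul (‖mulCLM m‖ * C * D), ?_⟩
  filter_upwards [hC.prod_mk hD] with p ⟨h1, h2⟩ y
  have h3 := h1 (-y)
  have h4 := h2 y
  rw [norm_neg] at h3
  have hC0 : 0 ≤ C * (1 + ‖y‖) ^ (lam.re + d) := (norm_nonneg _).trans h3
  calc _ ≤ ‖mulCLM m‖ * ‖regularize (homDist (vecPow m k) p.1) φ (-y)‖ *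
        ‖regularize (homDist (vecPow m k') p.2) ψ y‖ := norm_mul_le_mulCLM _ _
    _ ≤ ‖mulCLM m‖ * (C * (1 + ‖y‖) ^ (lam.re + d)) * (D * (1 + ‖y‖) ^ (lam'.re + d)) := by
        gcongr
    _ = ‖mulCLM m‖ * C * D * ((1 + ‖y‖) ^ (lam.re + d) * (1 + ‖y‖) ^ (lam'.re + d)) := by ring
    _ = _ := by
        rw [← Real.rpow_add (by positivity)]
        congr 2
        rw [hd]; ring

theorem aestronglyMeasurable_regularize_mul (u v : ClDistribution m) (φ ψ : 𝓢(Eu m, ℂ)) :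
    AEStronglyMeasurable (fun y => regularize u φ (-y) * regularize v ψ y) volume :=
  (((continuous_regularize u φ).comp continuous_neg).mul
    (continuous_regularize v ψ)).aestronglyMeasurable

theorem integrable_regularize_mul (hm : 1 ≤ m) {k k' : ℕ} {lam lam' : ℂ} (h : RegularAt m k lam)
    (h' : RegularAt m k' lam') (hsum : (lam + lam').re < -m) (φ ψ : 𝓢(Eu m, ℂ)) :
    Integrable fun y => regularize (homDist (vecPow m k) lam) φ (-y) *
      regularize (homDist (vecPow m k') lam') ψ y := by
  obtain ⟨b, hb, hbd⟩ := exists_bound_regularize_mul hm h h' hsum φ ψ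
  rw [← nhds_prod_eq] at hbd
  exact hb.mono' (aestronglyMeasurable_regularize_mul _ _ _ _)
    (Eventually.of_forall hbd.self_of_nhds)

theorem homKer_mul_homKer (k k' : ℕ) (μ ν : ℂ) {ξ : Eu m} (hξ : ξ ≠ 0) :
    homKer k μ ξ * homKer k' ν ξ = homKer (k + k') (μ + ν) ξ := by
  have h0 : (‖ξ‖ : ℂ) ≠ 0 := by exact_mod_cast (norm_pos_iff.2 hξ).ne'
  rw [homKer, homKer, homKer, smul_mul_smul_comm, ← pow_add, ← Complex.cpow_add _ _ h0]
  congr 2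
  push_cast
  ring

/-- The product of the Fourier transforms of two test functions. -/
def fourierMul (φ ψ : 𝓢(Eu m, ℂ)) : 𝓢(Eu m, ℂ) :=
  SchwartzMap.pairing (ContinuousLinearMap.mul ℂ ℂ) (𝓕 φ) (𝓕 ψ)

theorem fourierMul_apply (φ ψ : 𝓢(Eu m, ℂ)) (ξ : Eu m) :
    fourierMul φ ψ ξ = 𝓕 φ ξ * 𝓕 ψ ξ := rfl

/-- The multiplication formula leaves a double transform of A, which pointwise inversion identifies
at every point of continuity, hence almost everywhere. The factors keep their order. -/
theorem integral_fourier_mul_fourierInv (hm : 1 ≤ m) {A B : Eu m → Cl m} (hA : Integrable A)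
    (hAc : ContinuousOn A {0}ᶜ) (hFA : Integrable (𝓕 A)) (hB : Integrable B) :
    ∫ y, 𝓕 A y * 𝓕⁻ B y = ∫ ξ, A ξ * B ξ := by
  have h1 := VectorFourier.integral_bilin_fourierIntegral_eq_flip (L := innerₗ (Eu m))
    (μ := volume) (ν := volume) (mulCLM m)
    Real.continuous_fourierChar continuous_inner hFA hB.comp_neg
  have h2 : ∫ y, 𝓕 (𝓕 A) y * B (-y) = ∫ y, 𝓕 A y * 𝓕 (fun ξ => B (-ξ)) y := by
    simpa using! h1
  rw [Real.fourierInv_eq_fourier_comp_neg, ← h2,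
    ← integral_neg_eq_self (fun y => 𝓕 (𝓕 A) y * B (-y))]
  refine integral_congr_ae ?_
  filter_upwards [ae_ne_zero hm] with ξ hξ
  have h3 := hA.fourierInv_fourier_eq hFA (hAc.continuousAt (isOpen_compl_singleton.mem_nhds hξ))
  rw [Real.fourierInv_eq_fourier_neg] at h3
  rw [h3, neg_neg]

/-- Re μ > 0 makes the first regularisation integrable, as inversion requires; the second factor
need only have an integrable transform. -/
theorem integral_regularize_mul_of_re_pos (hm : 1 ≤ m) {k k' : ℕ} (hk : k ≤ 1) (hk' : k' ≤ 1)
    {μ ν : ℂ} (hμ : μ ∉ poles m k) (hν : ν ∉ poles m k') (hre : 0 < μ.re) (hre' : -(m : ℝ) < ν.re)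
    (φ ψ : 𝓢(Eu m, ℂ)) :
    ∫ y, regularize (homDist (vecPow m k) (-m - μ)) φ (-y) *
        regularize (homDist (vecPow m k') (-m - ν)) ψ y
      = (fourierConst m k μ * fourierConst m k' ν) •
          ∫ ξ, fourierMul φ ψ ξ • homKer (k + k') (μ + ν) ξ := by
  have hm0 : (0 : ℝ) < m := by exact_mod_cast hm
  have hu := fourierIsFun_homDist hm hk hμ (by linarith)
  have hv := fourierIsFun_homDist hm hk' hν hre'
  have hFA : Integrable (𝓕 fun ξ => 𝓕 φ ξ • fourierConst m k μ • homKer k μ ξ) := by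
    -- An exponent strictly between the homogeneity degree -m - Re μ and the integrability threshold
    -- -m.
    have hlt : (-m - μ : ℂ).re < -(m + μ.re / 2) := by simp; linarith
    obtain ⟨C, hC⟩ := norm_regularize_homDist_le hm k (notMem_poles_iff.1 hμ).2 hlt φ
    have hI : Integrable fun y : Eu m => (1 + ‖y‖) ^ (-(m + μ.re / 2)) :=
      integrable_one_add_norm (by simp [hre])
    have h1 : (𝓕 fun ξ => 𝓕 φ ξ • fourierConst m k μ • homKer k μ ξ)
        = fun y => regularize (homDist (vecPow m k) (-m - μ)) φ (-y) :=
      funext fun y => (hu.regularize_neg φ y).symm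
    rw [h1]
    refine (hI.const_mul C).mono'
      ((continuous_regularize _ φ).comp continuous_neg).aestronglyMeasurable
      (Eventually.of_forall fun y => ?_)
    simpa using hC.self_of_nhds (-y)
  have hAc : ContinuousOn (fun ξ => 𝓕 φ ξ • fourierConst m k μ • homKer k μ ξ) {0}ᶜ := by
    have h1 := (isHom_homKer (m := m) k μ).cont
    have h2 := (𝓕 φ).continuous
    fun_prop
  simp only [hu.regularize_neg, hv.regularize_eq]
  rw [integral_fourier_mul_fourierInv hm (hu.integrable _) hAc hFA (hv.integrable _), ← integral_smul]
  refine integral_congr_ae ?_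
  filter_upwards [ae_ne_zero hm] with ξ hξ
  simp only [smul_mul_smul_comm, homKer_mul_homKer k k' μ ν hξ, fourierMul_apply]
  exact smul_comm _ _ _

theorem differentiableAt_integral_regularize_mul (hm : 1 ≤ m) {k k' : ℕ} {s μ : ℂ}
    (hs : -(m : ℝ) < s.re) (hμ : μ ∉ poles m k) (hν : s - μ ∉ poles m k') (φ ψ : 𝓢(Eu m, ℂ)) :
    DifferentiableAt ℂ (fun μ => ∫ y, regularize (homDist (vecPow m k) (-m - μ)) φ (-y) *
        regularize (homDist (vecPow m k') (-m - (s - μ))) ψ y) μ := by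
  obtain ⟨b, hb, hbd⟩ := exists_bound_regularize_mul hm (notMem_poles_iff.1 hμ).2
    (notMem_poles_iff.1 hν).2 (by simp; linarith) φ ψ
  have hd1 : ∀ z : ℂ, DifferentiableAt ℂ (fun μ : ℂ => (-m - μ : ℂ)) z := fun z => by fun_prop
  have hd2 : ∀ z : ℂ, DifferentiableAt ℂ (fun μ : ℂ => (-m - (s - μ) : ℂ)) z := fun z => by fun_prop
  have hev : ∀ᶠ z in 𝓝 μ, z ∉ poles m k := (isClosed_poles m k).isOpen_compl.mem_nhds hμ
  have hev' : ∀ᶠ z in 𝓝 μ, s - z ∉ poles m k' :=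
    (continuous_const.sub continuous_id).continuousAt.eventually
      ((isClosed_poles m k').isOpen_compl.mem_nhds hν)
  refine differentiableAt_integral_of_bound hb
    (Eventually.of_forall fun z => aestronglyMeasurable_regularize_mul _ _ _ _) ?_ ?_
  · filter_upwards [hev, hev'] with z hz hz' y
    have h1 := (differentiableAt_regularize_homDist (notMem_poles_iff.1 hz).2 φ (-y)).comp z (hd1 z)
    have h2 := (differentiableAt_regularize_homDist (notMem_poles_iff.1 hz').2 ψ y).comp z (hd2 z)
    have h3 : DifferentiableAt ℂ (fun z => mulCLM m
        (regularize (homDist (vecPow m k) (-m - z)) φ (-y))) z :=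
      (mulCLM m).differentiableAt.comp z h1
    exact h3.clm_apply h2
  · exact ((hd1 μ).continuousAt.tendsto.prodMk (hd2 μ).continuousAt.tendsto).eventually hbd

/-- With s = μ + ν held fixed, the integral on the right does not depend on μ, so only the constants
vary and both sides are holomorphic off countably many points. Agreement on 0 < Re μ < Re s + m,
nonempty since Re s > -m, suffices. -/
theorem integral_regularize_mul (hm : 1 ≤ m) {k k' : ℕ} (hk : k ≤ 1) (hk' : k' ≤ 1)
    {μ ν : ℂ} (hμ : μ ∉ poles m k) (hν : ν ∉ poles m k') (hre : -(m : ℝ) < (μ + ν).re)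
    (φ ψ : 𝓢(Eu m, ℂ)) :
    ∫ y, regularize (homDist (vecPow m k) (-m - μ)) φ (-y) *
        regularize (homDist (vecPow m k') (-m - ν)) ψ y
      = (fourierConst m k μ * fourierConst m k' ν) •
          ∫ ξ, fourierMul φ ψ ξ • homKer (k + k') (μ + ν) ξ := by
  obtain ⟨s, rfl⟩ : ∃ s, ν = s - μ := ⟨μ + ν, by ring⟩
  rw [add_sub_cancel] at hre ⊢
  set S : Set ℂ := poles m k ∪ (fun z => s - z) ⁻¹' poles m k' with hS
  have hSc : S.Countable := (countable_poles m k).union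
    ((countable_poles m k').preimage (sub_right_injective))
  have hScl : IsClosed S := (isClosed_poles m k).union
    ((isClosed_poles m k').preimage (continuous_const.sub continuous_id))
  have hmem : ∀ z ∉ S, z ∉ poles m k ∧ s - z ∉ poles m k' := fun z hz =>
    ⟨fun h => hz (Or.inl h), fun h => hz (Or.inr h)⟩
  refine eq_of_differentiable_off_countable hSc hScl
    (f := fun μ => ∫ y, regularize (homDist (vecPow m k) (-m - μ)) φ (-y) *
        regularize (homDist (vecPow m k') (-m - (s - μ))) ψ y)
    (g := fun μ => (fourierConst m k μ * fourierConst m k' (s - μ)) •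
          ∫ ξ, fourierMul φ ψ ξ • homKer (k + k') s ξ)
    (V := {z : ℂ | 0 < z.re ∧ z.re < s.re + m})
    (fun z hz => differentiableAt_integral_regularize_mul hm hre (hmem z hz).1 (hmem z hz).2 φ ψ)
    (fun z hz => ?_)
    ((isOpen_lt continuous_const Complex.continuous_re).inter
      (isOpen_lt Complex.continuous_re continuous_const))
    ⟨(((s.re + m) / 2 : ℝ) : ℂ), ?_⟩ (fun z hz hzS => ?_) μ ?_
  · have h1 := differentiableAt_fourierConst (hmem z hz).1
    have h2 : DifferentiableAt ℂ (fun z => fourierConst m k' (s - z)) z :=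
      (differentiableAt_fourierConst (hmem z hz).2).comp z (f := fun z => s - z) (by fun_prop)
    exact (h1.mul h2).smul_const _
  · rw [Set.mem_ofPred_eq, Complex.ofReal_re]
    constructor <;> linarith
  · have h1 := integral_regularize_mul_of_re_pos hm hk hk' (hmem z hzS).1 (hmem z hzS).2 hz.1
      (by rw [Complex.sub_re]; linarith [hz.2]) φ ψ
    rw [add_sub_cancel] at h1
    exact h1
  · rintro (h | h)
    · exact hμ h
    · exact hν h

/-! ### Convolution of the complex powers, non-integer exponents -/

/-- The coefficients of the symbol of `∂^μ`. -/
def symbolCoeff (k : ℕ) (μ : ℂ) : ℂ := (2 * Real.pi : ℂ) ^ μ * parityFactor k μ * Complex.I ^ k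

theorem powPart_regularize_mul (hm : 1 ≤ m) {k k' : ℕ} (hk : k ≤ 1) (hk' : k' ≤ 1) {μ ν : ℂ}
    (hμ : Admissible m μ) (hν : Admissible m ν) (hμn : ∀ n : ℕ, μ ≠ n) (hνn : ∀ n : ℕ, ν ≠ n)
    (hre : -(m : ℝ) < (μ + ν).re) (φ ψ : 𝓢(Eu m, ℂ)) :
    Integrable (fun y => regularize (powPart m k μ) φ (-y) * regularize (powPart m k' ν) ψ y) ∧
    ∫ y, regularize (powPart m k μ) φ (-y) * regularize (powPart m k' ν) ψ y
      = (symbolCoeff k μ * symbolCoeff k' ν) •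
          ∫ ξ, fourierMul φ ψ ξ • homKer (k + k') (μ + ν) ξ := by
  have h0 : ∀ (φ : 𝓢(Eu m, ℂ)) x, regularize (0 : ClDistribution m) φ x = 0 := fun _ _ => rfl
  rcases regularAt_or_parityFactor_eq_zero hμ k with hreg | hzero
  swap
  · rw [powPart_eq_zero hk hzero, symbolCoeff, hzero]
    simp [h0]
  rcases regularAt_or_parityFactor_eq_zero hν k' with hreg' | hzero'
  swap
  · rw [powPart_eq_zero hk' hzero', symbolCoeff, symbolCoeff, hzero']
    simp [h0]
  have hp := notMem_poles_of_ne hreg hμn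
  have hp' := notMem_poles_of_ne hreg' hνn
  rw [powPart_eq_smul_homDist hk fun l hl => hμn (k + 2 * l) (by rw [hl]; push_cast; rfl),
    powPart_eq_smul_homDist hk' fun l hl => hνn (k' + 2 * l) (by rw [hl]; push_cast; rfl)]
  simp only [regularize_smul, smul_mul_smul_comm]
  rw [integral_smul, integral_regularize_mul hm hk hk' hp hp' hre, smul_smul, symbolCoeff, symbolCoeff,
    ← powCoeff_mul_fourierConst hp, ← powCoeff_mul_fourierConst hp']
  refine ⟨(integrable_regularize_mul hm (notMem_poles_iff.1 hp).2 (notMem_poles_iff.1 hp').2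
    ?_ φ ψ).smul (powCoeff m k μ * powCoeff m k' ν), ?_⟩
  · rw [Complex.add_re] at hre
    simp
    linarith
  · congr 1
    ring

theorem symbol_eq (μ : ℂ) (ξ : Eu m) :
    symbol m μ ξ = symbolCoeff 0 μ • homKer 0 μ ξ + symbolCoeff 1 μ • homKer 1 μ ξ := by
  rw [symbol, symbolCoeff, symbolCoeff, pow_zero, mul_one, pow_one]

theorem integral_add_add {f₁ f₂ f₃ f₄ : Eu m → Cl m} (h₁ : Integrable f₁) (h₂ : Integrable f₂)
    (h₃ : Integrable f₃) (h₄ : Integrable f₄) :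
    ∫ y, (f₁ y + f₂ y + (f₃ y + f₄ y))
      = (∫ y, f₁ y) + (∫ y, f₂ y) + ((∫ y, f₃ y) + ∫ y, f₄ y) := by
  rw [← integral_add h₁ h₂, ← integral_add h₃ h₄]
  exact integral_add (h₁.add h₂) (h₃.add h₄)

/-- Each kernel splits into two parity parts. The four products recombine under the integral into
the product of symbols. -/
theorem isOrdinaryConvolution_of_ne (hm : 1 ≤ m) {μ ν : ℂ} (hμ : Admissible m μ)
    (hν : Admissible m ν) (hs : Admissible m (μ + ν)) (hμn : ∀ n : ℕ, μ ≠ n) (hνn : ∀ n : ℕ, ν ≠ n)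
    (hre : -(m : ℝ) < (μ + ν).re) :
    IsOrdinaryConvolution (diracPow m μ) (diracPow m ν) (diracPow m (μ + ν)) := by
  intro φ ψ
  obtain ⟨i00, e00⟩ := powPart_regularize_mul hm zero_le_one zero_le_one hμ hν hμn hνn hre φ ψ
  obtain ⟨i01, e01⟩ := powPart_regularize_mul hm zero_le_one le_rfl hμ hν hμn hνn hre φ ψ
  obtain ⟨i10, e10⟩ := powPart_regularize_mul hm le_rfl zero_le_one hμ hν hμn hνn hre φ ψ
  obtain ⟨i11, e11⟩ := powPart_regularize_mul hm le_rfl le_rfl hμ hν hμn hνn hre φ ψ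
  rw [(fourierIsFun_diracPow hm hs hre).integral_smul_regularize]
  rw [diracPow_eq_add, diracPow_eq_add]
  simp only [regularize_add, add_mul, mul_add]
  refine ⟨(i00.add i10).add (i01.add i11), ?_⟩
  rw [integral_add_add i00 i10 i01 i11, e00, e01, e10, e11]
  have hI : ∀ (c : ℂ) k, Integrable fun ξ => c • fourierMul φ ψ ξ • homKer (m := m) k (μ + ν) ξ :=
    fun c k => ((isHom_homKer k (μ + ν)).integrable hm hre _).smul c
  simp only [← integral_smul]
  rw [← integral_add_add (hI _ _) (hI _ _) (hI _ _) (hI _ _)]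
  refine integral_congr_ae ?_
  filter_upwards [ae_ne_zero hm] with ξ hξ
  rw [← symbol_mul μ ν hξ, symbol_eq, symbol_eq, add_mul, mul_add, mul_add]
  simp only [smul_mul_smul_comm, homKer_mul_homKer _ _ μ ν hξ, fourierMul_apply]
  module

end Convolution

section Integer

variable {m : ℕ}

/-! ### The recursion `∂ ∂^μ δ = ∂^(μ+1) δ` -/

/-- The function `ω ↦ ωⱼ eⱼ h(ω)` on the sphere. -/
def coordSphere (j : Fin m) (h : C(Sph m, Cl m)) : C(Sph m, Cl m) where
  toFun ω := (((ω : Eu m) j : ℝ) : ℂ) • mulCLM m (e j) (h ω)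
  continuous_toFun := by fun_prop

/-- The coordinate rωⱼ contributes r to the ray exponent and ωⱼ to the sphere function. The shift is
exact also at the poles, so no exponent is excluded. -/
theorem e_mul_homDist_coordMul (j : Fin m) (h : C(Sph m, Cl m)) (lam : ℂ) (φ : 𝓢(Eu m, ℂ)) :
    e j * homDist h lam (coordMul j φ) = homDist (coordSphere j h) (lam + 1) φ := by
  set h' : C(Sph m, Cl m) := ⟨fun ω => (((ω : Eu m) j : ℝ) : ℂ) • h ω, by fun_prop⟩ with hh'
  have h1 : ∀ r : ℝ, sphericalMean h (coordMul j φ) r = (r : ℂ) • sphericalMean h' φ r := by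
    intro r
    rw [sphericalMean_apply, sphericalMean_apply, ← integral_smul]
    refine integral_congr_ae (Eventually.of_forall fun ω => ?_)
    simp only [coordMul_apply, hh', ContinuousMap.coe_mk, smul_smul, PiLp.smul_apply, smul_eq_mul]
    push_cast
    congr 1
    ring
  have h2 : ∀ r : ℝ, sphericalMean (coordSphere j h) φ r
      = mulCLM m (e j) (sphericalMean h' φ r) := by
    intro r
    rw [sphericalMean_apply, sphericalMean_apply,
      ← (mulCLM m (e j)).integral_comp_comm (integrable_sphere h'.continuous φ r)]
    refine integral_congr_ae (Eventually.of_forall fun ω => ?_)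
    simp only [hh', ContinuousMap.coe_mk, map_smul, coordSphere]
  rw [homDist_apply, homDist_apply, fpRayFun_of_eq_smul _ h1,
    show lam + m - 1 + 1 = lam + 1 + m - 1 by ring, clm_fpRayFun _ _ h2, mulCLM_apply]

theorem homDist_sum {ι : Type*} (s : Finset ι) (h : ι → C(Sph m, Cl m)) (lam : ℂ)
    (φ : 𝓢(Eu m, ℂ)) : homDist (∑ i ∈ s, h i) lam φ = ∑ i ∈ s, homDist (h i) lam φ := by
  have h0 : homDist (0 : C(Sph m, Cl m)) lam φ = 0 := by
    have := homDist_smul 0 (0 : C(Sph m, Cl m)) lam φ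
    rwa [zero_smul, zero_smul] at this
  exact map_sum ({ toFun := fun h => homDist h lam φ, map_zero' := h0,
                   map_add' := fun h h' => homDist_add h h' lam φ } : C(Sph m, Cl m) →+ Cl m) h s

/-- Multiplication by iω fixes P₊ and changes the sign of P₋, and e^{iπ(μ+1)} = -e^{iπμ}. -/
theorem symbolSphere_succ (μ : ℂ) :
    (2 * Real.pi * Complex.I) • ∑ j, coordSphere j (symbolSphere m μ) = symbolSphere m (μ + 1) := by
  have hpi : (2 * Real.pi : ℂ) ≠ 0 := by exact_mod_cast (mul_pos two_pos Real.pi_pos).ne'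
  ext1 ω
  have h1 : (∑ j, coordSphere j (symbolSphere m μ)) ω = vec (ω : Eu m) * symbolSphere m μ ω := by
    rw [ContinuousMap.sum_apply, vec, Finset.sum_mul]
    refine Finset.sum_congr rfl fun j _ => ?_
    simp only [coordSphere, ContinuousMap.coe_mk, mulCLM_apply, smul_mul_assoc]
  have hv : vec (ω : Eu m) * vec (ω : Eu m) = (-1 : ℂ) • (1 : Cl m) := by
    rw [vec_mul_vec]; simp
  rw [ContinuousMap.smul_apply, h1]
  simp only [symbolSphere, ContinuousMap.add_apply, ContinuousMap.smul_apply, vecPow_apply, pow_zero,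
    pow_one, mul_add, mul_smul_comm, mul_one, hv, parityFactor]
  rw [Complex.exp_add, Complex.cpow_add _ _ hpi, Complex.cpow_one,
    mul_comm Complex.I (Real.pi : ℂ), Complex.exp_pi_mul_I]
  have e1 : ∀ a b c d a' b' : ℂ, c * b * d = a' → c * a = b' → ∀ x : Cl m,
      c • (a • x + b • d • (1 : Cl m)) = a' • (1 : Cl m) + b' • x := by
    rintro a b c d _ _ rfl rfl x
    module
  refine e1 _ _ _ _ _ _ ?_ ?_ _
  · linear_combination -(2 * Real.pi) * (2 * Real.pi : ℂ) ^ μ *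
      ((1 + -1 * Complex.exp (Real.pi * Complex.I * μ)) / 2) * Complex.I_mul_I
  · ring

theorem admissible_add_natCast {μ : ℂ} (hμ : Admissible m μ) (n : ℕ) : Admissible m (μ + n) := by
  intro he j hj
  refine hμ he (n + j) ?_
  push_cast
  linear_combination hj

theorem fourier_apply_inj {u v : ClDistribution m} (h : ∀ φ, 𝓕 u φ = 𝓕 v φ) : u = v :=
  dist_ext fun φ => by
    have h1 := h (𝓕⁻ φ)
    rwa [TemperedDistribution.fourier_apply, TemperedDistribution.fourier_apply,
      FourierTransform.fourier_fourierInv_eq] at h1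

theorem dirac_diracPow (hm : 1 ≤ m) {μ : ℂ} (hμ : Admissible m μ) :
    dirac (diracPow m μ) = diracPow m (μ + 1) := by
  have hμ1 : Admissible m (μ + 1) := by simpa using admissible_add_natCast hμ 1
  refine fourier_apply_inj fun φ => ?_
  rw [fourier_dirac_apply, fourier_diracPow hm hμ1, ← symbolSphere_succ, homDist_smul, homDist_sum]
  congr 1
  refine Finset.sum_congr rfl fun j _ => ?_
  rw [fourier_diracPow hm hμ, e_mul_homDist_coordMul]

theorem admissible_natCast (hm : 1 ≤ m) (n : ℕ) : Admissible m n := by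
  intro _ j hj
  have h1 : ((n + m + j : ℕ) : ℂ) = 0 := by push_cast; linear_combination hj
  have h2 : n + m + j = 0 := by exact_mod_cast h1
  omega

theorem diracPow_zero (hm : 1 ≤ m) : diracPow m 0 = delta m := by
  have h0 : Admissible m 0 := by simpa using admissible_natCast hm 0
  have hre : -(m : ℝ) < (0 : ℂ).re := by
    have : (0 : ℝ) < m := by exact_mod_cast hm
    simpa using this
  refine fourier_apply_inj fun φ => ?_
  rw [(fourierIsFun_diracPow hm h0 hre).eq, fourierIsFun_delta.eq]
  simp [symbol, homKer, parityFactor]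

/-! ### Convolution with integer powers -/

theorem neg_lineDeriv_reflTranslate (v x : Eu m) (φ : 𝓢(Eu m, ℂ)) :
    -∂_{v} (reflTranslate x φ) = reflTranslate x (∂_{v} φ) := by
  ext y
  have h1 : HasFDerivAt (reflTranslate x φ)
      ((fderiv ℝ φ (x - y)).comp (-ContinuousLinearMap.id ℝ (Eu m))) y :=
    (φ.differentiableAt.hasFDerivAt).comp y ((hasFDerivAt_id y).const_sub x)
  rw [reflTranslate_apply, neg_apply, SchwartzMap.lineDerivOp_apply_eq_fderiv,
    SchwartzMap.lineDerivOp_apply_eq_fderiv, h1.fderiv]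
  simp

theorem regularize_dirac (u : ClDistribution m) (φ : 𝓢(Eu m, ℂ)) (x : Eu m) :
    regularize (dirac u) φ x
      = ∑ j, mulCLM m (e j) (regularize u (∂_{EuclideanSpace.single j (1 : ℝ)} φ) x) := by
  rw [regularize, dirac_apply]
  simp only [neg_lineDeriv_reflTranslate]
  rfl

/-- Derivatives pass to φ, and the generators, acting from the left, come out of the product and of
the integral. -/
theorem IsOrdinaryConvolution.dirac {u v w : ClDistribution m} (h : IsOrdinaryConvolution u v w)
    (hw : IsSymmetricAction w) :
    IsOrdinaryConvolution (DiracPowers.dirac u) v (DiracPowers.dirac w) := by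
  intro φ ψ
  have e1 : ∀ y, regularize (DiracPowers.dirac u) φ (-y) * regularize v ψ y
      = ∑ j, mulCLM m (e j) (regularize u (∂_{EuclideanSpace.single j (1 : ℝ)} φ) (-y) *
          regularize v ψ y) := by
    intro y
    rw [regularize_dirac, Finset.sum_mul]
    simp only [mulCLM_apply, mul_assoc]
  have e2 : ∀ y, ψ y • regularize (DiracPowers.dirac w) φ (-y)
      = ∑ j, mulCLM m (e j) (ψ y • regularize w (∂_{EuclideanSpace.single j (1 : ℝ)} φ) (-y)) := by
    intro y
    rw [regularize_dirac, Finset.smul_sum]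
    simp only [map_smul]
  have i1 : ∀ j, Integrable fun y => mulCLM m (e j)
      (regularize u (∂_{EuclideanSpace.single j (1 : ℝ)} φ) (-y) * regularize v ψ y) :=
    fun j => (mulCLM m (e j)).integrable_comp (h _ _).1
  have i2 : ∀ j, Integrable fun y => mulCLM m (e j)
      (ψ y • regularize w (∂_{EuclideanSpace.single j (1 : ℝ)} φ) (-y)) :=
    fun j => (mulCLM m (e j)).integrable_comp (hw _ _).1
  simp only [e1, e2]
  refine ⟨integrable_finsetSum _ fun j _ => i1 j, ?_⟩
  rw [integral_finsetSum _ fun j _ => i1 j, integral_finsetSum _ fun j _ => i2 j]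
  refine Finset.sum_congr rfl fun j _ => ?_
  rw [(mulCLM m (e j)).integral_comp_comm (h _ _).1, (mulCLM m (e j)).integral_comp_comm (hw _ _).1,
    (h _ _).2]

/-- Regularising δ returns φ itself, so convolution with δ is the symmetry of the action after y ↦
-y. -/
theorem IsSymmetricAction.delta {v : ClDistribution m} (hv : IsSymmetricAction v) :
    IsOrdinaryConvolution (DiracPowers.delta m) v v := by
  intro φ ψ
  have e1 : ∀ y, regularize (DiracPowers.delta m) φ (-y) * regularize v ψ y
      = φ (-y) • regularize v ψ y := by
    intro y
    rw [regularize, delta_apply, reflTranslate_apply, sub_zero, smul_mul_assoc, one_mul]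
  simp only [e1]
  have h1 := (hv ψ φ).1.comp_neg
  simp only [neg_neg] at h1
  refine ⟨h1, ?_⟩
  rw [(hv φ ψ).2, ← integral_neg_eq_self fun y => φ y • regularize v ψ (-y)]
  simp only [neg_neg]

theorem isOrdinaryConvolution_natCast (hm : 1 ≤ m) (n : ℕ) {ν : ℂ} (hν : Admissible m ν) :
    IsOrdinaryConvolution (diracPow m n) (diracPow m ν) (diracPow m (n + ν)) := by
  induction n with
  | zero =>
    rw [Nat.cast_zero, diracPow_zero hm, zero_add]
    exact (isSymmetricAction_diracPow hm hν).delta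
  | succ n ih =>
    have h1 : Admissible m (n + ν) := by
      rw [add_comm]; exact admissible_add_natCast hν n
    have h2 := ih.dirac (isSymmetricAction_diracPow hm h1)
    rw [dirac_diracPow hm (admissible_natCast hm n), dirac_diracPow hm h1] at h2
    rw [Nat.cast_succ, add_right_comm]
    exact h2

/-! ### Reversion -/

theorem rev_symbolSphere (μ : ℂ) (ω : Sph m) : rev m (symbolSphere m μ ω) = symbolSphere m μ ω := by
  simp [symbolSphere, rev_one, rev_vec]

/-- The symbol is a combination of 1 and a vector, both fixed by reversal, and reversal commutes
with the finite part. -/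
theorem rev_diracPow (hm : 1 ≤ m) {μ : ℂ} (hμ : Admissible m μ) (φ : 𝓢(Eu m, ℂ)) :
    rev m (diracPow m μ φ) = diracPow m μ φ := by
  have h1 : diracPow m μ φ = homDist (symbolSphere m μ) μ (𝓕⁻ φ) := by
    rw [← fourier_diracPow hm hμ, TemperedDistribution.fourier_apply,
      FourierTransform.fourier_fourierInv_eq]
  rw [h1, homDist_apply, ← clm_fpRayFun (rev m) _ (f := sphericalMean (symbolSphere m μ) (𝓕⁻ φ))]
  intro r
  rw [sphericalMean_apply,
    ← (rev m).integral_comp_comm (integrable_sphere (symbolSphere m μ).continuous _ r)]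
  simp only [map_smul, rev_symbolSphere]

theorem isOrdinaryConvolution_natCast_right (hm : 1 ≤ m) {μ : ℂ} (hμ : Admissible m μ) (n : ℕ) :
    IsOrdinaryConvolution (diracPow m μ) (diracPow m n) (diracPow m (μ + n)) := by
  intro φ ψ
  have hs := admissible_add_natCast hμ n
  -- The case of a natural left factor, with the test functions exchanged: reversal swaps the
  -- factors and y ↦ -y restores the arguments.
  obtain ⟨hi, he⟩ := isOrdinaryConvolution_natCast hm n hμ ψ φ
  rw [add_comm] at he
  have hr : ∀ {μ : ℂ}, Admissible m μ → ∀ (φ : 𝓢(Eu m, ℂ)) x,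
      rev m (regularize (diracPow m μ) φ x) = regularize (diracPow m μ) φ x :=
    fun h φ x => rev_diracPow hm h _
  have e1 : ∀ y, regularize (diracPow m μ) φ (-y) * regularize (diracPow m n) ψ y
      = rev m (regularize (diracPow m n) ψ y * regularize (diracPow m μ) φ (-y)) := by
    intro y
    rw [rev_mul, hr hμ, hr (admissible_natCast hm n)]
  simp only [e1]
  have hi' : Integrable fun y =>
      regularize (diracPow m n) ψ y * regularize (diracPow m μ) φ (-y) := by
    simpa only [neg_neg] using hi.comp_neg
  refine ⟨(rev m).integrable_comp hi', ?_⟩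
  have e2 : ∫ y, regularize (diracPow m n) ψ y * regularize (diracPow m μ) φ (-y)
      = ∫ y, φ y • regularize (diracPow m (μ + n)) ψ (-y) := by
    rw [← he, ← integral_neg_eq_self]
    simp only [neg_neg]
  rw [(rev m).integral_comp_comm hi', e2,
    ← (rev m).integral_comp_comm (isSymmetricAction_diracPow hm hs ψ φ).1]
  simp only [map_smul, hr hs]
  exact ((isSymmetricAction_diracPow hm hs φ ψ).2).symm

end Integer

end DiracPowers

end

theorem proposition4p1 (m : ℕ) (hm : 1 ≤ m) (μ ν : ℂ)
    (h : Even m → ∀ n : ℕ, μ ≠ -m - n ∧ ν ≠ -m - n ∧ μ + ν ≠ -m - n) :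
    DiracPowers.IsConvolution (DiracPowers.diracPow m μ) (DiracPowers.diracPow m ν)
        (DiracPowers.diracPow m (μ + ν)) ∧
      ((-(m : ℝ) < (μ + ν).re ∨ (∃ k : ℕ, μ = k) ∨ (∃ k : ℕ, ν = k)) →
        DiracPowers.IsOrdinaryConvolution (DiracPowers.diracPow m μ) (DiracPowers.diracPow m ν)
          (DiracPowers.diracPow m (μ + ν))) := by
  have hμ : DiracPowers.Admissible m μ := fun he n => (h he n).1
  have hν : DiracPowers.Admissible m ν := fun he n => (h he n).2.1
  have hs : DiracPowers.Admissible m (μ + ν) := fun he n => (h he n).2.2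
  refine ⟨DiracPowers.isConvolution_diracPow hm hμ hν hs, fun hcase => ?_⟩
  -- Natural exponents are treated first, without any condition on Re(μ + ν); the analytic argument
  -- needs both exponents to be non-natural.
  by_cases hμn : ∃ k : ℕ, μ = k
  · obtain ⟨k, rfl⟩ := hμn
    exact DiracPowers.isOrdinaryConvolution_natCast hm k hν
  by_cases hνn : ∃ k : ℕ, ν = k
  · obtain ⟨k, rfl⟩ := hνn
    exact DiracPowers.isOrdinaryConvolution_natCast_right hm hμ k
  have hre : -(m : ℝ) < (μ + ν).re := by tauto
  exact DiracPowers.isOrdinaryConvolution_of_ne hm hμ hν hs (not_exists.1 hμn) (not_exists.1 hνn) hre
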